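/- Let $m$ be fixed. For each $N\ge 1$ let $\Lambda=\Lambda_N=(\lambda_1,\dots,\lambda_N)^\top\in\mathbb R^{N\times m}$ and $A=A_N\in\mathbb R^{N\times N}$ be deterministic, put $\Sigma_\epsilon=AA^\top$, and let the observations be $y_t=\Lambda f_t+\epsilon_t\in\mathbb R^N$, $t=1,\dots,T$. Assume the following. (1) $(f_t^\top,\epsilon_t^\top)^\top=\xi_t\begin{pmatrix}I_m&0\\0&A\end{pmatrix}g_t/\|g_t\|_2$, where the pairs $(\xi_t,g_t)$ are independent over $t$, $\xi_t$ is independent of $g_t$, $g_t\sim\mathcal N(0,I_{m+N})$, and the $\xi_t$ are distributed as a scalar random variable $\xi=\xi^{(N)}$ with $P(\xi=0)=0$ and $\xi/\sqrt N=O_p(1)$ as $N\to\infty$. Moreover the largest diagonal entry of $\Sigma_0=\operatorname{diag}(I_m,\Sigma_\epsilon)$ is $1$. (2) $\|\lambda_i\|_2$ is bounded uniformly in $i\le N$ and $N$, and $\Lambda^\top\Lambda/N\to V$ as $N\to\infty$, where $V$ is positive definite with distinct eigenvalues. (3) There are constants $c_1,c_2>0$, not depending on $N$, such that all eigenvalues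 of $\Sigma_\epsilon$ lie in $[c_2,c_1]$. Let $\widehat K_y=\frac{2}{T(T-1)}\sum_{t<s}\frac{(y_t-y_s)(y_t-y_s)^\top}{\|y_t-y_s\|_2^2}$ be the sample spatial Kendall's tau matrix, let $\widehat V$ be the diagonal matrix of its $m$ largest eigenvalues in descending order, and let the robust two-step (RTS) loading estimator $\widetilde\Lambda=(\tilde\lambda_1,\dots,\tilde\lambda_N)^\top\in\mathbb R^{N\times m}$ be $\sqrt N$ times any choice of corresponding orthonormal eigenvectors, that is, $\widetilde\Lambda^\top\widetilde\Lambda=N I_m$ and $\widehat K_y\widetilde\Lambda=\widetilde\Lambda\widehat V$. Put $$\widehat H=M_1\Lambda^\top\widetilde\Lambda\widehat V^{-1},\qquad M_1=\frac{2}{T(T-1)}\sum_{t<s}\frac{(f_t-f_s)(f_t-f_s)^\top}{\|y_t-y_s\|_2^2}$$ (with $\widehat V^{-1}$ replaced by $0$ where $\widehat V$ is singular). Then, as $N,T\to\infty$, $\widehat H^\top V\widehat H\to I_m$ in probability and $$\max_{1\le i\le N}\big\|\tilde\lambda_i-\widehat H^\top\lambda_i\big\|_2=O_p\big(N^{-1/2}\big)+O_p\big((N/T)^{1/2}\big).$$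 -/

import Mathlib

open MeasureTheory ProbabilityTheory Filter Topology Matrix

noncomputable section

namespace RTS

/-- The Euclidean norm of a plain coordinate vector. -/
def l2norm {ι : Type*} [Fintype ι] (v : ι → ℝ) : ℝ := ‖WithLp.toLp 2 v‖

/-- `X i = O_p(a i)` along the filter `l`: for every `δ > 0` there is a constant `C` such that
eventually `P(|X i| > C * a i) ≤ δ`. -/
def IsBigOp {Ω ι : Type*} [MeasurableSpace Ω] (P : Measure Ω) (l : Filter ι)
    (X : ι → Ω → ℝ) (a : ι → ℝ) : Prop :=
  ∀ δ : ℝ, 0 < δ → ∃ C : ℝ, ∀ᶠ i in l, P {ω | C * a i < |X i ω|} ≤ ENNReal.ofReal δ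

/-- The `j`-th largest eigenvalue (`j = 0, 1, …`, counted with multiplicity) of a symmetric
matrix; `0` beyond the size of the matrix. -/
def descEig {N : ℕ} {K : Matrix (Fin N) (Fin N) ℝ} (hK : K.IsHermitian) (j : ℕ) : ℝ :=
  if h : j < Fintype.card (Fin N) then hK.eigenvalues₀ ⟨j, h⟩ else 0

/-- `(2 / (T (T - 1))) ∑_{t < s} (a_t - a_s) (b_t - b_s)ᵀ / ‖y_t - y_s‖²` over the sample
points `t, s ∈ {0, …, T - 1}`. -/
def pairAverage {N p q : ℕ} (T : ℕ) (y : ℕ → Fin N → ℝ) (a : ℕ → Fin p → ℝ)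
    (b : ℕ → Fin q → ℝ) : Matrix (Fin p) (Fin q) ℝ :=
  (2 / ((T : ℝ) * ((T : ℝ) - 1))) •
    ∑ s ∈ Finset.range T, ∑ t ∈ Finset.range s,
      (l2norm (y t - y s) ^ 2)⁻¹ • vecMulVec (a t - a s) (b t - b s)

/-- The sample spatial Kendall's tau matrix of `y_0, …, y_{T-1}`. -/
def kendall {N : ℕ} (T : ℕ) (y : ℕ → Fin N → ℝ) : Matrix (Fin N) (Fin N) ℝ :=
  pairAverage T y y y

theorem kendall_isHermitian {N : ℕ} (T : ℕ) (y : ℕ → Fin N → ℝ) :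
    (kendall T y).IsHermitian := by
  ext i j
  simp [kendall, pairAverage, Matrix.sum_apply, vecMulVec_apply, mul_comm]

theorem scatter_isHermitian {N : ℕ} (A : Matrix (Fin N) (Fin N) ℝ) :
    (A * Aᵀ).IsHermitian := by
  simpa using Matrix.isHermitian_mul_conjTranspose_self A

/-- The diagonal matrix of the `m` largest eigenvalues of the sample Kendall's tau matrix. -/
def eigMatrix {N : ℕ} (m T : ℕ) (y : ℕ → Fin N → ℝ) : Matrix (Fin m) (Fin m) ℝ :=
  diagonal fun j => descEig (kendall_isHermitian T y) j

/-- `L` is a robust two-step loading estimate: its columns are `√N` times orthonormal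
eigenvectors of the sample Kendall's tau matrix, belonging to the `m` largest eigenvalues in
descending order. -/
def IsRTSLoading {N m : ℕ} (T : ℕ) (y : ℕ → Fin N → ℝ) (L : Matrix (Fin N) (Fin m) ℝ) : Prop :=
  Lᵀ * L = (N : ℝ) • (1 : Matrix (Fin m) (Fin m) ℝ) ∧ kendall T y * L = L * eigMatrix m T y

/-- The rotation matrix `Ĥ = M₁ Λᵀ Λ̃ V̂⁻¹`, with
`M₁ = (2 / (T (T - 1))) ∑_{t < s} (f_t - f_s) (f_t - f_s)ᵀ / ‖y_t - y_s‖²`. -/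
def rotation {N m : ℕ} (T : ℕ) (Λ : Matrix (Fin N) (Fin m) ℝ) (f : ℕ → Fin m → ℝ)
    (y : ℕ → Fin N → ℝ) (L : Matrix (Fin N) (Fin m) ℝ) : Matrix (Fin m) (Fin m) ℝ :=
  pairAverage T y f f * Λᵀ * L * (eigMatrix m T y)⁻¹

/-- `max_i ‖λ̃_i - Hᵀ λ_i‖₂`, where `λ̃_i`, `λ_i` are the rows of `L`, `Λ`. -/
def maxError {N m : ℕ} (L Λ : Matrix (Fin N) (Fin m) ℝ) (H : Matrix (Fin m) (Fin m) ℝ) : ℝ :=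
  ⨆ i : Fin N, l2norm (L i - Hᵀ *ᵥ Λ i)

/-- The stacked scatter matrix `diag(I_m, A Aᵀ)` of factors and idiosyncratic errors. -/
def scatter (m : ℕ) {N : ℕ} (A : Matrix (Fin N) (Fin N) ℝ) :
    Matrix (Fin m ⊕ Fin N) (Fin m ⊕ Fin N) ℝ :=
  fromBlocks 1 0 0 (A * Aᵀ)

/-- The factor model with jointly elliptical factors and errors, for each cross-sectional
dimension `N`. For fixed `N` the sample is indexed by `t = 0, 1, 2, …`; nothing is assumed on the
joint law of the samples for different `N`. -/
structure EllipticalFactorModel {Ω : Type*} [MeasurableSpace Ω] (P : Measure Ω) (m : ℕ)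
    (Λ : (N : ℕ) → Matrix (Fin N) (Fin m) ℝ) (A : (N : ℕ) → Matrix (Fin N) (Fin N) ℝ)
    (ξ : ℕ → ℕ → Ω → ℝ) (g : (N : ℕ) → ℕ → Ω → Fin m ⊕ Fin N → ℝ)
    (f : (N : ℕ) → ℕ → Ω → Fin m → ℝ) (e y : (N : ℕ) → ℕ → Ω → Fin N → ℝ) : Prop where
  measurable_radius : ∀ N t, Measurable (ξ N t)
  measurable_gaussian : ∀ N t, Measurable (g N t)
  /-- The pairs `(ξ_t, g_t)` are independent over `t`. -/
  indep_time : ∀ N, iIndepFun (fun t ω => (ξ N t ω, g N t ω)) P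
  indep_radius : ∀ N t, IndepFun (ξ N t) (g N t) P
  identDistrib_radius : ∀ N t, IdentDistrib (ξ N t) (ξ N 0) P P
  gaussian_law : ∀ N t, P.map (g N t) = Measure.pi fun _ => gaussianReal 0 1
  /-- The radius does not vanish, so that Kendall's tau is well defined almost surely. -/
  radius_ne_zero : ∀ N, 1 ≤ N → ∀ᵐ ω ∂P, ξ N 0 ω ≠ 0
  /-- `ξ / √N = O_p(1)` as `N → ∞`. -/
  radius_bounded : IsBigOp P atTop (fun N ω => ξ N 0 ω / √(N : ℝ)) fun _ => 1
  /-- `(fᵀ, eᵀ)ᵀ = ξ diag(I_m, A) g / ‖g‖`. -/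
  representation : ∀ N t ω, Sum.elim (f N t ω) (e N t ω) =
    ξ N t ω • (fromBlocks (1 : Matrix (Fin m) (Fin m) ℝ) 0 0 (A N) *ᵥ
      ((l2norm (g N t ω))⁻¹ • g N t ω))
  observation : ∀ N t ω, y N t ω = Λ N *ᵥ f N t ω + e N t ω
  /-- `‖diag(Σ₀)‖_∞ = 1` (the norm on a function type is the sup norm). -/
  identifiable : ∀ N, 1 ≤ N → ‖fun j => scatter m (A N) j j‖ = 1

/-- Bounded loadings, and `Λᵀ Λ / N → V` with `V` positive definite with distinct eigenvalues. -/
structure LoadingAssumption {m : ℕ} (Λ : (N : ℕ) → Matrix (Fin N) (Fin m) ℝ)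
    (V : Matrix (Fin m) (Fin m) ℝ) : Prop where
  bounded : ∃ C : ℝ, ∀ N i, l2norm (Λ N i) ≤ C
  limit : Tendsto (fun N : ℕ => (N : ℝ)⁻¹ • ((Λ N)ᵀ * Λ N)) atTop (𝓝 V)
  posDef : V.PosDef
  distinct : StrictAnti posDef.isHermitian.eigenvalues₀
  eigenvalue_bounds : ∃ c₁ c₂ : ℝ, 0 < c₁ ∧ 0 < c₂ ∧
    ∀ j, c₂ ≤ posDef.isHermitian.eigenvalues₀ j ∧ posDef.isHermitian.eigenvalues₀ j ≤ c₁

/-- The eigenvalues of `Σ_ε = A Aᵀ` are bounded above and away from zero, uniformly in `N`. -/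
def NoiseAssumption (A : (N : ℕ) → Matrix (Fin N) (Fin N) ℝ) : Prop :=
  ∃ c₁ c₂ : ℝ, 0 < c₁ ∧ 0 < c₂ ∧ ∀ N i,
    c₂ ≤ (scatter_isHermitian (A N)).eigenvalues i ∧
      (scatter_isHermitian (A N)).eigenvalues i ≤ c₁

end RTS

end

/-! Write `R = K̂ - Λ M₁ Λᵀ`. The eigenvector equation gives `Λ̃ - Λ Ĥ = R Λ̃ V̂⁻¹`. The columns of
`Λ̃` have norm `√N`, so if the `m` leading sample eigenvalues are at least `c > 0`, every column of
the error, and hence every row up to the constant `m`, is at most `√N ‖R‖ / c`. The rate therefore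
follows from `‖R‖ = O_p(1/N + T^(-1/2))` in operator norm and a lower bound on the eigenvalues.

Both come from treating the entries of `K̂` and `R` as U-statistics of order two. With `w = ξ g/‖g‖
- ξ' g'/‖g'‖ = (h, k)`, an observation difference is `Λ h + A k`. The direction of `w` is uniform on
the sphere, and the kernels are homogeneous of degree zero, so they have the same law as under a
standard Gaussian `w` (`map_homogeneous_pair`). All population quantities become Gaussian integrals.
The variance bound for U-statistics, summed over entries, controls the Frobenius error by the mean
squared Frobenius norm of the kernel over `T` (`RadialSample.prob_frobenius_le`). The kernels have
rank at most two and their Frobenius norms have second moments bounded in `N`, so no dimension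
factor appears.

The mean of `R` must be `O(1/N)`. The noise-noise part is of that order because `N / ‖y‖²` has
bounded moments (`exists_octicBound_div_obs`). The factor-noise part is naively `O(N^(-1/2))`;
averaging it with its image under `k ↦ -k` leaves only the difference of two inverse squared norms,
which gains another `N^(-1/2)` (`OcticDesign.abs_integral_common_idio_le`).

For the eigenvalues, Cauchy–Schwarz gives `E (x·y)²/‖y‖² ≥ (E|x·y|)² / E‖y‖²`, which is bounded
below on the range of `Λ`, and Courant–Fischer transfers this to `K̂`. Finally `Λ Ĥ = Λ̃ - E` with
`E` small gives `Ĥᵀ (ΛᵀΛ/N) Ĥ ≈ I`. This also bounds `Ĥ`, so `ΛᵀΛ/N` may be replaced by `V`. -/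

noncomputable section

namespace RTS

/-! ### Uniformity of the direction of a difference of spherical vectors -/

section Sphere

variable {E : Type*} [NormedAddCommGroup E] [InnerProductSpace ℝ E] [FiniteDimensional ℝ E]
  [MeasurableSpace E] [BorelSpace E]

/-- The law of a linear form under the standard Gaussian measure. -/
theorem stdGaussian_map_inner (a : E) :
    (stdGaussian E).map (fun x => inner ℝ a x) = gaussianReal 0 (‖a‖ ^ 2).toNNReal := by
  have h := IsGaussian.map_eq_gaussianReal (μ := stdGaussian E) (innerSL ℝ a)
  rw [integral_strongDual_stdGaussian, variance_dual_stdGaussian, innerSL_apply_norm] at h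
  exact h

theorem stdGaussian_orthogonal_eq_zero {a : E} (ha : a ≠ 0) :
    stdGaussian E {x | inner ℝ a x = 0} = 0 := by
  have hm : Measurable fun x : E => inner ℝ a x := by fun_prop
  have h : (stdGaussian E).map (fun x => inner ℝ a x) {0} = 0 := by
    rw [stdGaussian_map_inner]
    have : (‖a‖ ^ 2).toNNReal ≠ 0 := by
      simpa using ha
    have := nullSingletonClass_gaussianReal (μ := 0) this
    exact measure_singleton 0
  rwa [Measure.map_apply hm (measurableSet_singleton 0)] at h

/-- In dimension at least two some nonzero vector is orthogonal to `z`, so the line through `z` lies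
in a null hyperplane. -/
theorem stdGaussian_span_singleton_eq_zero (hE : 2 ≤ Module.finrank ℝ E) (z : E) :
    stdGaussian E {x | x ∈ Submodule.span ℝ {z}} = 0 := by
  have hne : (Submodule.span ℝ {z})ᗮ ≠ ⊥ := by
    intro h
    have h1 := Submodule.finrank_add_finrank_orthogonal (Submodule.span ℝ {z})
    rw [h, finrank_bot] at h1
    have h2 := finrank_span_le_card (R := ℝ) ({z} : Set E)
    simp only [Set.toFinset_singleton, Finset.card_singleton] at h2
    omega
  obtain ⟨a, ha, ha0⟩ := Submodule.exists_mem_ne_zero_of_ne_bot hne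
  refine measure_mono_null (fun x hx => ?_) (stdGaussian_orthogonal_eq_zero ha0)
  exact Submodule.inner_left_of_mem_orthogonal hx ha

/-- A probability measure on the unit sphere that is invariant under all linear isometries is
unique. -/
theorem eq_of_isometry_invariant_of_norm_eq_one (μ ν : Measure E) [IsProbabilityMeasure μ]
    [IsProbabilityMeasure ν] (hμ : ∀ O : E ≃ₗᵢ[ℝ] E, μ.map O = μ)
    (hν : ∀ O : E ≃ₗᵢ[ℝ] E, ν.map O = ν) (hμ1 : ∀ᵐ x ∂μ, ‖x‖ = 1) (hν1 : ∀ᵐ x ∂ν, ‖x‖ = 1) :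
    μ = ν := by
  -- Invariance makes the characteristic function radial: a reflection carries `s` to any `t` of the
  -- same norm.
  have key : ∀ (ρ : Measure E) [IsProbabilityMeasure ρ], (∀ O : E ≃ₗᵢ[ℝ] E, ρ.map O = ρ) →
      ∀ s t : E, ‖s‖ = ‖t‖ → charFun ρ s = charFun ρ t := by
    intro ρ _ hρ s t hst
    set O : E ≃ₗᵢ[ℝ] E := Submodule.reflection (ℝ ∙ (s - t))ᗮ with hO
    have hOs : O s = t := Submodule.reflection_sub hst
    rw [← hOs, charFun_apply, charFun_apply]
    conv_rhs => rw [← hρ O]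
    rw [integral_map O.continuous.aemeasurable (by fun_prop)]
    simp only [LinearIsometryEquiv.inner_map_map]
  -- Being radial, it may be averaged over `‖t‖ • y` with `y` drawn from any law `τ` on the unit
  -- sphere. The resulting double integral is symmetric in the two measures, so Fubini identifies
  -- them.
  have avg : ∀ (ρ τ : Measure E) [IsProbabilityMeasure ρ] [IsProbabilityMeasure τ],
      (∀ O : E ≃ₗᵢ[ℝ] E, ρ.map O = ρ) → (∀ᵐ x ∂τ, ‖x‖ = 1) → ∀ t : E, charFun ρ t =
        ∫ y, ∫ x, Complex.exp ((inner ℝ x (‖t‖ • y) : ℝ) * Complex.I) ∂ρ ∂τ := by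
    intro ρ τ _ _ hρ hτ t
    have : ∀ᵐ y ∂τ, ∫ x, Complex.exp ((inner ℝ x (‖t‖ • y) : ℝ) * Complex.I) ∂ρ
        = charFun ρ t := by
      filter_upwards [hτ] with y hy
      rw [← charFun_apply]
      exact key ρ hρ _ _ (by rw [norm_smul, hy]; simp)
    rw [integral_congr_ae this]
    simp
  apply Measure.ext_of_charFun
  ext t
  rw [avg μ ν hμ hν1 t, avg ν μ hν hμ1 t, integral_integral_swap]
  · refine integral_congr_ae (.of_forall fun x => ?_)
    refine integral_congr_ae (.of_forall fun y => ?_)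
    simp only [inner_smul_right]
    rw [real_inner_comm]
  · refine (integrable_const (1 : ℝ)).mono ?_ (.of_forall fun p => ?_)
    · apply Continuous.aestronglyMeasurable
      simp only [Function.uncurry_def]
      fun_prop
    · simp only [Function.uncurry_def, Complex.norm_exp_ofReal_mul_I]
      simp

/-- The difference of two vectors with prescribed (signed) lengths and directions. -/
def directedDiff (p : (ℝ × E) × (ℝ × E)) : E :=
  p.1.1 • (‖p.1.2‖⁻¹ • p.1.2) - p.2.1 • (‖p.2.2‖⁻¹ • p.2.2)

theorem directedDiff_isometry {F : Type*} [NormedAddCommGroup F] [InnerProductSpace ℝ F]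
    (O : F ≃ₗᵢ[ℝ] F) (p : (ℝ × F) × (ℝ × F)) :
    O (directedDiff p) = directedDiff (Prod.map (Prod.map id O) (Prod.map id O) p) := by
  simp [directedDiff]

theorem measurable_directedDiff : Measurable (directedDiff (E := E)) := by
  unfold directedDiff
  fun_prop

/-- If the difference vanishes while the first vector does not, the second Gaussian direction lies
on the line through the first, a null event given the first pair. -/
theorem ae_directedDiff_ne_zero (hE : 2 ≤ Module.finrank ℝ E) (μ ν : Measure ℝ)
    [IsProbabilityMeasure μ] [IsProbabilityMeasure ν] (hμ : ∀ᵐ a ∂μ, a ≠ 0) :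
    ∀ᵐ p ∂(μ.prod (stdGaussian E)).prod (ν.prod (stdGaussian E)), directedDiff p ≠ 0 := by
  have hms : MeasurableSet {p : (ℝ × E) × (ℝ × E) | directedDiff p ≠ 0} :=
    (measurable_directedDiff (measurableSet_singleton 0)).compl
  rw [Measure.ae_prod_iff_ae_ae hms]
  have h0 : ∀ᵐ x ∂stdGaussian E, x ≠ 0 := by
    rw [ae_iff]
    refine measure_mono_null (fun x hx => ?_) (stdGaussian_span_singleton_eq_zero hE 0)
    have : x = 0 := by simpa using hx
    simp [this]
  have h1 : ∀ᵐ p ∂μ.prod (stdGaussian E), p.1 ≠ 0 := Measure.quasiMeasurePreserving_fst.ae hμ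
  have h2 : ∀ᵐ p ∂μ.prod (stdGaussian E), p.2 ≠ 0 := Measure.quasiMeasurePreserving_snd.ae h0
  filter_upwards [h1, h2] with p hp1 hp2
  have h3 : ∀ᵐ x ∂stdGaussian E, x ∉ Submodule.span ℝ {p.2} := by
    rw [ae_iff]
    simpa using stdGaussian_span_singleton_eq_zero hE p.2
  have h4 : ∀ᵐ q ∂ν.prod (stdGaussian E), q.2 ∉ Submodule.span ℝ {p.2} :=
    Measure.quasiMeasurePreserving_snd.ae h3
  filter_upwards [h4] with q hq h
  apply hq
  rw [directedDiff, sub_eq_zero] at h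
  simp only at h
  have hne : p.1 • (‖p.2‖⁻¹ • p.2) ≠ 0 := by simp [hp1, hp2]
  rw [h, smul_smul] at hne
  have hc : q.1 * ‖q.2‖⁻¹ ≠ 0 := left_ne_zero_of_smul hne
  rw [Submodule.mem_span_singleton]
  refine ⟨(q.1 * ‖q.2‖⁻¹)⁻¹ * (p.1 * ‖p.2‖⁻¹), ?_⟩
  rw [mul_smul, mul_smul p.1, h, ← mul_smul q.1, smul_smul, inv_mul_cancel₀ hc, one_smul]

/-- The direction of `a u - b v`, with `u`, `v` independent and uniformly distributed on the
sphere, is uniformly distributed on the sphere. -/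
theorem map_normalize_directedDiff (hE : 2 ≤ Module.finrank ℝ E) (μ ν : Measure ℝ)
    [IsProbabilityMeasure μ] [IsProbabilityMeasure ν] (hμ : ∀ᵐ a ∂μ, a ≠ 0) :
    ((μ.prod (stdGaussian E)).prod (ν.prod (stdGaussian E))).map
        (fun p => ‖directedDiff p‖⁻¹ • directedDiff p) =
      (stdGaussian E).map fun x => ‖x‖⁻¹ • x := by
  have hmd := measurable_directedDiff (E := E)
  have hmn : Measurable fun p : (ℝ × E) × (ℝ × E) => ‖directedDiff p‖⁻¹ • directedDiff p := by
    fun_prop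
  have hm : Measurable fun x : E => ‖x‖⁻¹ • x := by fun_prop
  have := Measure.isProbabilityMeasure_map (μ := stdGaussian E) hm.aemeasurable
  have := Measure.isProbabilityMeasure_map
    (μ := (μ.prod (stdGaussian E)).prod (ν.prod (stdGaussian E))) hmn.aemeasurable
  have hms : MeasurableSet {x : E | ‖x‖ = 1} := measurable_norm (measurableSet_singleton 1)
  apply eq_of_isometry_invariant_of_norm_eq_one
  · intro O
    have hO : Measurable O := O.continuous.measurable
    have hp : MeasurePreserving O (stdGaussian E) (stdGaussian E) := ⟨hO, stdGaussian_map O⟩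
    -- Rotate both directions by the same isometry and leave the radii alone: this preserves the
    -- joint law and rotates the difference.
    have hpp := ((MeasurePreserving.id μ).prod hp).prod ((MeasurePreserving.id ν).prod hp)
    rw [Measure.map_map hO hmn]
    conv_rhs => rw [← hpp.map_eq, Measure.map_map hmn hpp.measurable]
    congr 1
    ext p
    simp only [Function.comp_apply, map_smul, ← directedDiff_isometry,
      LinearIsometryEquiv.norm_map]
  · intro O
    have hO : Measurable O := O.continuous.measurable
    rw [Measure.map_map hO hm]
    conv_rhs => rw [← stdGaussian_map O, Measure.map_map hm hO]
    congr 1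
    ext p
    simp
  · rw [ae_map_iff hmn.aemeasurable hms]
    filter_upwards [ae_directedDiff_ne_zero hE μ ν hμ] with p hp
    rw [norm_smul, norm_inv, norm_norm, inv_mul_cancel₀ (norm_ne_zero_iff.2 hp)]
  · rw [ae_map_iff hm.aemeasurable hms]
    have h0 : ∀ᵐ x ∂stdGaussian E, x ≠ 0 := by
      rw [ae_iff]
      refine measure_mono_null (fun x hx => ?_) (stdGaussian_span_singleton_eq_zero hE 0)
      have : x = 0 := by simpa using hx
      simp [this]
    filter_upwards [h0] with p hp
    rw [norm_smul, norm_inv, norm_norm, inv_mul_cancel₀ (norm_ne_zero_iff.2 hp)]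

end Sphere

/-- The standard Gaussian measure on a coordinate space. -/
abbrev stdPi (ι : Type*) [Fintype ι] : Measure (ι → ℝ) := Measure.pi fun _ => gaussianReal 0 1

/-- A `0`-homogeneous function of `ξ g / ‖g‖ - ξ' g' / ‖g'‖` has the law of the same function of a
standard Gaussian vector. -/
theorem map_homogeneous_pair {Ω ι : Type*} [MeasurableSpace Ω] [Fintype ι] {P : Measure Ω}
    [IsProbabilityMeasure P] (hι : 2 ≤ Fintype.card ι) {X Y : Ω → ℝ × (ι → ℝ)}
    (hX : Measurable X) (hY : Measurable Y) (hXY : IndepFun X Y P)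
    (hXi : IndepFun (fun ω => (X ω).1) (fun ω => (X ω).2) P)
    (hYi : IndepFun (fun ω => (Y ω).1) (fun ω => (Y ω).2) P)
    (hXg : P.map (fun ω => (X ω).2) = stdPi ι) (hYg : P.map (fun ω => (Y ω).2) = stdPi ι)
    (hX0 : ∀ᵐ ω ∂P, (X ω).1 ≠ 0)
    {Φ : (ι → ℝ) → ℝ} (hΦ : Measurable Φ) (hom : ∀ (c : ℝ) (x : ι → ℝ), c ≠ 0 → Φ (c • x) = Φ x) :
    P.map (fun ω => Φ ((X ω).1 • ((l2norm (X ω).2)⁻¹ • (X ω).2) -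
      (Y ω).1 • ((l2norm (Y ω).2)⁻¹ • (Y ω).2))) = (stdPi ι).map Φ := by
  have hlp : Measurable (WithLp.toLp 2 : (ι → ℝ) → EuclideanSpace ℝ ι) := WithLp.measurable_toLp 2 _
  have hpl : Measurable (WithLp.ofLp : EuclideanSpace ℝ ι → (ι → ℝ)) := WithLp.measurable_ofLp 2 _
  have hE : 2 ≤ Module.finrank ℝ (EuclideanSpace ℝ ι) := by simpa using hι
  have hX1 : Measurable fun ω => (X ω).1 := hX.fst
  have hY1 : Measurable fun ω => (Y ω).1 := hY.fst
  have hX2 : Measurable fun ω => (WithLp.toLp 2 (X ω).2 : EuclideanSpace ℝ ι) := hlp.comp hX.snd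
  have hY2 : Measurable fun ω => (WithLp.toLp 2 (Y ω).2 : EuclideanSpace ℝ ι) := hlp.comp hY.snd
  have lawg : ∀ Z : Ω → ℝ × (ι → ℝ), Measurable Z → P.map (fun ω => (Z ω).2) = stdPi ι →
      P.map (fun ω => (WithLp.toLp 2 (Z ω).2 : EuclideanSpace ℝ ι)) = stdGaussian (EuclideanSpace ℝ ι) := by
    intro Z hZ h
    rw [← map_pi_eq_stdGaussian]
    change _ = Measure.map _ (stdPi ι)
    rw [← h, Measure.map_map hlp hZ.snd]
    rfl
  have lawX : P.map (fun ω => ((X ω).1, (WithLp.toLp 2 (X ω).2 : EuclideanSpace ℝ ι))) =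
      (P.map fun ω => (X ω).1).prod (stdGaussian (EuclideanSpace ℝ ι)) := by
    rw [← lawg X hX hXg]
    exact (indepFun_iff_map_prod_eq_prod_map_map hX1.aemeasurable hX2.aemeasurable).1
      (hXi.comp measurable_id hlp)
  have lawY : P.map (fun ω => ((Y ω).1, (WithLp.toLp 2 (Y ω).2 : EuclideanSpace ℝ ι))) =
      (P.map fun ω => (Y ω).1).prod (stdGaussian (EuclideanSpace ℝ ι)) := by
    rw [← lawg Y hY hYg]
    exact (indepFun_iff_map_prod_eq_prod_map_map hY1.aemeasurable hY2.aemeasurable).1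
      (hYi.comp measurable_id hlp)
  have hq : Measurable fun z : ℝ × (ι → ℝ) => (z.1, (WithLp.toLp 2 z.2 : EuclideanSpace ℝ ι)) := by fun_prop
  have law : P.map (fun ω => (((X ω).1, (WithLp.toLp 2 (X ω).2 : EuclideanSpace ℝ ι)),
      ((Y ω).1, (WithLp.toLp 2 (Y ω).2 : EuclideanSpace ℝ ι)))) =
      ((P.map fun ω => (X ω).1).prod (stdGaussian (EuclideanSpace ℝ ι))).prod
        ((P.map fun ω => (Y ω).1).prod (stdGaussian (EuclideanSpace ℝ ι))) := by
    rw [← lawX, ← lawY]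
    exact (indepFun_iff_map_prod_eq_prod_map_map (hX1.prodMk hX2).aemeasurable
      (hY1.prodMk hY2).aemeasurable).1 (hXY.comp hq hq)
  have := Measure.isProbabilityMeasure_map (μ := P) hX1.aemeasurable
  have := Measure.isProbabilityMeasure_map (μ := P) hY1.aemeasurable
  have hμ : ∀ᵐ a ∂P.map (fun ω => (X ω).1), a ≠ 0 := by
    exact (ae_map_iff hX1.aemeasurable (measurableSet_singleton (0 : ℝ)).compl).2 hX0
  have main := map_normalize_directedDiff hE (P.map fun ω => (X ω).1) (P.map fun ω => (Y ω).1) hμ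
  have hmd := measurable_directedDiff (E := EuclideanSpace ℝ ι)
  -- A function homogeneous of degree zero sees only the direction; at `0` this holds since both
  -- arguments are `0`.
  have hΦ' : ∀ x : EuclideanSpace ℝ ι, Φ (WithLp.ofLp (‖x‖⁻¹ • x)) = Φ (WithLp.ofLp x) := by
    intro x
    rcases eq_or_ne x 0 with rfl | hx
    · simp
    · rw [WithLp.ofLp_smul, hom _ _ (inv_ne_zero (norm_ne_zero_iff.2 hx))]
  have hΦlp : Measurable fun x : EuclideanSpace ℝ ι => Φ (WithLp.ofLp x) := hΦ.comp hpl
  have main2 := congrArg (Measure.map fun x : EuclideanSpace ℝ ι => Φ (WithLp.ofLp x)) main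
  rw [← law, Measure.map_map hΦlp (by fun_prop), Measure.map_map (by fun_prop) (by fun_prop),
    Measure.map_map hΦlp (by fun_prop), ← map_pi_eq_stdGaussian,
    Measure.map_map (by fun_prop) hlp] at main2
  simp only [Function.comp_def, hΦ'] at main2
  exact main2

end RTS

/-! ### Variance of U-statistics of order two -/

namespace RTS

/-- The pairs `(s, t)` with `t < s < T`. -/
def orderedPairs (T : ℕ) : Finset (ℕ × ℕ) :=
  (Finset.range T ×ˢ Finset.range T).filter fun p => p.2 < p.1

theorem sum_orderedPairs {M : Type*} [AddCommMonoid M] (T : ℕ) (F : ℕ → ℕ → M) :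
    ∑ p ∈ orderedPairs T, F p.1 p.2 =
      ∑ s ∈ Finset.range T, ∑ t ∈ Finset.range s, F s t := by
  rw [orderedPairs, Finset.sum_filter, Finset.sum_product]
  refine Finset.sum_congr rfl fun s hs => ?_
  rw [← Finset.sum_filter]
  refine Finset.sum_congr ?_ fun _ _ => rfl
  ext t
  simp only [Finset.mem_filter, Finset.mem_range] at hs ⊢
  omega

theorem card_orderedPairs (T : ℕ) : ((orderedPairs T).card : ℝ) = T * (T - 1) / 2 := by
  have h := sum_orderedPairs T fun _ _ => (1 : ℝ)
  simp only [Finset.sum_const, nsmul_eq_mul, mul_one, Finset.card_range] at h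
  rw [h]
  induction T with
  | zero => simp
  | succ n ih =>
    rw [Finset.sum_range_succ, ih (by
      have h := sum_orderedPairs n fun _ _ => (1 : ℝ)
      simpa only [Finset.sum_const, nsmul_eq_mul, mul_one, Finset.card_range] using h)]
    push_cast
    ring

/-- A shared index pins one coordinate of `q` to one of two values, leaving at most `T` choices for
the other in each of four cases. -/
theorem card_intersecting_le (T : ℕ) (p : ℕ × ℕ) :
    ((orderedPairs T).filter fun q =>
      q.1 = p.1 ∨ q.1 = p.2 ∨ q.2 = p.1 ∨ q.2 = p.2).card ≤ 4 * T := by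
  classical
  have hsub : ((orderedPairs T).filter fun q =>
      q.1 = p.1 ∨ q.1 = p.2 ∨ q.2 = p.1 ∨ q.2 = p.2) ⊆
      (({p.1} ×ˢ Finset.range T ∪ {p.2} ×ˢ Finset.range T) ∪
        (Finset.range T ×ˢ {p.1} ∪ Finset.range T ×ˢ {p.2})) := by
    rintro ⟨a, b⟩ h
    simp only [orderedPairs, Finset.mem_filter, Finset.mem_product, Finset.mem_range,
      Finset.mem_union, Finset.mem_singleton] at h ⊢
    tauto
  refine (Finset.card_le_card hsub).trans ?_
  refine (Finset.card_union_le _ _).trans ?_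
  have h1 := Finset.card_union_le ({p.1} ×ˢ Finset.range T) ({p.2} ×ˢ Finset.range T)
  have h2 := Finset.card_union_le (Finset.range T ×ˢ {p.1}) (Finset.range T ×ˢ {p.2})
  simp only [Finset.card_product, Finset.card_singleton, Finset.card_range] at h1 h2
  omega

/-- The variance of a U-statistic of order two. -/
theorem integral_sq_pair_mean_sub_le {Ω S : Type*} [MeasurableSpace Ω] [MeasurableSpace S]
    {P : Measure Ω} [IsProbabilityMeasure P] {X : ℕ → Ω → S} (hX : ∀ t, Measurable (X t))
    (hind : iIndepFun X P) {κ : S → S → ℝ} (hκ : Measurable (Function.uncurry κ))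
    {ν : Measure ℝ} (hν : ∀ t s, t < s → P.map (fun ω => κ (X t ω) (X s ω)) = ν)
    (hν2 : MemLp id 2 ν) {T : ℕ} (hT : 2 ≤ T) :
    Integrable (fun ω => ((2 / ((T : ℝ) * ((T : ℝ) - 1))) *
      ∑ s ∈ Finset.range T, ∑ t ∈ Finset.range s, κ (X t ω) (X s ω) - ∫ x, x ∂ν) ^ 2) P ∧
    ∫ ω, ((2 / ((T : ℝ) * ((T : ℝ) - 1))) *
      ∑ s ∈ Finset.range T, ∑ t ∈ Finset.range s, κ (X t ω) (X s ω) - ∫ x, x ∂ν) ^ 2 ∂P ≤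
      16 / T * ∫ x, x ^ 2 ∂ν := by
  classical
  set Z : ℕ × ℕ → Ω → ℝ := fun p ω => κ (X p.2 ω) (X p.1 ω) with hZ
  have hZm : ∀ p, Measurable (Z p) := fun p =>
    hκ.comp ((hX p.2).prodMk (hX p.1))
  have hlt : ∀ p ∈ orderedPairs T, p.2 < p.1 := fun p hp => (Finset.mem_filter.1 hp).2
  have hmap : ∀ p ∈ orderedPairs T, P.map (Z p) = ν := fun p hp => hν _ _ (hlt p hp)
  have hL2 : ∀ p ∈ orderedPairs T, MemLp (Z p) 2 P := by
    intro p hp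
    rw [← hmap p hp] at hν2
    exact (memLp_map_measure_iff (by fun_prop) (hZm p).aemeasurable).1 hν2
  have hmean : ∀ p ∈ orderedPairs T, ∫ ω, Z p ω ∂P = ∫ x, x ∂ν := by
    intro p hp
    rw [← hmap p hp, integral_map (hZm p).aemeasurable (by fun_prop)]
  have hsq : ∀ p ∈ orderedPairs T, ∫ ω, Z p ω ^ 2 ∂P = ∫ x, x ^ 2 ∂ν := by
    intro p hp
    rw [← hmap p hp, integral_map (hZm p).aemeasurable (by fun_prop)]
  set q := ∫ x, x ^ 2 ∂ν with hq
  have hq0 : 0 ≤ q := integral_nonneg fun x => sq_nonneg x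
  have hvar : ∀ p ∈ orderedPairs T, Var[Z p; P] ≤ q := by
    intro p hp
    rw [← hsq p hp]
    exact variance_le_expectation_sq (hZm p).aestronglyMeasurable
  have hcov : ∀ p ∈ orderedPairs T, ∀ p' ∈ orderedPairs T, cov[Z p, Z p'; P] ≤
      if p'.1 = p.1 ∨ p'.1 = p.2 ∨ p'.2 = p.1 ∨ p'.2 = p.2 then q else 0 := by
    intro p hp p' hp'
    split_ifs with h
    -- `Var(Z - Z') ≥ 0` bounds the covariance by the mean of the two variances.
    · have h1 := variance_sub (hL2 p hp) (hL2 p' hp')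
      have h2 := variance_nonneg (Z p - Z p') P
      have h3 := hvar p hp
      have h4 := hvar p' hp'
      linarith
    · push Not at h
      have := hind.indepFun_prodMk_prodMk hX p.2 p.1 p'.2 p'.1 (Ne.symm h.2.2.2)
        (Ne.symm h.2.1) (Ne.symm h.2.2.1) (Ne.symm h.1)
      have h2 : IndepFun (Z p) (Z p') P := this.comp hκ hκ
      exact (h2.covariance_eq_zero (hL2 p hp) (hL2 p' hp')).le
  set n : ℝ := ((orderedPairs T).card : ℝ) with hn
  have hn' : n = T * (T - 1) / 2 := card_orderedPairs T
  have hT' : (2 : ℝ) ≤ T := by exact_mod_cast hT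
  have hn0 : 0 < n := by rw [hn']; nlinarith
  have hvs : Var[∑ p ∈ orderedPairs T, Z p; P] ≤ n * (4 * T) * q := by
    rw [variance_sum' hL2]
    calc _ ≤ ∑ p ∈ orderedPairs T, ∑ p' ∈ orderedPairs T,
          if p'.1 = p.1 ∨ p'.1 = p.2 ∨ p'.2 = p.1 ∨ p'.2 = p.2 then q else 0 :=
          Finset.sum_le_sum fun p hp => Finset.sum_le_sum fun p' hp' => hcov p hp p' hp'
      _ ≤ ∑ p ∈ orderedPairs T, (4 * T : ℝ) * q := by
          refine Finset.sum_le_sum fun p hp => ?_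
          rw [← Finset.sum_filter, Finset.sum_const, nsmul_eq_mul]
          refine mul_le_mul_of_nonneg_right ?_ hq0
          exact_mod_cast card_intersecting_le T p
      _ = n * (4 * T) * q := by rw [Finset.sum_const, nsmul_eq_mul, hn]; ring
  have hc : 2 / ((T : ℝ) * ((T : ℝ) - 1)) = n⁻¹ := by rw [hn']; field_simp
  have hS2 : MemLp (∑ p ∈ orderedPairs T, Z p) 2 P := memLp_finsetSum' _ hL2
  have hfun : (fun ω => ((2 / ((T : ℝ) * ((T : ℝ) - 1))) *
      ∑ s ∈ Finset.range T, ∑ t ∈ Finset.range s, κ (X t ω) (X s ω) - ∫ x, x ∂ν) ^ 2) =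
      fun ω => (n⁻¹) ^ 2 * ((∑ p ∈ orderedPairs T, Z p) ω -
        ∫ ω', (∑ p ∈ orderedPairs T, Z p) ω' ∂P) ^ 2 := by
    have hI : ∫ ω', (∑ p ∈ orderedPairs T, Z p) ω' ∂P = n * ∫ x, x ∂ν := by
      simp only [Finset.sum_apply]
      rw [integral_finsetSum _ fun p hp => (hL2 p hp).integrable (by norm_num),
        Finset.sum_congr rfl hmean, Finset.sum_const, nsmul_eq_mul]
    ext ω
    rw [hI, hc, ← sum_orderedPairs T fun s t => κ (X t ω) (X s ω), ← mul_pow, Finset.sum_apply,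
      mul_sub, inv_mul_cancel_left₀ hn0.ne']
  rw [hfun]
  refine ⟨((hS2.sub (memLp_const _)).integrable_sq).const_mul _, ?_⟩
  rw [integral_const_mul, ← variance_eq_integral hS2.aemeasurable]
  calc _ ≤ (n⁻¹) ^ 2 * (n * (4 * T) * q) := by gcongr
    _ = 8 / ((T : ℝ) - 1) * q := by
      have : (T : ℝ) - 1 ≠ 0 := by linarith
      rw [hn']; field_simp; ring
    -- `T ≥ 2` gives `T - 1 ≥ T / 2`.
    _ ≤ 16 / T * q := by
      refine mul_le_mul_of_nonneg_right ?_ hq0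
      rw [div_le_div_iff₀ (by linarith) (by linarith)]
      linarith

end RTS

namespace RTS

/-! ### Moments of Gaussian linear forms -/

section LinearForms

variable {ι : Type*} [Fintype ι]

theorem stdPi_map_dotProduct (a : ι → ℝ) :
    (stdPi ι).map (fun x => a ⬝ᵥ x) = (gaussianReal 0 1).map fun x => √(a ⬝ᵥ a) * x := by
  have h := stdGaussian_map_inner (E := EuclideanSpace ℝ ι) (WithLp.toLp 2 a)
  rw [← map_pi_eq_stdGaussian, Measure.map_map (by fun_prop) (WithLp.measurable_toLp 2 _)] at h
  have h1 : (fun x : ι → ℝ => a ⬝ᵥ x) =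
      (fun x : EuclideanSpace ℝ ι => inner ℝ (WithLp.toLp 2 a) x) ∘ WithLp.toLp 2 := by
    ext x
    simp [PiLp.inner_apply, dotProduct, mul_comm]
  have h0 : 0 ≤ a ⬝ᵥ a := Finset.sum_nonneg fun i _ => mul_self_nonneg _
  rw [h1, h, gaussianReal_map_const_mul, mul_zero, mul_one]
  congr 1
  rw [EuclideanSpace.real_norm_sq_eq]
  ext
  simp [dotProduct, sq, Finset.sum_nonneg, mul_self_nonneg]

theorem integrable_abs_pow_gaussianReal (n : ℕ) :
    Integrable (fun x : ℝ => |x| ^ n) (gaussianReal 0 1) := by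
  have h := memLp_id_gaussianReal (μ := 0) (v := 1) n
  simpa using h.integrable_norm_pow'

theorem integrable_abs_dotProduct_pow (a : ι → ℝ) (n : ℕ) :
    Integrable (fun x => |a ⬝ᵥ x| ^ n) (stdPi ι) := by
  have hm : Measurable fun x : ι → ℝ => a ⬝ᵥ x := by unfold dotProduct; fun_prop
  have h : Integrable (fun y : ℝ => |y| ^ n) ((stdPi ι).map fun x => a ⬝ᵥ x) := by
    rw [stdPi_map_dotProduct, integrable_map_measure (by fun_prop) (by fun_prop)]
    simp only [Function.comp_def, abs_mul, mul_pow]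
    exact (integrable_abs_pow_gaussianReal n).const_mul _
  exact (integrable_map_measure (by fun_prop) hm.aemeasurable).1 h

theorem integral_abs_dotProduct_pow (a : ι → ℝ) (n : ℕ) :
    ∫ x, |a ⬝ᵥ x| ^ n ∂stdPi ι = √(a ⬝ᵥ a) ^ n * ∫ x, |x| ^ n ∂gaussianReal 0 1 := by
  have hm : Measurable fun x : ι → ℝ => a ⬝ᵥ x := by unfold dotProduct; fun_prop
  have h : ∫ y : ℝ, |y| ^ n ∂((stdPi ι).map fun x => a ⬝ᵥ x) =
      √(a ⬝ᵥ a) ^ n * ∫ x, |x| ^ n ∂gaussianReal 0 1 := by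
    rw [stdPi_map_dotProduct, integral_map (by fun_prop) (by fun_prop)]
    simp only [abs_mul, mul_pow, abs_of_nonneg (Real.sqrt_nonneg _)]
    rw [integral_const_mul]
  rw [← h, integral_map hm.aemeasurable (by fun_prop)]

theorem integral_abs_gaussianReal_pos : 0 < ∫ x, |x| ∂gaussianReal 0 1 := by
  rw [integral_pos_iff_support_of_nonneg (fun x => abs_nonneg x)
    (by simpa using integrable_abs_pow_gaussianReal 1)]
  have h : Function.support (fun x : ℝ => |x|) = {0}ᶜ := by ext; simp
  have := nullSingletonClass_gaussianReal (μ := 0) one_ne_zero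
  rw [h, prob_compl_eq_one_sub (measurableSet_singleton 0), measure_singleton]
  simp

theorem integral_sq_gaussianReal : ∫ x, |x| ^ 2 ∂gaussianReal 0 1 = 1 := by
  have h := variance_id_gaussianReal (μ := 0) (v := 1)
  rw [variance_eq_integral (by fun_prop)] at h
  simpa using h

end LinearForms

/-! ### Negative moments of Gaussian norms -/

section NegativeMoments

open scoped ENNReal NNReal

theorem lintegral_indicator_enorm_rpow_lt_top :
    ∫⁻ x : ℝ, (Set.Ioc (0 : ℝ) 1).indicator (fun x => ‖x‖ₑ ^ (-(1 / 2) : ℝ)) x < ⊤ := by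
  have h := (intervalIntegral.intervalIntegrable_rpow' (a := 0) (b := 1) (r := -(1 / 2))
    (by norm_num)).1
  have h2 := h.hasFiniteIntegral
  rw [HasFiniteIntegral] at h2
  rw [lintegral_indicator measurableSet_Ioc]
  refine lt_of_le_of_lt (le_of_eq ?_) h2
  refine setLIntegral_congr_fun measurableSet_Ioc fun x hx => ?_
  rw [Real.enorm_eq_ofReal hx.1.le, Real.enorm_eq_ofReal (Real.rpow_nonneg hx.1.le _),
    ENNReal.ofReal_rpow_of_pos hx.1]

/-- Negative moments of order `1/2` of a Gaussian variable are bounded uniformly in the mean. -/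
theorem exists_lintegral_enorm_rpow_le :
    ∃ C : ℝ≥0, ∀ v : ℝ, ∫⁻ x, ‖x + v‖ₑ ^ (-(1 / 2) : ℝ) ∂gaussianReal 0 1 ≤ C := by
  set F : ℝ → ℝ≥0∞ := (Set.Ioc (0 : ℝ) 1).indicator (fun x => ‖x‖ₑ ^ (-(1 / 2) : ℝ)) with hF
  have hFm : Measurable F := Measurable.indicator (by fun_prop) measurableSet_Ioc
  have hfin : 1 + ((∫⁻ x, F x) + ∫⁻ x, F x) ≠ ⊤ := by
    have : ∫⁻ x, F x ≠ ⊤ := lintegral_indicator_enorm_rpow_lt_top.ne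
    simp [this]
  refine ⟨(1 + ((∫⁻ x, F x) + ∫⁻ x, F x)).toNNReal, fun v => ?_⟩
  rw [ENNReal.coe_toNNReal hfin]
  -- A density bounded by one lets the singular part be integrated against Lebesgue measure, whose
  -- translation invariance removes `v`.
  have hpdf : ∀ x, gaussianPDF 0 1 x ≤ 1 := by
    intro x
    rw [gaussianPDF, ← ENNReal.ofReal_one]
    refine ENNReal.ofReal_le_ofReal ?_
    rw [gaussianPDFReal]
    refine mul_le_one₀ (inv_le_one_of_one_le₀ ?_) (Real.exp_nonneg _) ?_
    · rw [Real.one_le_sqrt]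
      have := Real.pi_gt_three
      simp only [NNReal.coe_one]
      linarith
    · rw [Real.exp_le_one_iff, neg_div]
      exact neg_nonpos.2 (by positivity)
  have hle : ∀ f : ℝ → ℝ≥0∞, Measurable f → ∫⁻ x, f x ∂gaussianReal 0 1 ≤ ∫⁻ x, f x := by
    intro f hf
    rw [gaussianReal_of_var_ne_zero 0 one_ne_zero,
      lintegral_withDensity_eq_lintegral_mul _ (measurable_gaussianPDF 0 1) hf]
    refine lintegral_mono fun x => ?_
    exact mul_le_of_le_one_left zero_le (hpdf x)
  have hae : ∀ᵐ x ∂gaussianReal 0 1, x + v ≠ 0 := by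
    have := nullSingletonClass_gaussianReal (μ := 0) one_ne_zero
    rw [ae_iff]
    refine measure_mono_null (t := {-v}) (fun x hx => ?_) (measure_singleton _)
    simp only [ne_eq, not_not, Set.mem_ofPred_eq, Set.mem_singleton_iff] at hx ⊢
    linarith
  calc ∫⁻ x, ‖x + v‖ₑ ^ (-(1 / 2) : ℝ) ∂gaussianReal 0 1
      ≤ ∫⁻ x, (1 + (F (x + v) + F (-(x + v)))) ∂gaussianReal 0 1 := by
        refine lintegral_mono_ae ?_
        filter_upwards [hae] with x hx
        set y := x + v
        rcases le_or_gt |y| 1 with h1 | h1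
        · rcases lt_or_gt_of_ne hx with h0 | h0
          · have : F (-y) = ‖y‖ₑ ^ (-(1 / 2) : ℝ) := by
              rw [hF, Set.indicator_of_mem, enorm_neg]
              rw [abs_of_neg h0] at h1
              exact ⟨by linarith, h1⟩
            rw [this]
            exact le_add_left (le_add_left le_rfl)
          · have : F y = ‖y‖ₑ ^ (-(1 / 2) : ℝ) := by
              rw [hF, Set.indicator_of_mem]
              rw [abs_of_pos h0] at h1
              exact ⟨h0, h1⟩
            rw [this]
            exact le_add_left (le_add_right le_rfl)
        · refine le_add_right ?_
          refine ENNReal.rpow_le_one_of_one_le_of_neg ?_ (by norm_num)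
          rw [← ofReal_norm, Real.norm_eq_abs, ENNReal.one_le_ofReal]
          exact h1.le
    _ = 1 + ∫⁻ x, (F (x + v) + F (-(x + v))) ∂gaussianReal 0 1 := by
        rw [lintegral_add_left measurable_const]
        simp
    _ ≤ 1 + ∫⁻ x, (F (x + v) + F (-(x + v))) := by
        exact add_le_add le_rfl <| hle (fun x => F (x + v) + F (-(x + v))) (by fun_prop)
    _ = 1 + ((∫⁻ x, F x) + ∫⁻ x, F x) := by
        rw [lintegral_add_left (by fun_prop), lintegral_add_right_eq_self F v,
          lintegral_add_right_eq_self (fun x => F (-x)) v, lintegral_neg_eq_self]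

/-- Jensen's inequality for the concave power `θ`, read off from the monotonicity of `L^p` seminorms
on a probability space. -/
theorem lintegral_rpow_le_rpow_lintegral {α : Type*} [MeasurableSpace α] (μ : Measure α)
    [IsProbabilityMeasure μ] {ψ : α → ℝ≥0∞} (hψ : Measurable ψ) {θ : ℝ} (h0 : 0 < θ) (h1 : θ ≤ 1) :
    ∫⁻ x, ψ x ^ θ ∂μ ≤ (∫⁻ x, ψ x ∂μ) ^ θ := by
  have h := eLpNorm'_le_eLpNorm'_of_exponent_le h0 h1 μ hψ.aestronglyMeasurable
  simp only [eLpNorm', enorm_eq_self, ENNReal.rpow_one, div_one] at h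
  have h2 := ENNReal.rpow_le_rpow h h0.le
  rwa [← ENNReal.rpow_mul, one_div, inv_mul_cancel₀ h0.ne', ENNReal.rpow_one] at h2

/-- The inequality between the geometric and the quadratic mean, for negative powers. -/
theorem ofReal_div_dotProduct_pow_le {N : ℕ} (hN : 0 < N) (x : Fin N → ℝ) :
    ENNReal.ofReal ((N / (x ⬝ᵥ x)) ^ 8) ≤ ∏ i, ‖x i‖ₑ ^ (-(16 / N) : ℝ) := by
  have hN' : (0 : ℝ) < N := by exact_mod_cast hN
  by_cases h : ∃ i, x i = 0
  · obtain ⟨i, hi⟩ := h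
    -- A zero coordinate contributes `0 ^ negative = ⊤`, and no other factor vanishes because a
    -- finite base never has zero negative power.
    have : ∏ i, ‖x i‖ₑ ^ (-(16 / N) : ℝ) = ⊤ := by
      rw [← Finset.mul_prod_erase _ _ (Finset.mem_univ i), hi, enorm_zero,
        ENNReal.zero_rpow_of_neg (by simpa using by positivity), ENNReal.top_mul]
      refine Finset.prod_ne_zero_iff.2 fun j _ => ?_
      have : (0 : ℝ) ≤ 16 / N := by positivity
      simp [ENNReal.rpow_eq_zero_iff, this]
    rw [this]
    exact le_top
  · push Not at h
    have hx : ∀ i, 0 < |x i| := fun i => abs_pos.2 (h i)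
    have hgm := Real.geom_mean_le_arith_mean_weighted Finset.univ (fun _ : Fin N => (N : ℝ)⁻¹)
      (fun i => x i ^ 2) (fun _ _ => by positivity) (by simp [hN'.ne']) (fun _ _ => sq_nonneg _)
    have hpos : 0 < ∏ i, (x i ^ 2) ^ (N : ℝ)⁻¹ :=
      Finset.prod_pos fun i _ => Real.rpow_pos_of_pos (by have := h i; positivity) _
    have hsum : ∑ i, (N : ℝ)⁻¹ * x i ^ 2 = (x ⬝ᵥ x) / N := by
      rw [← Finset.mul_sum, dotProduct, div_eq_inv_mul]
      simp only [sq]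
    rw [hsum] at hgm
    have h1 : (N : ℝ) / (x ⬝ᵥ x) ≤ (∏ i, (x i ^ 2) ^ (N : ℝ)⁻¹)⁻¹ := by
      rw [← inv_div]
      exact inv_anti₀ hpos hgm
    have h2 : ((∏ i, (x i ^ 2) ^ (N : ℝ)⁻¹)⁻¹) ^ 8 = ∏ i, |x i| ^ (-(16 / N) : ℝ) := by
      rw [← Finset.prod_inv_distrib, ← Finset.prod_pow]
      refine Finset.prod_congr rfl fun i _ => ?_
      rw [← sq_abs, ← Real.rpow_natCast |x i| 2, ← Real.rpow_mul (hx i).le,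
        ← Real.rpow_neg (hx i).le, ← Real.rpow_natCast, ← Real.rpow_mul (hx i).le]
      congr 1
      push_cast
      ring
    have h3 : 0 ≤ (N : ℝ) / (x ⬝ᵥ x) :=
      div_nonneg hN'.le (Finset.sum_nonneg fun i _ => mul_self_nonneg _)
    calc ENNReal.ofReal ((N / (x ⬝ᵥ x)) ^ 8) ≤ ENNReal.ofReal (∏ i, |x i| ^ (-(16 / N) : ℝ)) := by
          rw [← h2]
          exact ENNReal.ofReal_le_ofReal (pow_le_pow_left₀ h3 h1 8)
      _ = _ := by
          rw [ENNReal.ofReal_prod_of_nonneg fun i _ => Real.rpow_nonneg (hx i).le _]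
          refine Finset.prod_congr rfl fun i _ => ?_
          rw [← ENNReal.ofReal_rpow_of_pos (hx i), ← Real.norm_eq_abs, ofReal_norm]

/-- Negative moments of the squared norm of a Gaussian vector, uniformly in the mean. -/
theorem exists_lintegral_div_dotProduct_pow_le :
    ∃ C : ℝ≥0, ∀ N : ℕ, 32 ≤ N → ∀ v : Fin N → ℝ,
      ∫⁻ x, ENNReal.ofReal ((N / ((x + v) ⬝ᵥ (x + v))) ^ 8) ∂stdPi (Fin N) ≤ C := by
  obtain ⟨C, hC⟩ := exists_lintegral_enorm_rpow_le
  -- The coordinates are independent, and `-16/N = (-1/2) (32/N)`. Jensen applies since `32/N ≤ 1`,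
  -- so each factor is at most `C ^ (32/N)` and the `N` factors multiply to `C ^ 32`.
  refine ⟨C ^ 32, fun N hN v => ?_⟩
  have hN0 : 0 < N := by omega
  have hN' : (32 : ℝ) ≤ N := by exact_mod_cast hN
  have hNpos : (0 : ℝ) < N := by linarith
  have hfm : ∀ i, Measurable fun x : ℝ => ‖x + v i‖ₑ ^ (-(16 / N) : ℝ) := fun i => by fun_prop
  calc ∫⁻ x, ENNReal.ofReal ((N / ((x + v) ⬝ᵥ (x + v))) ^ 8) ∂stdPi (Fin N)
      ≤ ∫⁻ x, ∏ i, ‖x i + v i‖ₑ ^ (-(16 / N) : ℝ) ∂stdPi (Fin N) :=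
        lintegral_mono fun x => ofReal_div_dotProduct_pow_le hN0 (x + v)
    _ = ∏ i, ∫⁻ x, ‖x i + v i‖ₑ ^ (-(16 / N) : ℝ) ∂stdPi (Fin N) := by
        refine lintegral_prod_eq_prod_lintegral_of_indepFun Finset.univ
          (fun i (x : Fin N → ℝ) => ‖x i + v i‖ₑ ^ (-(16 / N) : ℝ)) ?_ fun i => by fun_prop
        exact iIndepFun_pi (X := fun i (x : ℝ) => ‖x + v i‖ₑ ^ (-(16 / N) : ℝ))
          fun i => (hfm i).aemeasurable
    _ ≤ ∏ _i : Fin N, (C : ℝ≥0∞) ^ (32 / N : ℝ) := by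
        refine Finset.prod_le_prod' fun i _ => ?_
        have h1 : ∫⁻ x, ‖x i + v i‖ₑ ^ (-(16 / N) : ℝ) ∂stdPi (Fin N) =
            ∫⁻ x, ‖x + v i‖ₑ ^ (-(16 / N) : ℝ) ∂gaussianReal 0 1 :=
          (measurePreserving_eval (fun _ : Fin N => gaussianReal 0 1) i).lintegral_comp (hfm i)
        have h2 : ∀ x : ℝ, ‖x + v i‖ₑ ^ (-(16 / N) : ℝ) =
            (‖x + v i‖ₑ ^ (-(1 / 2) : ℝ)) ^ (32 / N : ℝ) := by
          intro x
          rw [← ENNReal.rpow_mul]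
          congr 1
          ring
        rw [h1]
        simp only [h2]
        refine (lintegral_rpow_le_rpow_lintegral _ (by fun_prop) (by positivity) ?_).trans ?_
        · rw [div_le_one hNpos]
          exact hN'
        · exact ENNReal.rpow_le_rpow (hC (v i)) (by positivity)
    _ = ((C ^ 32 : ℝ≥0) : ℝ≥0∞) := by
        rw [Finset.prod_const, Finset.card_univ, Fintype.card_fin, ← ENNReal.rpow_natCast,
          ← ENNReal.rpow_mul, div_mul_cancel₀ _ hNpos.ne']
        push_cast
        exact_mod_cast ENNReal.rpow_natCast (C : ℝ≥0∞) 32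

end NegativeMoments

end RTS

namespace RTS

/-! ### Norm bounds for matrices and their transposes -/

section DotProduct

variable {ι κ : Type*} [Fintype ι] [Fintype κ]

theorem dotProduct_self_nonneg' (v : ι → ℝ) : 0 ≤ v ⬝ᵥ v :=
  Finset.sum_nonneg fun _ _ => mul_self_nonneg _

theorem dotProduct_sq_le (u v : ι → ℝ) : (u ⬝ᵥ v) ^ 2 ≤ (u ⬝ᵥ u) * (v ⬝ᵥ v) := by
  have h := Finset.sum_mul_sq_le_sq_mul_sq Finset.univ u v
  simpa only [dotProduct, sq] using h

theorem transpose_mulVec_dotProduct (M : Matrix ι κ ℝ) (u : ι → ℝ) (x : κ → ℝ) :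
    (Mᵀ *ᵥ u) ⬝ᵥ x = u ⬝ᵥ (M *ᵥ x) := by
  rw [mulVec_transpose, ← dotProduct_mulVec]

/-- An upper bound on `‖M x‖²` carries over to the transpose. -/
theorem transpose_mulVec_sq_le {M : Matrix ι κ ℝ} {c : ℝ} (hc : 0 ≤ c)
    (h : ∀ x, (M *ᵥ x) ⬝ᵥ (M *ᵥ x) ≤ c * (x ⬝ᵥ x)) (u : ι → ℝ) :
    (Mᵀ *ᵥ u) ⬝ᵥ (Mᵀ *ᵥ u) ≤ c * (u ⬝ᵥ u) := by
  -- `‖x‖² = u · M x ≤ ‖u‖ √c ‖x‖`, and one factor `‖x‖` cancels.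
  set x := Mᵀ *ᵥ u with hx
  have h1 : x ⬝ᵥ x = u ⬝ᵥ (M *ᵥ x) := transpose_mulVec_dotProduct M u x
  have h2 := dotProduct_sq_le u (M *ᵥ x)
  rw [← h1] at h2
  have h3 := h x
  have hu := dotProduct_self_nonneg' u
  rcases (dotProduct_self_nonneg' x).eq_or_lt with h0 | h0
  · rw [← h0]
    positivity
  · have h4 : (x ⬝ᵥ x) ^ 2 ≤ (c * (u ⬝ᵥ u)) * (x ⬝ᵥ x) :=
      h2.trans ((mul_le_mul_of_nonneg_left h3 hu).trans_eq (by ring))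
    rw [sq] at h4
    exact le_of_mul_le_mul_right h4 h0

/-- A lower bound on `‖M z‖²` gives one for `Mᵀ` on the range of `M`. -/
theorem mulVec_sq_le_transpose_mulVec_sq {M : Matrix ι κ ℝ} {c : ℝ}
    (h : ∀ z, c * (z ⬝ᵥ z) ≤ (M *ᵥ z) ⬝ᵥ (M *ᵥ z)) (z : κ → ℝ) :
    c * ((M *ᵥ z) ⬝ᵥ (M *ᵥ z)) ≤ (Mᵀ *ᵥ (M *ᵥ z)) ⬝ᵥ (Mᵀ *ᵥ (M *ᵥ z)) := by
  set x := M *ᵥ z with hx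
  -- `‖x‖² = Mᵀ x · z ≤ ‖Mᵀ x‖ ‖z‖`, where `‖z‖² ≤ ‖x‖² / c`.
  have h1 : (Mᵀ *ᵥ x) ⬝ᵥ z = x ⬝ᵥ x := transpose_mulVec_dotProduct M x z
  have h2 := dotProduct_sq_le (Mᵀ *ᵥ x) z
  rw [h1] at h2
  have h3 := h z
  have hw := dotProduct_self_nonneg' (Mᵀ *ᵥ x)
  rcases (dotProduct_self_nonneg' z).eq_or_lt with h0 | h0
  · have : x ⬝ᵥ x = 0 := by rw [← h0] at h2; nlinarith
    rw [this]; simpa using hw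
  · have hx0 := dotProduct_self_nonneg' x
    have : c * (x ⬝ᵥ x) * (z ⬝ᵥ z) ≤ ((Mᵀ *ᵥ x) ⬝ᵥ (Mᵀ *ᵥ x)) * (z ⬝ᵥ z) := by nlinarith
    exact le_of_mul_le_mul_right this h0

theorem mulVec_injective_of_lower_bound {M : Matrix ι κ ℝ} {c : ℝ} (hc : 0 < c)
    (h : ∀ z, c * (z ⬝ᵥ z) ≤ (M *ᵥ z) ⬝ᵥ (M *ᵥ z)) : Function.Injective M.mulVecLin := by
  rw [← LinearMap.ker_eq_bot, LinearMap.ker_eq_bot']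
  intro z hz
  have h1 := h z
  rw [mulVecLin_apply] at hz
  rw [hz] at h1
  have h2 := dotProduct_self_nonneg' z
  have h3 : z ⬝ᵥ z = 0 := by simp only [dotProduct_zero] at h1; nlinarith
  exact dotProduct_self_eq_zero.1 h3

theorem mulVec_surjective_of_transpose_lower_bound {M : Matrix ι ι ℝ} {c : ℝ} (hc : 0 < c)
    (h : ∀ z, c * (z ⬝ᵥ z) ≤ (M *ᵥ z) ⬝ᵥ (M *ᵥ z)) (x : ι → ℝ) : ∃ v, M *ᵥ v = x := by
  classical
  have := LinearMap.injective_iff_surjective.1 (mulVec_injective_of_lower_bound hc h)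
  exact this x

/-- For a square matrix, a lower bound on `‖Mᵀ u‖²` carries over to `M`. -/
theorem lower_bound_of_transpose {M : Matrix ι ι ℝ} {c : ℝ} (hc : 0 < c)
    (h : ∀ u, c * (u ⬝ᵥ u) ≤ (Mᵀ *ᵥ u) ⬝ᵥ (Mᵀ *ᵥ u)) (x : ι → ℝ) :
    c * (x ⬝ᵥ x) ≤ (M *ᵥ x) ⬝ᵥ (M *ᵥ x) := by
  obtain ⟨v, rfl⟩ := mulVec_surjective_of_transpose_lower_bound hc h x
  simpa using mulVec_sq_le_transpose_mulVec_sq h v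

theorem sumElim_dotProduct (a : ι → ℝ) (b : κ → ℝ) (w : ι ⊕ κ → ℝ) :
    Sum.elim a b ⬝ᵥ w = a ⬝ᵥ (w ∘ Sum.inl) + b ⬝ᵥ (w ∘ Sum.inr) := by
  simp [dotProduct, Fintype.sum_sum_type]

theorem mulVec_sq_le_of_rows {N : ℕ} {M : Matrix (Fin N) κ ℝ} {B : ℝ}
    (h : ∀ i, M i ⬝ᵥ M i ≤ B) (x : κ → ℝ) : (M *ᵥ x) ⬝ᵥ (M *ᵥ x) ≤ N * B * (x ⬝ᵥ x) := by
  calc (M *ᵥ x) ⬝ᵥ (M *ᵥ x) = ∑ i, (M i ⬝ᵥ x) ^ 2 := by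
        simp [dotProduct, mulVec, sq]
    _ ≤ ∑ _i : Fin N, B * (x ⬝ᵥ x) := Finset.sum_le_sum fun i _ =>
        (dotProduct_sq_le _ _).trans (mul_le_mul_of_nonneg_right (h i) (dotProduct_self_nonneg' x))
    _ = _ := by simp [mul_assoc]

end DotProduct

/-! ### Products of variables with bounded eighth moments -/

section OcticMoments

variable {α : Type*} [MeasurableSpace α]

/-- `F` has an eighth moment bounded by `C`. -/
structure OcticBound (μ : Measure α) (F : α → ℝ) (C : ℝ) : Prop where
  measurable : Measurable F
  integrable : Integrable (fun x => |F x| ^ 8) μ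
  integral_le : ∫ x, |F x| ^ 8 ∂μ ≤ C

theorem OcticBound.mono {μ : Measure α} {F : α → ℝ} {C C' : ℝ} (h : OcticBound μ F C)
    (hC : C ≤ C') : OcticBound μ F C' :=
  ⟨h.measurable, h.integrable, h.integral_le.trans hC⟩

/-- A crude substitute for Hölder: each `|x i| ^ 8` is at most the right side `S ≥ 1`, so the eighth
power of the product is at most `S ^ 8`. The longest product needed later has six factors. -/
theorem prod_abs_le_one_add_sum {ι : Type*} [Fintype ι] (hι : Fintype.card ι ≤ 8) (x : ι → ℝ) :
    ∏ i, |x i| ≤ 1 + ∑ i, |x i| ^ 8 := by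
  set S := 1 + ∑ i, |x i| ^ 8 with hS
  have hsum : 0 ≤ ∑ i, |x i| ^ 8 := Finset.sum_nonneg fun i _ => by positivity
  have hS1 : 1 ≤ S := by linarith
  have hi : ∀ i, |x i| ^ 8 ≤ S := fun i => by
    have := Finset.single_le_sum (f := fun i => |x i| ^ 8) (fun i _ => by positivity)
      (Finset.mem_univ i)
    linarith
  have h8 : (∏ i, |x i|) ^ 8 ≤ S ^ 8 := by
    rw [← Finset.prod_pow]
    calc ∏ i, |x i| ^ 8 ≤ ∏ _i : ι, S :=
          Finset.prod_le_prod (fun i _ => by positivity) fun i _ => hi i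
      _ = S ^ Fintype.card ι := by simp
      _ ≤ S ^ 8 := pow_le_pow_right₀ hS1 hι
  exact le_of_pow_le_pow_left₀ (by norm_num) (by linarith) h8

/-- The mean of a product of at most eight factors with bounded eighth moments. -/
theorem OcticBound.prod {ι : Type*} [Fintype ι] (hι : Fintype.card ι ≤ 8) {μ : Measure α}
    [IsProbabilityMeasure μ] {F : ι → α → ℝ} {C : ℝ} (h : ∀ i, OcticBound μ (F i) C) :
    Integrable (fun x => ∏ i, F i x) μ ∧ |∫ x, ∏ i, F i x ∂μ| ≤ 1 + Fintype.card ι * C ∧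
      ∫ x, |∏ i, F i x| ∂μ ≤ 1 + Fintype.card ι * C := by
  have hint : Integrable (fun x => 1 + ∑ i, |F i x| ^ 8) μ :=
    (integrable_const 1).add (integrable_finsetSum _ fun i _ => (h i).integrable)
  have hle : ∀ x, |∏ i, F i x| ≤ 1 + ∑ i, |F i x| ^ 8 := fun x => by
    rw [Finset.abs_prod]
    exact prod_abs_le_one_add_sum hι fun i => F i x
  have hm : Measurable fun x => ∏ i, F i x :=
    Finset.measurable_prod _ fun i _ => (h i).measurable
  have hI : Integrable (fun x => ∏ i, F i x) μ :=
    hint.mono' hm.aestronglyMeasurable (.of_forall fun x => by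
      rw [Real.norm_eq_abs]; exact hle x)
  have hb : ∫ x, |∏ i, F i x| ∂μ ≤ 1 + Fintype.card ι * C := by
    calc ∫ x, |∏ i, F i x| ∂μ ≤ ∫ x, (1 + ∑ i, |F i x| ^ 8) ∂μ :=
          integral_mono hI.abs hint hle
      _ = 1 + ∑ i, ∫ x, |F i x| ^ 8 ∂μ := by
          rw [integral_add (integrable_const 1)
            (integrable_finsetSum _ fun i _ => (h i).integrable),
            integral_finsetSum _ fun i _ => (h i).integrable]
          simp
      _ ≤ 1 + ∑ _i : ι, C := by gcongr with i; exact (h i).integral_le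
      _ = _ := by simp
  exact ⟨hI, abs_integral_le_integral_abs.trans hb, hb⟩

/-- The eighth absolute moment of a standard Gaussian variable. -/
def gaussianOcticMoment : ℝ := ∫ x, |x| ^ 8 ∂gaussianReal 0 1

theorem gaussianOcticMoment_nonneg : 0 ≤ gaussianOcticMoment :=
  integral_nonneg fun x => by positivity

theorem octicBound_dotProduct {ι : Type*} [Fintype ι] {a : ι → ℝ} {B : ℝ} (h : a ⬝ᵥ a ≤ B) :
    OcticBound (stdPi ι) (fun w => a ⬝ᵥ w) (B ^ 4 * gaussianOcticMoment) := by
  refine ⟨by unfold dotProduct; fun_prop, integrable_abs_dotProduct_pow a 8, ?_⟩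
  rw [integral_abs_dotProduct_pow]
  refine mul_le_mul_of_nonneg_right ?_ gaussianOcticMoment_nonneg
  rw [show √(a ⬝ᵥ a) ^ 8 = (√(a ⬝ᵥ a) ^ 2) ^ 4 by ring,
    Real.sq_sqrt (dotProduct_self_nonneg' a)]
  exact pow_le_pow_left₀ (dotProduct_self_nonneg' a) h 4

end OcticMoments

end RTS

/-! ### Common and idiosyncratic components as functions of a Gaussian vector -/

namespace RTS

/-- The common component `Λ h` of the vector `w = (h, k)`. -/
def common {m N : ℕ} (Λ : Matrix (Fin N) (Fin m) ℝ) (w : Fin m ⊕ Fin N → ℝ) : Fin N → ℝ :=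
  Λ *ᵥ (w ∘ Sum.inl)

/-- The idiosyncratic component `A k` of the vector `w = (h, k)`. -/
def idio {m N : ℕ} (A : Matrix (Fin N) (Fin N) ℝ) (w : Fin m ⊕ Fin N → ℝ) : Fin N → ℝ :=
  A *ᵥ (w ∘ Sum.inr)

/-- The observation `Λ h + A k` made from the vector `w = (h, k)`. -/
def obs {m N : ℕ} (Λ : Matrix (Fin N) (Fin m) ℝ) (A : Matrix (Fin N) (Fin N) ℝ)
    (w : Fin m ⊕ Fin N → ℝ) : Fin N → ℝ :=
  common Λ w + idio A w

/-- Quantitative bounds on loadings and noise for a fixed dimension. -/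
structure DesignBounds {m N : ℕ} (Λ : Matrix (Fin N) (Fin m) ℝ) (A : Matrix (Fin N) (Fin N) ℝ)
    (B c₁ c₂ : ℝ) : Prop where
  nonneg : 0 ≤ B
  upper_pos : 0 < c₁
  lower_pos : 0 < c₂
  rows : ∀ i, Λ i ⬝ᵥ Λ i ≤ B
  upper : ∀ u, (Aᵀ *ᵥ u) ⬝ᵥ (Aᵀ *ᵥ u) ≤ c₁ * (u ⬝ᵥ u)
  lower : ∀ u, c₂ * (u ⬝ᵥ u) ≤ (Aᵀ *ᵥ u) ⬝ᵥ (Aᵀ *ᵥ u)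

variable {m N : ℕ} {Λ : Matrix (Fin N) (Fin m) ℝ} {A : Matrix (Fin N) (Fin N) ℝ} {B c₁ c₂ : ℝ}

theorem DesignBounds.neg (h : DesignBounds Λ A B c₁ c₂) : DesignBounds Λ (-A) B c₁ c₂ := by
  refine ⟨h.nonneg, h.upper_pos, h.lower_pos, h.rows, fun u => ?_, fun u => ?_⟩
  · simpa [transpose_neg, neg_mulVec] using h.upper u
  · simpa [transpose_neg, neg_mulVec] using h.lower u

theorem dotProduct_common (u : Fin N → ℝ) (w : Fin m ⊕ Fin N → ℝ) :
    u ⬝ᵥ common Λ w = Sum.elim (Λᵀ *ᵥ u) 0 ⬝ᵥ w := by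
  rw [sumElim_dotProduct, transpose_mulVec_dotProduct, zero_dotProduct, add_zero, common]

theorem dotProduct_idio (u : Fin N → ℝ) (w : Fin m ⊕ Fin N → ℝ) :
    u ⬝ᵥ idio A w = Sum.elim 0 (Aᵀ *ᵥ u) ⬝ᵥ w := by
  rw [sumElim_dotProduct, transpose_mulVec_dotProduct, zero_dotProduct, zero_add, idio]

theorem dotProduct_obs (u : Fin N → ℝ) (w : Fin m ⊕ Fin N → ℝ) :
    u ⬝ᵥ obs Λ A w = Sum.elim (Λᵀ *ᵥ u) (Aᵀ *ᵥ u) ⬝ᵥ w := by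
  rw [obs, dotProduct_add, dotProduct_common, dotProduct_idio, sumElim_dotProduct,
    sumElim_dotProduct, sumElim_dotProduct]
  simp

theorem sumElim_dotProduct_self {ι κ : Type*} [Fintype ι] [Fintype κ] (a : ι → ℝ) (b : κ → ℝ) :
    Sum.elim a b ⬝ᵥ Sum.elim a b = a ⬝ᵥ a + b ⬝ᵥ b := by
  rw [sumElim_dotProduct]
  rfl

theorem measurable_common (i : Fin N) : Measurable fun w => common Λ w i := by
  simp only [common, mulVec, dotProduct, Function.comp_def]
  fun_prop

theorem measurable_obs (i : Fin N) : Measurable fun w => obs Λ A w i := by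
  simp only [obs, common, idio, mulVec, dotProduct, Function.comp_def, Pi.add_apply]
  fun_prop

theorem measurable_obs_sq : Measurable fun w => obs Λ A w ⬝ᵥ obs Λ A w :=
  Finset.measurable_sum _ fun i _ => (measurable_obs i).mul (measurable_obs i)

/-- The first coordinate of the observation is already a nondegenerate Gaussian linear form, since
the lower noise bound gives its coefficient vector squared norm at least `c₂`. -/
theorem DesignBounds.ae_obs_ne_zero (h : DesignBounds Λ A B c₁ c₂) (hN : 0 < N) :
    ∀ᵐ w ∂stdPi (Fin m ⊕ Fin N), obs Λ A w ⬝ᵥ obs Λ A w ≠ 0 := by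
  set u : Fin N → ℝ := Pi.single ⟨0, hN⟩ 1 with hu
  set r : Fin m ⊕ Fin N → ℝ := Sum.elim (Λᵀ *ᵥ u) (Aᵀ *ᵥ u) with hr
  have hr0 : 0 < r ⬝ᵥ r := by
    rw [hr, sumElim_dotProduct_self]
    have h1 := h.lower u
    have h2 : u ⬝ᵥ u = 1 := by simp [hu]
    have h3 := dotProduct_self_nonneg' (Λᵀ *ᵥ u)
    have := h.lower_pos
    rw [h2] at h1
    linarith
  have hm : Measurable fun w : Fin m ⊕ Fin N → ℝ => r ⬝ᵥ w := by unfold dotProduct; fun_prop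
  have hz : (stdPi (Fin m ⊕ Fin N)).map (fun w => r ⬝ᵥ w) {0} = 0 := by
    rw [stdPi_map_dotProduct, Measure.map_apply (by fun_prop) (measurableSet_singleton 0)]
    have := nullSingletonClass_gaussianReal (μ := 0) one_ne_zero
    refine measure_mono_null (t := {0}) (fun x hx => ?_) (measure_singleton _)
    have h3 : √(r ⬝ᵥ r) ≠ 0 := (Real.sqrt_pos.2 hr0).ne'
    simpa [h3] using hx
  rw [Measure.map_apply hm (measurableSet_singleton 0)] at hz
  rw [ae_iff]
  refine measure_mono_null (fun w hw => ?_) hz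
  have h0 : obs Λ A w = 0 := dotProduct_self_eq_zero.1 (by simpa using hw)
  have h4 := dotProduct_obs (Λ := Λ) (A := A) u w
  rw [h0, dotProduct_zero] at h4
  exact h4.symm

open scoped ENNReal NNReal in
/-- Eighth moments of `N / ‖y‖²`. -/
theorem exists_octicBound_div_obs (m : ℕ) {B c₁ c₂ : ℝ} :
    ∃ C : ℝ, ∀ (N : ℕ) (Λ : Matrix (Fin N) (Fin m) ℝ) (A : Matrix (Fin N) (Fin N) ℝ), 32 ≤ N →
      DesignBounds Λ A B c₁ c₂ →
      OcticBound (stdPi (Fin m ⊕ Fin N)) (fun w => N / (obs Λ A w ⬝ᵥ obs Λ A w)) C := by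
  obtain ⟨C, hC⟩ := exists_lintegral_div_dotProduct_pow_le
  refine ⟨(c₂⁻¹) ^ 8 * C, fun N Λ A hN h => ?_⟩
  have hc := h.lower_pos
  have hlow := lower_bound_of_transpose hc h.lower
  have hm : Measurable fun w => (N : ℝ) / (obs Λ A w ⬝ᵥ obs Λ A w) :=
    measurable_const.div measurable_obs_sq
  -- Condition on the factors. As `A` is onto, the common component is `A v`, so the observation is
  -- `A (k + v)` with `k` Gaussian. The negative moments are bounded uniformly in the shift, so the
  -- dependence of `v` on `a` is harmless.
  have hpt : ∀ (a : Fin m → ℝ), ∃ v : Fin N → ℝ, ∀ k : Fin N → ℝ,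
      ENNReal.ofReal ((N / (obs Λ A (Sum.elim a k) ⬝ᵥ obs Λ A (Sum.elim a k))) ^ 8) ≤
        ENNReal.ofReal ((c₂⁻¹) ^ 8) * ENNReal.ofReal ((N / ((k + v) ⬝ᵥ (k + v))) ^ 8) := by
    intro a
    obtain ⟨v, hv⟩ := mulVec_surjective_of_transpose_lower_bound hc hlow (Λ *ᵥ a)
    refine ⟨v, fun k => ?_⟩
    have hobs : obs Λ A (Sum.elim a k) = A *ᵥ (k + v) := by
      rw [obs, common, idio, Sum.elim_comp_inl, Sum.elim_comp_inr, mulVec_add, hv, add_comm]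
    rw [hobs, ← ENNReal.ofReal_mul (by positivity), ← mul_pow]
    have h1 := hlow (k + v)
    have h2 := dotProduct_self_nonneg' (k + v)
    refine ENNReal.ofReal_le_ofReal (pow_le_pow_left₀
      (div_nonneg (Nat.cast_nonneg _) (dotProduct_self_nonneg' _)) ?_ 8)
    rcases h2.eq_or_lt with h0 | h0
    · have : k + v = 0 := dotProduct_self_eq_zero.1 h0.symm
      simp [this]
    · rw [inv_mul_eq_div, div_div, mul_comm _ c₂]
      exact div_le_div_of_nonneg_left (Nat.cast_nonneg _) (by positivity) h1
  have hlin : ∫⁻ w, ENNReal.ofReal ((N / (obs Λ A w ⬝ᵥ obs Λ A w)) ^ 8)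
      ∂stdPi (Fin m ⊕ Fin N) ≤ ENNReal.ofReal ((c₂⁻¹) ^ 8 * C) := by
    have hmp := measurePreserving_sumPiEquivProdPi_symm (X := fun _ : Fin m ⊕ Fin N => ℝ)
      fun _ => gaussianReal 0 1
    have hmf : Measurable fun w => ENNReal.ofReal ((N / (obs Λ A w ⬝ᵥ obs Λ A w)) ^ 8) :=
      (hm.pow_const 8).ennreal_ofReal
    rw [← hmp.lintegral_comp hmf]
    refine (lintegral_prod _ (hmf.comp hmp.measurable).aemeasurable).trans_le ?_
    calc _ ≤ ∫⁻ _a : Fin m → ℝ, ENNReal.ofReal ((c₂⁻¹) ^ 8 * C) ∂stdPi (Fin m) := by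
          refine lintegral_mono fun a => ?_
          obtain ⟨v, hv⟩ := hpt a
          calc _ ≤ ∫⁻ k, ENNReal.ofReal ((c₂⁻¹) ^ 8) *
                ENNReal.ofReal ((N / ((k + v) ⬝ᵥ (k + v))) ^ 8) ∂stdPi (Fin N) :=
                lintegral_mono fun k => hv k
            _ ≤ _ := by
                rw [lintegral_const_mul' _ _ ENNReal.ofReal_ne_top,
                  ENNReal.ofReal_mul (by positivity), ENNReal.ofReal_coe_nnreal]
                exact mul_le_mul_right (hC N hN v) _
      _ = _ := by simp
  have hnn : ∀ w, 0 ≤ (N / (obs Λ A w ⬝ᵥ obs Λ A w)) ^ 8 := fun w => by positivity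
  have habs : ∀ w, |(N : ℝ) / (obs Λ A w ⬝ᵥ obs Λ A w)| ^ 8 =
      (N / (obs Λ A w ⬝ᵥ obs Λ A w)) ^ 8 := fun w => Even.pow_abs (by decide) _
  refine ⟨hm, ?_, ?_⟩
  · simp only [habs]
    refine ⟨(hm.pow_const 8).aestronglyMeasurable, ?_⟩
    rw [hasFiniteIntegral_iff_ofReal (.of_forall hnn)]
    exact hlin.trans_lt ENNReal.ofReal_lt_top
  · simp only [habs]
    rw [integral_eq_lintegral_of_nonneg_ae (.of_forall hnn) (hm.pow_const 8).aestronglyMeasurable]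
    exact ENNReal.toReal_le_of_le_ofReal (by positivity) hlin

/-- Reflection of the idiosyncratic coordinates preserves the standard Gaussian measure. -/
theorem measurePreserving_reflect (m N : ℕ) :
    MeasurePreserving (fun w : Fin m ⊕ Fin N → ℝ => fun i => Sum.elim (fun _ => (1 : ℝ))
      (fun _ => -1) i * w i) (stdPi (Fin m ⊕ Fin N)) (stdPi (Fin m ⊕ Fin N)) := by
  refine measurePreserving_pi (fun _ => gaussianReal 0 1) (fun _ => gaussianReal 0 1) fun i => ?_
  refine ⟨by fun_prop, ?_⟩
  rw [gaussianReal_map_const_mul]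
  rcases i with i | i <;> simp

theorem common_reflect (w : Fin m ⊕ Fin N → ℝ) :
    common Λ (fun i => Sum.elim (fun _ => (1 : ℝ)) (fun _ => -1) i * w i) = common Λ w := by
  simp [common, Function.comp_def]

theorem idio_reflect (w : Fin m ⊕ Fin N → ℝ) :
    idio A (fun i => Sum.elim (fun _ => (1 : ℝ)) (fun _ => -1) i * w i) = -idio A w := by
  rw [idio, idio, ← mulVec_neg]
  congr 1
  ext i
  simp

end RTS

/-! ### Gaussian means of the kernels -/

namespace RTS

/-- Uniform eighth-moment bounds for the building blocks of the kernels. -/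
structure OcticDesign {m N : ℕ} (Λ : Matrix (Fin N) (Fin m) ℝ) (A : Matrix (Fin N) (Fin N) ℝ)
    (Q : ℝ) : Prop where
  common_form : ∀ u : Fin N → ℝ, u ⬝ᵥ u ≤ 1 →
    OcticBound (stdPi (Fin m ⊕ Fin N)) (fun w => (√N)⁻¹ * (u ⬝ᵥ common Λ w)) Q
  idio_form : ∀ u : Fin N → ℝ, u ⬝ᵥ u ≤ 1 →
    OcticBound (stdPi (Fin m ⊕ Fin N)) (fun w => u ⬝ᵥ idio A w) Q
  factor : ∀ j : Fin m, OcticBound (stdPi (Fin m ⊕ Fin N)) (fun w => w (Sum.inl j)) Q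
  loading_idio : ∀ j : Fin m,
    OcticBound (stdPi (Fin m ⊕ Fin N)) (fun w => (√N)⁻¹ * (Λᵀ j ⬝ᵥ idio A w)) Q
  inv : OcticBound (stdPi (Fin m ⊕ Fin N)) (fun w => N / (obs Λ A w ⬝ᵥ obs Λ A w)) Q
  inv_neg : OcticBound (stdPi (Fin m ⊕ Fin N)) (fun w => N / (obs Λ (-A) w ⬝ᵥ obs Λ (-A) w)) Q

theorem inv_sqrt_sq {N : ℕ} : (√(N : ℝ))⁻¹ * (√(N : ℝ))⁻¹ = (N : ℝ)⁻¹ := by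
  rw [← mul_inv, Real.mul_self_sqrt (Nat.cast_nonneg _)]

/-- All blocks except the two inverse norms are Gaussian linear forms, and the scaling `(√N)⁻¹`
offsets `‖Λᵀ u‖² ≤ N B` and the size `N B` of a column of `Λ`. Replacing `A` by `-A` keeps the
design bounds, which covers `inv_neg`. -/
theorem exists_octicDesign (m : ℕ) {B c₁ c₂ : ℝ} :
    ∃ Q : ℝ, 0 ≤ Q ∧ ∀ (N : ℕ) (Λ : Matrix (Fin N) (Fin m) ℝ) (A : Matrix (Fin N) (Fin N) ℝ),
      32 ≤ N → DesignBounds Λ A B c₁ c₂ → OcticDesign Λ A Q := by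
  obtain ⟨C, hC⟩ := exists_octicBound_div_obs m (B := B) (c₁ := c₁) (c₂ := c₂)
  set G := gaussianOcticMoment with hG
  have hG0 : 0 ≤ G := gaussianOcticMoment_nonneg
  have e1 : 0 ≤ B ^ 4 * G := by positivity
  have e2 : 0 ≤ c₁ ^ 4 * G := by positivity
  have e3 : 0 ≤ (c₁ * B) ^ 4 * G := by positivity
  refine ⟨B ^ 4 * G + c₁ ^ 4 * G + (c₁ * B) ^ 4 * G + 1 ^ 4 * G + |C|, by positivity,
    fun N Λ A hN h => ?_⟩
  have hNpos : (0 : ℝ) < N := by exact_mod_cast (by omega : 0 < N)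
  have hCle := le_abs_self C
  have hC0 := abs_nonneg C
  have hΛu : ∀ u : Fin N → ℝ, (Λᵀ *ᵥ u) ⬝ᵥ (Λᵀ *ᵥ u) ≤ N * B * (u ⬝ᵥ u) :=
    transpose_mulVec_sq_le (mul_nonneg hNpos.le h.nonneg) (mulVec_sq_le_of_rows h.rows)
  have hc₁ := h.upper_pos
  have hB := h.nonneg
  refine ⟨fun u hu => ?_, fun u hu => ?_, fun j => ?_, fun j => ?_, ?_, ?_⟩
  · have h1 := octicBound_dotProduct (ι := Fin m ⊕ Fin N)
      (a := (√(N : ℝ))⁻¹ • Sum.elim (Λᵀ *ᵥ u) 0) (B := B) (by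
        rw [smul_dotProduct, dotProduct_smul, sumElim_dotProduct_self, smul_eq_mul, smul_eq_mul,
          ← mul_assoc, inv_sqrt_sq, zero_dotProduct, add_zero, inv_mul_le_iff₀ hNpos]
        refine (hΛu u).trans ?_
        exact mul_le_of_le_one_right (by positivity) hu)
    simp only [smul_dotProduct, smul_eq_mul, ← dotProduct_common] at h1
    exact h1.mono (by linarith)
  · have h1 := octicBound_dotProduct (ι := Fin m ⊕ Fin N)
      (a := Sum.elim 0 (Aᵀ *ᵥ u)) (B := c₁) (by
        rw [sumElim_dotProduct_self, zero_dotProduct, zero_add]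
        exact (h.upper u).trans (mul_le_of_le_one_right hc₁.le hu))
    simp only [← dotProduct_idio] at h1
    exact h1.mono (by linarith)
  · have h1 := octicBound_dotProduct (ι := Fin m ⊕ Fin N)
      (a := Pi.single (Sum.inl j) 1) (B := 1) (by simp)
    simp only [single_dotProduct, one_mul] at h1
    exact h1.mono (by linarith)
  · have hcol : Λᵀ j ⬝ᵥ Λᵀ j ≤ N * B := by
      calc Λᵀ j ⬝ᵥ Λᵀ j = ∑ i, Λ i j * Λ i j := rfl
        _ ≤ ∑ _i : Fin N, B := Finset.sum_le_sum fun i _ =>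
            (Finset.single_le_sum (f := fun j => Λ i j * Λ i j)
              (fun _ _ => mul_self_nonneg _) (Finset.mem_univ j)).trans (h.rows i)
        _ = N * B := by simp
    have h1 := octicBound_dotProduct (ι := Fin m ⊕ Fin N)
      (a := (√(N : ℝ))⁻¹ • Sum.elim (0 : Fin m → ℝ) (Aᵀ *ᵥ Λᵀ j)) (B := c₁ * B) (by
        rw [smul_dotProduct, dotProduct_smul, sumElim_dotProduct_self, smul_eq_mul, smul_eq_mul,
          ← mul_assoc, inv_sqrt_sq, zero_dotProduct, zero_add, inv_mul_le_iff₀ hNpos]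
        refine (h.upper _).trans ((mul_le_mul_of_nonneg_left hcol hc₁.le).trans_eq (by ring)))
    simp only [smul_dotProduct, smul_eq_mul, ← dotProduct_idio] at h1
    exact h1.mono (by linarith)
  · exact (hC N Λ A hN h).mono (by linarith)
  · exact (hC N Λ (-A) hN h.neg).mono (by linarith)

variable {m N : ℕ} {Λ : Matrix (Fin N) (Fin m) ℝ} {A : Matrix (Fin N) (Fin N) ℝ} {B c₁ c₂ Q : ℝ}

theorem idio_neg (w : Fin m ⊕ Fin N → ℝ) : idio (-A) w = -idio A w := by
  rw [idio, idio, neg_mulVec]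

theorem obs_reflect (w : Fin m ⊕ Fin N → ℝ) :
    obs Λ A (fun i => Sum.elim (fun _ => (1 : ℝ)) (fun _ => -1) i * w i) = obs Λ (-A) w := by
  rw [obs, obs, common_reflect, idio_reflect, idio_neg]

theorem common_dotProduct_eq_sum (v : Fin N → ℝ) (w : Fin m ⊕ Fin N → ℝ) :
    common Λ w ⬝ᵥ v = ∑ j, w (Sum.inl j) * (Λᵀ j ⬝ᵥ v) := by
  rw [dotProduct_comm, common, ← transpose_mulVec_dotProduct, dotProduct_comm]
  rfl

/-- Pulling out `1/N` leaves `N / ‖y‖²` times two forms with bounded moments. -/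
theorem OcticDesign.integrable_idio_idio (hQ : OcticDesign Λ A Q) (hN : 0 < N) {u v : Fin N → ℝ}
    (hu : u ⬝ᵥ u ≤ 1) (hv : v ⬝ᵥ v ≤ 1) :
    Integrable (fun w => (obs Λ A w ⬝ᵥ obs Λ A w)⁻¹ * ((u ⬝ᵥ idio A w) * (v ⬝ᵥ idio A w)))
      (stdPi (Fin m ⊕ Fin N)) ∧
    |∫ w, (obs Λ A w ⬝ᵥ obs Λ A w)⁻¹ * ((u ⬝ᵥ idio A w) * (v ⬝ᵥ idio A w))
      ∂stdPi (Fin m ⊕ Fin N)| ≤ (1 + 3 * Q) / N := by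
  have hNpos : (0 : ℝ) < N := by exact_mod_cast hN
  have h := OcticBound.prod (μ := stdPi (Fin m ⊕ Fin N)) (C := Q) (ι := Fin 3) (by simp)
    (F := ![fun w => N / (obs Λ A w ⬝ᵥ obs Λ A w), fun w => u ⬝ᵥ idio A w,
      fun w => v ⬝ᵥ idio A w])
    (by
      rw [Fin.forall_fin_succ, Fin.forall_fin_succ, Fin.forall_fin_succ]
      exact ⟨hQ.inv, hQ.idio_form u hu, hQ.idio_form v hv, fun i => i.elim0⟩)
  simp only [Fin.prod_univ_three, Matrix.cons_val, Fintype.card_fin] at h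
  have heq : (fun w => (obs Λ A w ⬝ᵥ obs Λ A w)⁻¹ * ((u ⬝ᵥ idio A w) * (v ⬝ᵥ idio A w))) =
      fun w => (N : ℝ)⁻¹ * (N / (obs Λ A w ⬝ᵥ obs Λ A w) * (u ⬝ᵥ idio A w) * (v ⬝ᵥ idio A w)) := by
    ext w
    rw [div_eq_mul_inv]
    field_simp
  rw [heq]
  refine ⟨h.1.const_mul _, ?_⟩
  rw [integral_const_mul, abs_mul, abs_of_pos (inv_pos.2 hNpos), inv_mul_eq_div]
  gcongr
  exact_mod_cast h.2.1

/-- The same normalization leaves a factor `N⁻¹ √N`. This gives integrability, but as a size bound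
it would only be `N^(-1/2)`. -/
theorem OcticDesign.integrable_common_idio (hQ : OcticDesign Λ A Q) (hN : 0 < N)
    {u v : Fin N → ℝ} (hu : u ⬝ᵥ u ≤ 1) (hv : v ⬝ᵥ v ≤ 1) :
    Integrable (fun w => (obs Λ A w ⬝ᵥ obs Λ A w)⁻¹ * ((u ⬝ᵥ common Λ w) * (v ⬝ᵥ idio A w)))
      (stdPi (Fin m ⊕ Fin N)) := by
  have hNpos : (0 : ℝ) < N := by exact_mod_cast hN
  have hsq : √(N : ℝ) ≠ 0 := (Real.sqrt_pos.2 hNpos).ne'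
  have h := OcticBound.prod (μ := stdPi (Fin m ⊕ Fin N)) (C := Q) (ι := Fin 3) (by simp)
    (F := ![fun w => N / (obs Λ A w ⬝ᵥ obs Λ A w), fun w => (√N)⁻¹ * (u ⬝ᵥ common Λ w),
      fun w => v ⬝ᵥ idio A w])
    (by
      rw [Fin.forall_fin_succ, Fin.forall_fin_succ, Fin.forall_fin_succ]
      exact ⟨hQ.inv, hQ.common_form u hu, hQ.idio_form v hv, fun i => i.elim0⟩)
  simp only [Fin.prod_univ_three, Matrix.cons_val, Fintype.card_fin] at h
  refine (h.1.const_mul ((N : ℝ)⁻¹ * √N)).congr (.of_forall fun w => ?_)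
  simp only
  rw [div_eq_mul_inv]
  field_simp

/-- The cross terms are of order `1 / N`, since their leading parts cancel under the reflection of
the idiosyncratic coordinates. -/
theorem OcticDesign.abs_integral_common_idio_le (hQ : OcticDesign Λ A Q)
    (hD : DesignBounds Λ A B c₁ c₂) (hN : 0 < N)
    {u v : Fin N → ℝ} (hu : u ⬝ᵥ u ≤ 1) (hv : v ⬝ᵥ v ≤ 1) :
    |∫ w, (obs Λ A w ⬝ᵥ obs Λ A w)⁻¹ * ((u ⬝ᵥ common Λ w) * (v ⬝ᵥ idio A w))
      ∂stdPi (Fin m ⊕ Fin N)| ≤ 2 * m * (1 + 6 * Q) / N := by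
  have hNpos : (0 : ℝ) < N := by exact_mod_cast hN
  have hsq : √(N : ℝ) ≠ 0 := (Real.sqrt_pos.2 hNpos).ne'
  have hsq2 : (√(N : ℝ)) ^ 2 = N := Real.sq_sqrt hNpos.le
  set φ : (Fin m ⊕ Fin N → ℝ) → ℝ := fun w =>
    (obs Λ A w ⬝ᵥ obs Λ A w)⁻¹ * ((u ⬝ᵥ common Λ w) * (v ⬝ᵥ idio A w)) with hφ
  set φ' : (Fin m ⊕ Fin N → ℝ) → ℝ := fun w =>
    (obs Λ (-A) w ⬝ᵥ obs Λ (-A) w)⁻¹ * ((u ⬝ᵥ common Λ w) * -(v ⬝ᵥ idio A w)) with hφ'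
  have hint : Integrable φ (stdPi (Fin m ⊕ Fin N)) := hQ.integrable_common_idio hN hu hv
  have hmp := measurePreserving_reflect m N
  have hcomp : (φ ∘ fun w i => Sum.elim (fun _ => (1 : ℝ)) (fun _ => -1) i * w i) = φ' := by
    ext w
    simp only [hφ, hφ', Function.comp_apply, obs_reflect, common_reflect, idio_reflect,
      dotProduct_neg]
  have hint' : Integrable φ' (stdPi (Fin m ⊕ Fin N)) := by
    rw [← hcomp]
    exact hmp.integrable_comp_of_integrable hint
  -- The reflection preserves the measure, so `2 ∫ φ = ∫ (φ + φ')` and only the symmetrized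
  -- integrand has to be estimated.
  have hI : ∫ w, φ' w ∂stdPi (Fin m ⊕ Fin N) = ∫ w, φ w ∂stdPi (Fin m ⊕ Fin N) := by
    have h1 := integral_map (μ := stdPi (Fin m ⊕ Fin N)) hmp.measurable.aemeasurable (f := φ)
      (by rw [hmp.map_eq]; exact hint.aestronglyMeasurable)
    rw [hmp.map_eq] at h1
    rw [h1, ← hcomp]
    rfl
  set ψ : Fin m → (Fin m ⊕ Fin N → ℝ) → ℝ := fun j w =>
    (N / (obs Λ A w ⬝ᵥ obs Λ A w)) * (N / (obs Λ (-A) w ⬝ᵥ obs Λ (-A) w)) *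
      ((√N)⁻¹ * (u ⬝ᵥ common Λ w)) * (v ⬝ᵥ idio A w) * w (Sum.inl j) *
      ((√N)⁻¹ * (Λᵀ j ⬝ᵥ idio A w)) with hψ
  have hψb : ∀ j, Integrable (ψ j) (stdPi (Fin m ⊕ Fin N)) ∧
      |∫ w, ψ j w ∂stdPi (Fin m ⊕ Fin N)| ≤ 1 + 6 * Q := by
    intro j
    have h := OcticBound.prod (μ := stdPi (Fin m ⊕ Fin N)) (C := Q) (ι := Fin 6) (by simp)
      (F := ![fun w => N / (obs Λ A w ⬝ᵥ obs Λ A w),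
        fun w => N / (obs Λ (-A) w ⬝ᵥ obs Λ (-A) w), fun w => (√N)⁻¹ * (u ⬝ᵥ common Λ w),
        fun w => v ⬝ᵥ idio A w, fun w => w (Sum.inl j), fun w => (√N)⁻¹ * (Λᵀ j ⬝ᵥ idio A w)])
      (by
        simp only [Fin.forall_fin_succ]
        exact ⟨hQ.inv, hQ.inv_neg, hQ.common_form u hu, hQ.idio_form v hv, hQ.factor j, hQ.loading_idio j,
          fun i => i.elim0⟩)
    simp only [Fin.prod_univ_six, Matrix.cons_val, Fintype.card_fin] at h
    exact ⟨h.1, by exact_mod_cast h.2.1⟩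
  -- With `a`, `b` the squared norms before and after reflection, `1/a - 1/b = (b - a)/(ab)` and `b
  -- - a = -4 (Λh · Ak)`. Expanding this product over the `m` factors turns the sum into `m`
  -- normalized six-fold products with prefactor `-4/N`.
  have hsym : ∀ᵐ w ∂stdPi (Fin m ⊕ Fin N), φ w + φ' w = (-(4 / N)) * ∑ j, ψ j w := by
    filter_upwards [hD.ae_obs_ne_zero hN, hD.neg.ae_obs_ne_zero hN] with w h1 h2
    have hsum : ∑ j, ψ j w = (N / (obs Λ A w ⬝ᵥ obs Λ A w)) *
        (N / (obs Λ (-A) w ⬝ᵥ obs Λ (-A) w)) * ((√N)⁻¹ * (u ⬝ᵥ common Λ w)) *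
        (v ⬝ᵥ idio A w) * ((√N)⁻¹ * (common Λ w ⬝ᵥ idio A w)) := by
      rw [common_dotProduct_eq_sum, Finset.mul_sum, Finset.mul_sum]
      refine Finset.sum_congr rfl fun j _ => ?_
      simp only [hψ]
      ring
    rw [hsum]
    simp only [hφ, hφ']
    have hdiff : obs Λ (-A) w ⬝ᵥ obs Λ (-A) w =
        obs Λ A w ⬝ᵥ obs Λ A w - 4 * (common Λ w ⬝ᵥ idio A w) := by
      rw [obs, obs, idio_neg]
      simp only [add_dotProduct, dotProduct_add, neg_dotProduct, dotProduct_neg]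
      rw [dotProduct_comm (idio A w) (common Λ w)]
      ring
    set a := obs Λ A w ⬝ᵥ obs Λ A w
    set b := obs Λ (-A) w ⬝ᵥ obs Λ (-A) w
    have hzc : common Λ w ⬝ᵥ idio A w = (a - b) / 4 := by linarith
    rw [hzc]
    field_simp
    rw [hsq2]
    ring
  have h2I : 2 * ∫ w, φ w ∂stdPi (Fin m ⊕ Fin N) =
      (-(4 / N)) * ∑ j, ∫ w, ψ j w ∂stdPi (Fin m ⊕ Fin N) := by
    have h3 : ∫ w, (φ w + φ' w) ∂stdPi (Fin m ⊕ Fin N) =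
        2 * ∫ w, φ w ∂stdPi (Fin m ⊕ Fin N) := by
      rw [integral_add hint hint', hI]
      ring
    rw [← h3, integral_congr_ae hsym, integral_const_mul,
      integral_finsetSum _ fun j _ => (hψb j).1]
  have h4 : |∑ j, ∫ w, ψ j w ∂stdPi (Fin m ⊕ Fin N)| ≤ m * (1 + 6 * Q) := by
    refine (Finset.abs_sum_le_sum_abs _ _).trans ?_
    refine (Finset.sum_le_sum fun j _ => (hψb j).2).trans ?_
    simp [mul_add]
  have h5 : ∫ w, φ w ∂stdPi (Fin m ⊕ Fin N) =
      (-(2 / N)) * ∑ j, ∫ w, ψ j w ∂stdPi (Fin m ⊕ Fin N) := by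
    have : (-(2 / N) : ℝ) = (-(4 / N)) / 2 := by ring
    rw [this]
    linarith
  rw [h5, abs_mul, abs_neg, abs_of_pos (by positivity : (0 : ℝ) < 2 / N)]
  calc 2 / (N : ℝ) * |∑ j, ∫ w, ψ j w ∂stdPi (Fin m ⊕ Fin N)|
      ≤ 2 / N * (m * (1 + 6 * Q)) := by gcongr
    _ = _ := by ring

/-- The mean of the part of the Kendall kernel that is not due to the common components has
operator norm of order `1 / N`. -/
theorem OcticDesign.abs_integral_residual_le (hQ : OcticDesign Λ A Q)
    (hD : DesignBounds Λ A B c₁ c₂) (hN : 0 < N)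
    {u v : Fin N → ℝ} (hu : u ⬝ᵥ u ≤ 1) (hv : v ⬝ᵥ v ≤ 1) :
    |∫ w, (obs Λ A w ⬝ᵥ obs Λ A w)⁻¹ * ((u ⬝ᵥ obs Λ A w) * (v ⬝ᵥ obs Λ A w) -
      (u ⬝ᵥ common Λ w) * (v ⬝ᵥ common Λ w)) ∂stdPi (Fin m ⊕ Fin N)| ≤
      (4 * m * (1 + 6 * Q) + (1 + 3 * Q)) / N := by
  have h1 := hQ.integrable_common_idio hN hu hv
  have h2 := hQ.integrable_common_idio hN hv hu
  have h3 := hQ.integrable_idio_idio hN hu hv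
  have b1 := hQ.abs_integral_common_idio_le hD hN hu hv
  have b2 := hQ.abs_integral_common_idio_le hD hN hv hu
  have heq : ∀ w, (obs Λ A w ⬝ᵥ obs Λ A w)⁻¹ * ((u ⬝ᵥ obs Λ A w) * (v ⬝ᵥ obs Λ A w) -
      (u ⬝ᵥ common Λ w) * (v ⬝ᵥ common Λ w)) =
      (obs Λ A w ⬝ᵥ obs Λ A w)⁻¹ * ((u ⬝ᵥ common Λ w) * (v ⬝ᵥ idio A w)) +
      (obs Λ A w ⬝ᵥ obs Λ A w)⁻¹ * ((v ⬝ᵥ common Λ w) * (u ⬝ᵥ idio A w)) +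
      (obs Λ A w ⬝ᵥ obs Λ A w)⁻¹ * ((u ⬝ᵥ idio A w) * (v ⬝ᵥ idio A w)) := by
    intro w
    have e1 : ∀ x : Fin N → ℝ, x ⬝ᵥ obs Λ A w = x ⬝ᵥ common Λ w + x ⬝ᵥ idio A w := fun x => by
      rw [obs, dotProduct_add]
    rw [e1 u, e1 v]
    ring
  simp only [heq]
  have h12 := h1.add h2
  simp only [Pi.add_def] at h12
  rw [integral_add h12 h3.1, integral_add h1 h2]
  refine (abs_add_le _ _).trans ((add_le_add ((abs_add_le _ _).trans (add_le_add b1 b2))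
    h3.2).trans_eq ?_)
  ring

/-- The second moment of `‖Λ h‖² / ‖y‖²`. -/
theorem OcticDesign.integral_common_ratio_sq_le (hQ : OcticDesign Λ A Q)
    (hD : DesignBounds Λ A B c₁ c₂) (hN : 0 < N) :
    Integrable (fun w => ((obs Λ A w ⬝ᵥ obs Λ A w)⁻¹ * (common Λ w ⬝ᵥ common Λ w)) ^ 2)
      (stdPi (Fin m ⊕ Fin N)) ∧
    ∫ w, ((obs Λ A w ⬝ᵥ obs Λ A w)⁻¹ * (common Λ w ⬝ᵥ common Λ w)) ^ 2
      ∂stdPi (Fin m ⊕ Fin N) ≤ B ^ 2 * m * (m * (1 + 6 * Q)) := by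
  have hNpos : (0 : ℝ) < N := by exact_mod_cast hN
  set ψ : Fin m → (Fin m ⊕ Fin N → ℝ) → ℝ := fun j w =>
    w (Sum.inl j) * w (Sum.inl j) * w (Sum.inl j) * w (Sum.inl j) *
      (N / (obs Λ A w ⬝ᵥ obs Λ A w)) * (N / (obs Λ A w ⬝ᵥ obs Λ A w)) with hψ
  have hψb : ∀ j, Integrable (ψ j) (stdPi (Fin m ⊕ Fin N)) ∧
      |∫ w, ψ j w ∂stdPi (Fin m ⊕ Fin N)| ≤ 1 + 6 * Q := by
    intro j
    have h := OcticBound.prod (μ := stdPi (Fin m ⊕ Fin N)) (C := Q) (ι := Fin 6) (by simp)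
      (F := ![fun w => w (Sum.inl j), fun w => w (Sum.inl j), fun w => w (Sum.inl j),
        fun w => w (Sum.inl j), fun w => N / (obs Λ A w ⬝ᵥ obs Λ A w),
        fun w => N / (obs Λ A w ⬝ᵥ obs Λ A w)])
      (by
        simp only [Fin.forall_fin_succ]
        exact ⟨hQ.factor j, hQ.factor j, hQ.factor j, hQ.factor j, hQ.inv, hQ.inv,
          fun i => i.elim0⟩)
    simp only [Fin.prod_univ_six, Matrix.cons_val, Fintype.card_fin] at h
    exact ⟨h.1, by exact_mod_cast h.2.1⟩
  have hmeas : Measurable fun w =>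
      ((obs Λ A w ⬝ᵥ obs Λ A w)⁻¹ * (common Λ w ⬝ᵥ common Λ w)) ^ 2 := by
    have hc : Measurable fun w => common Λ w ⬝ᵥ common Λ w :=
      Finset.measurable_sum _ fun i _ => (measurable_common i).mul (measurable_common i)
    exact (measurable_obs_sq.inv.mul hc).pow_const 2
  have hle : ∀ w, ((obs Λ A w ⬝ᵥ obs Λ A w)⁻¹ * (common Λ w ⬝ᵥ common Λ w)) ^ 2 ≤
      B ^ 2 * m * ∑ j, ψ j w := by
    intro w
    have hz := mulVec_sq_le_of_rows hD.rows (w ∘ Sum.inl)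
    have hy := dotProduct_self_nonneg' (obs Λ A w)
    have hz0 := dotProduct_self_nonneg' (common Λ w)
    have h1 : (obs Λ A w ⬝ᵥ obs Λ A w)⁻¹ * (common Λ w ⬝ᵥ common Λ w) ≤
        (obs Λ A w ⬝ᵥ obs Λ A w)⁻¹ * (N * B * ((w ∘ Sum.inl) ⬝ᵥ (w ∘ Sum.inl))) :=
      mul_le_mul_of_nonneg_left hz (inv_nonneg.2 hy)
    refine (pow_le_pow_left₀ (mul_nonneg (inv_nonneg.2 hy) hz0) h1 2).trans ?_
    -- Cauchy–Schwarz over the `m` factors avoids mixed terms: only fourth powers of single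
    -- coordinates remain, each times two copies of `N / ‖y‖²`.
    have h2 : ((w ∘ Sum.inl) ⬝ᵥ (w ∘ Sum.inl)) ^ 2 ≤
        m * ∑ j, (w (Sum.inl j) * w (Sum.inl j)) ^ 2 := by
      have := sq_sum_le_card_mul_sum_sq (s := Finset.univ)
        (f := fun j : Fin m => w (Sum.inl j) * w (Sum.inl j))
      simpa [dotProduct] using this
    calc ((obs Λ A w ⬝ᵥ obs Λ A w)⁻¹ * (N * B * ((w ∘ Sum.inl) ⬝ᵥ (w ∘ Sum.inl)))) ^ 2
        = B ^ 2 * (N / (obs Λ A w ⬝ᵥ obs Λ A w)) ^ 2 *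
          ((w ∘ Sum.inl) ⬝ᵥ (w ∘ Sum.inl)) ^ 2 := by rw [div_eq_mul_inv]; ring
      _ ≤ B ^ 2 * (N / (obs Λ A w ⬝ᵥ obs Λ A w)) ^ 2 *
          (m * ∑ j, (w (Sum.inl j) * w (Sum.inl j)) ^ 2) := by gcongr
      _ = B ^ 2 * m * ∑ j, ψ j w := by
          simp only [hψ, Finset.mul_sum]
          refine Finset.sum_congr rfl fun j _ => ?_
          ring
  have hintr : Integrable (fun w => B ^ 2 * m * ∑ j, ψ j w) (stdPi (Fin m ⊕ Fin N)) :=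
    (integrable_finsetSum _ fun j _ => (hψb j).1).const_mul _
  have hint : Integrable (fun w =>
      ((obs Λ A w ⬝ᵥ obs Λ A w)⁻¹ * (common Λ w ⬝ᵥ common Λ w)) ^ 2)
      (stdPi (Fin m ⊕ Fin N)) :=
    hintr.mono' hmeas.aestronglyMeasurable (.of_forall fun w => by
      rw [Real.norm_eq_abs, abs_of_nonneg (sq_nonneg _)]
      exact hle w)
  refine ⟨hint, (integral_mono hint hintr hle).trans ?_⟩
  rw [integral_const_mul, integral_finsetSum _ fun j _ => (hψb j).1]
  refine mul_le_mul_of_nonneg_left ?_ (by positivity)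
  refine (Finset.sum_le_sum fun j _ => (le_abs_self _).trans (hψb j).2).trans ?_
  simp [mul_add]

/-- A lower bound for the quadratic form of the population Kendall's tau matrix. -/
theorem DesignBounds.le_integral_obs_sq (hD : DesignBounds Λ A B c₁ c₂) (hN : 0 < N)
    (x : Fin N → ℝ) :
    (∫ t, |t| ∂gaussianReal 0 1) ^ 2 * ((Λᵀ *ᵥ x) ⬝ᵥ (Λᵀ *ᵥ x)) / (N * (B + c₁)) ≤
      ∫ w, (obs Λ A w ⬝ᵥ obs Λ A w)⁻¹ * ((x ⬝ᵥ obs Λ A w) * (x ⬝ᵥ obs Λ A w))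
        ∂stdPi (Fin m ⊕ Fin N) := by
  have hNpos : (0 : ℝ) < N := by exact_mod_cast hN
  have hB := hD.nonneg
  have hc₁ := hD.upper_pos
  set M := ∫ t, |t| ∂gaussianReal 0 1 with hM
  have hM0 : 0 < M := integral_abs_gaussianReal_pos
  set r : Fin m ⊕ Fin N → ℝ := Sum.elim (Λᵀ *ᵥ x) (Aᵀ *ᵥ x) with hr
  have hrr : (Λᵀ *ᵥ x) ⬝ᵥ (Λᵀ *ᵥ x) ≤ r ⬝ᵥ r := by
    rw [hr, sumElim_dotProduct_self]
    linarith [dotProduct_self_nonneg' (Aᵀ *ᵥ x)]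
  set K : ℝ := N * (B + c₁) with hK
  have hK0 : 0 < K := by positivity
  -- Cauchy–Schwarz in linearized form: `s²/b ≥ 2θ|s| - θ² b` for every `θ`. The value `E|x·y| / K`,
  -- with `K` bounding `E‖y‖²`, maximizes the integrated lower bound.
  set θ : ℝ := √(r ⬝ᵥ r) * M / K with hθ
  have habs_int : Integrable (fun w => |x ⬝ᵥ obs Λ A w|) (stdPi (Fin m ⊕ Fin N)) := by
    simp only [dotProduct_obs]
    simpa using integrable_abs_dotProduct_pow r 1
  have habs : ∫ w, |x ⬝ᵥ obs Λ A w| ∂stdPi (Fin m ⊕ Fin N) = √(r ⬝ᵥ r) * M := by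
    simp only [dotProduct_obs]
    simpa using integral_abs_dotProduct_pow r 1
  have hcoord : ∀ i w, obs Λ A w i = Sum.elim (Λ i) (A i) ⬝ᵥ w := by
    intro i w
    rw [sumElim_dotProduct]
    rfl
  have hsq_int : ∀ i, Integrable (fun w => obs Λ A w i * obs Λ A w i)
      (stdPi (Fin m ⊕ Fin N)) := by
    intro i
    have := integrable_abs_dotProduct_pow (ι := Fin m ⊕ Fin N) (Sum.elim (Λ i) (A i)) 2
    simpa only [hcoord, ← sq, sq_abs] using this
  have hsq : ∀ i, ∫ w, obs Λ A w i * obs Λ A w i ∂stdPi (Fin m ⊕ Fin N) ≤ B + c₁ := by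
    intro i
    have := integral_abs_dotProduct_pow (ι := Fin m ⊕ Fin N) (Sum.elim (Λ i) (A i)) 2
    rw [integral_sq_gaussianReal, mul_one, Real.sq_sqrt (dotProduct_self_nonneg' _),
      sumElim_dotProduct_self] at this
    simp only [sq_abs] at this
    simp only [hcoord, ← sq]
    rw [this]
    refine add_le_add (hD.rows i) ?_
    have h1 := hD.upper (Pi.single i 1)
    have h2 : Aᵀ *ᵥ Pi.single i 1 = A i := by ext j; simp
    simpa [h2] using h1
  have hyy_int : Integrable (fun w => obs Λ A w ⬝ᵥ obs Λ A w) (stdPi (Fin m ⊕ Fin N)) :=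
    integrable_finsetSum _ fun i _ => hsq_int i
  have hyy : ∫ w, obs Λ A w ⬝ᵥ obs Λ A w ∂stdPi (Fin m ⊕ Fin N) ≤ K := by
    simp only [dotProduct]
    rw [integral_finsetSum _ fun i _ => hsq_int i]
    refine (Finset.sum_le_sum fun i _ => hsq i).trans ?_
    simp [hK, mul_add]
  have hxm : Measurable fun w => x ⬝ᵥ obs Λ A w :=
    Finset.measurable_sum _ fun i _ => (measurable_obs i).const_mul _
  have hint : Integrable (fun w => (obs Λ A w ⬝ᵥ obs Λ A w)⁻¹ *
      ((x ⬝ᵥ obs Λ A w) * (x ⬝ᵥ obs Λ A w))) (stdPi (Fin m ⊕ Fin N)) := by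
    refine (integrable_const (x ⬝ᵥ x)).mono'
      (measurable_obs_sq.inv.mul (hxm.mul hxm)).aestronglyMeasurable (.of_forall fun w => ?_)
    have h0 := dotProduct_self_nonneg' (obs Λ A w)
    have h1 := dotProduct_sq_le x (obs Λ A w)
    rw [Real.norm_eq_abs, abs_of_nonneg
      (mul_nonneg (inv_nonneg.2 h0) (mul_self_nonneg _)), ← sq]
    rcases h0.eq_or_lt with h2 | h2
    · rw [← h2]
      simpa using dotProduct_self_nonneg' x
    · rw [inv_mul_le_iff₀ h2]
      linarith
  have hlow : ∀ᵐ w ∂stdPi (Fin m ⊕ Fin N),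
      2 * θ * |x ⬝ᵥ obs Λ A w| - θ ^ 2 * (obs Λ A w ⬝ᵥ obs Λ A w) ≤
      (obs Λ A w ⬝ᵥ obs Λ A w)⁻¹ * ((x ⬝ᵥ obs Λ A w) * (x ⬝ᵥ obs Λ A w)) := by
    filter_upwards [hD.ae_obs_ne_zero hN] with w hw
    have h0 := lt_of_le_of_ne (dotProduct_self_nonneg' (obs Λ A w)) hw.symm
    rw [le_inv_mul_iff₀ h0, ← abs_mul_abs_self (x ⬝ᵥ obs Λ A w)]
    nlinarith [sq_nonneg (|x ⬝ᵥ obs Λ A w| - θ * (obs Λ A w ⬝ᵥ obs Λ A w))]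
  have hmain := integral_mono_ae ((habs_int.const_mul (2 * θ)).sub (hyy_int.const_mul (θ ^ 2)))
    hint hlow
  refine le_trans ?_ hmain
  have e1 : ∫ w, (2 * θ * |x ⬝ᵥ obs Λ A w| - θ ^ 2 * (obs Λ A w ⬝ᵥ obs Λ A w))
      ∂stdPi (Fin m ⊕ Fin N) = 2 * θ * (√(r ⬝ᵥ r) * M) -
        θ ^ 2 * ∫ w, obs Λ A w ⬝ᵥ obs Λ A w ∂stdPi (Fin m ⊕ Fin N) := by
    rw [integral_sub (habs_int.const_mul (2 * θ)) (hyy_int.const_mul (θ ^ 2)),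
      integral_const_mul, integral_const_mul, habs]
  refine le_trans ?_ e1.ge
  have e2 : θ ^ 2 * ∫ w, obs Λ A w ⬝ᵥ obs Λ A w ∂stdPi (Fin m ⊕ Fin N) ≤ θ ^ 2 * K :=
    mul_le_mul_of_nonneg_left hyy (sq_nonneg _)
  have e3 : 2 * θ * (√(r ⬝ᵥ r) * M) - θ ^ 2 * K = M ^ 2 * (r ⬝ᵥ r) / K := by
    have hs := Real.sq_sqrt (dotProduct_self_nonneg' r)
    rw [hθ]
    field_simp
    rw [hs]
    ring
  have e4 : M ^ 2 * ((Λᵀ *ᵥ x) ⬝ᵥ (Λᵀ *ᵥ x)) / K ≤ M ^ 2 * (r ⬝ᵥ r) / K := by gcongr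
  linarith

end RTS

namespace RTS

/-! ### Rayleigh quotients and Courant–Fischer -/

section Spectral

variable {N : ℕ} {K : Matrix (Fin N) (Fin N) ℝ}

theorem sum_eigenvectorBasis_dotProduct (hK : K.IsHermitian) (x z : Fin N → ℝ) :
    ∑ i, (⇑(hK.eigenvectorBasis i) ⬝ᵥ x) * (⇑(hK.eigenvectorBasis i) ⬝ᵥ z) = x ⬝ᵥ z := by
  have h := hK.eigenvectorBasis.sum_inner_mul_inner (WithLp.toLp 2 x) (WithLp.toLp 2 z)
  simp only [EuclideanSpace.inner_eq_star_dotProduct, star_trivial] at h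
  rw [dotProduct_comm x z, ← h]
  refine Finset.sum_congr rfl fun i _ => ?_
  rw [dotProduct_comm z]

theorem dotProduct_mulVec_eq_sum (hK : K.IsHermitian) (x : Fin N → ℝ) :
    x ⬝ᵥ (K *ᵥ x) = ∑ i, hK.eigenvalues i * (⇑(hK.eigenvectorBasis i) ⬝ᵥ x) ^ 2 := by
  rw [← sum_eigenvectorBasis_dotProduct hK]
  refine Finset.sum_congr rfl fun i _ => ?_
  have hT : Kᵀ = K := by
    have h := hK.eq
    rwa [conjTranspose_eq_transpose_of_trivial] at h
  rw [← transpose_mulVec_dotProduct, hT, hK.mulVec_eigenvectorBasis i, smul_dotProduct,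
    smul_eq_mul]
  ring

theorem le_dotProduct_mulVec (hK : K.IsHermitian) {c : ℝ} (h : ∀ i, c ≤ hK.eigenvalues i)
    (x : Fin N → ℝ) : c * (x ⬝ᵥ x) ≤ x ⬝ᵥ (K *ᵥ x) := by
  rw [dotProduct_mulVec_eq_sum hK, ← sum_eigenvectorBasis_dotProduct hK, Finset.mul_sum]
  refine Finset.sum_le_sum fun i _ => ?_
  rw [← sq]
  exact mul_le_mul_of_nonneg_right (h i) (sq_nonneg _)

theorem dotProduct_mulVec_le (hK : K.IsHermitian) {c : ℝ} (h : ∀ i, hK.eigenvalues i ≤ c)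
    (x : Fin N → ℝ) : x ⬝ᵥ (K *ᵥ x) ≤ c * (x ⬝ᵥ x) := by
  rw [dotProduct_mulVec_eq_sum hK, ← sum_eigenvectorBasis_dotProduct hK, Finset.mul_sum]
  refine Finset.sum_le_sum fun i _ => ?_
  rw [← sq]
  exact mul_le_mul_of_nonneg_right (h i) (sq_nonneg _)

/-- One half of the Courant–Fischer principle. -/
theorem le_descEig (hK : K.IsHermitian) {m : ℕ} {M : Matrix (Fin N) (Fin m) ℝ}
    (hM : Function.Injective M.mulVecLin) {c : ℝ}
    (h : ∀ b, c * ((M *ᵥ b) ⬝ᵥ (M *ᵥ b)) ≤ (M *ᵥ b) ⬝ᵥ (K *ᵥ (M *ᵥ b))) {j : ℕ} (hj : j < m) :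
    c ≤ descEig hK j := by
  have hmN : m ≤ N := by
    simpa using LinearMap.finrank_le_finrank_of_injective hM
  have hjc : j < Fintype.card (Fin N) := by simp; omega
  rw [descEig, dif_pos hjc]
  set e : Fin (Fintype.card (Fin N)) ≃ Fin N :=
    Fintype.equivOfCardEq (Fintype.card_fin _) with he
  have hlam : ∀ i, hK.eigenvalues i = hK.eigenvalues₀ (e.symm i) := fun i => rfl
  -- Coefficients of `M b` along the top `j` eigenvectors. As `j < m`, some nonzero `b` kills them
  -- all, and its Rayleigh quotient is then at most the eigenvalue of index `j`.
  let φ : (Fin m → ℝ) →ₗ[ℝ] (Fin j → ℝ) :=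
    { toFun := fun b k =>
        ⇑(hK.eigenvectorBasis (e ⟨k, k.2.trans hjc⟩)) ⬝ᵥ (M *ᵥ b)
      map_add' := fun a b => by ext k; simp [mulVec_add, dotProduct_add]
      map_smul' := fun r b => by ext k; simp [mulVec_smul] }
  have hker : LinearMap.ker φ ≠ ⊥ := LinearMap.ker_ne_bot_of_finrank_lt (by simpa using hj)
  obtain ⟨b, hb, hb0⟩ := Submodule.exists_mem_ne_zero_of_ne_bot hker
  set x := M *ᵥ b with hx
  have hx0 : 0 < x ⬝ᵥ x := by
    refine lt_of_le_of_ne (dotProduct_self_nonneg' x) fun h0 => hb0 ?_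
    have h1 : M *ᵥ b = 0 := dotProduct_self_eq_zero.1 h0.symm
    exact hM (by simpa using h1)
  have hle : x ⬝ᵥ (K *ᵥ x) ≤ hK.eigenvalues₀ ⟨j, hjc⟩ * (x ⬝ᵥ x) := by
    rw [dotProduct_mulVec_eq_sum hK, ← sum_eigenvectorBasis_dotProduct hK, Finset.mul_sum]
    refine Finset.sum_le_sum fun i _ => ?_
    rw [← sq]
    by_cases hi : (e.symm i : ℕ) < j
    · have h2 : ⇑(hK.eigenvectorBasis i) ⬝ᵥ x = 0 := by
        have := congrFun (LinearMap.mem_ker.1 hb) ⟨e.symm i, hi⟩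
        simpa [φ] using this
      rw [h2]
      simp
    · refine mul_le_mul_of_nonneg_right ?_ (sq_nonneg _)
      rw [hlam]
      exact hK.eigenvalues₀_antitone (by rw [Fin.le_def]; simpa using hi)
  exact le_of_mul_le_mul_right ((h b).trans hle) hx0

end Spectral

/-! ### Operator, bilinear and entrywise bounds -/

section Bounds

variable {ι κ : Type*} [Fintype ι] [Fintype κ]

theorem l2norm_sq (v : ι → ℝ) : l2norm v ^ 2 = v ⬝ᵥ v := by
  rw [l2norm, EuclideanSpace.real_norm_sq_eq]
  simp [dotProduct, sq]

theorem mulVec_sq_le_frobenius (M : Matrix ι κ ℝ) (x : κ → ℝ) :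
    (M *ᵥ x) ⬝ᵥ (M *ᵥ x) ≤ (∑ i, ∑ j, M i j ^ 2) * (x ⬝ᵥ x) := by
  calc (M *ᵥ x) ⬝ᵥ (M *ᵥ x) = ∑ i, (M i ⬝ᵥ x) ^ 2 := by simp [dotProduct, mulVec, sq]
    _ ≤ ∑ i, (∑ j, M i j ^ 2) * (x ⬝ᵥ x) := by
        refine Finset.sum_le_sum fun i _ => (dotProduct_sq_le _ _).trans_eq ?_
        simp [dotProduct, sq]
    _ = _ := by rw [Finset.sum_mul]

theorem mulVec_sq_le_of_bilinear_le {M : Matrix ι κ ℝ} {k : ℝ}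
    (h : ∀ u v, u ⬝ᵥ u ≤ 1 → v ⬝ᵥ v ≤ 1 → |u ⬝ᵥ (M *ᵥ v)| ≤ k) (x : κ → ℝ) :
    (M *ᵥ x) ⬝ᵥ (M *ᵥ x) ≤ k ^ 2 * (x ⬝ᵥ x) := by
  set y := M *ᵥ x with hy
  rcases (dotProduct_self_nonneg' y).eq_or_lt with hy0 | hy0
  · rw [← hy0]
    exact mul_nonneg (sq_nonneg _) (dotProduct_self_nonneg' x)
  rcases (dotProduct_self_nonneg' x).eq_or_lt with hx0 | hx0
  · have : x = 0 := dotProduct_self_eq_zero.1 hx0.symm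
    rw [this, mulVec_zero] at hy
    rw [hy] at hy0
    simp at hy0
  set a := √(y ⬝ᵥ y) with ha
  set b := √(x ⬝ᵥ x) with hb
  have ha0 : 0 < a := Real.sqrt_pos.2 hy0
  have hb0 : 0 < b := Real.sqrt_pos.2 hx0
  have haa : y ⬝ᵥ y = a ^ 2 := (Real.sq_sqrt hy0.le).symm
  have hbb : x ⬝ᵥ x = b ^ 2 := (Real.sq_sqrt hx0.le).symm
  have h1 := h (a⁻¹ • y) (b⁻¹ • x)
    (by rw [smul_dotProduct, dotProduct_smul, haa, smul_eq_mul, smul_eq_mul]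
        field_simp; exact le_rfl)
    (by rw [smul_dotProduct, dotProduct_smul, hbb, smul_eq_mul, smul_eq_mul]
        field_simp; exact le_rfl)
  rw [mulVec_smul, smul_dotProduct, dotProduct_smul, ← hy, haa, smul_eq_mul, smul_eq_mul] at h1
  have h2 : a⁻¹ * (b⁻¹ * a ^ 2) = a / b := by field_simp
  rw [h2, abs_of_pos (div_pos ha0 hb0), div_le_iff₀ hb0] at h1
  rw [haa, hbb, ← mul_pow]
  exact pow_le_pow_left₀ ha0.le h1 2

/-- From `‖v‖₁ ≤ √card ‖v‖₂`, used twice. The dimension factor is harmless because this is applied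
to `m × m` matrices with `m` fixed. -/
theorem abs_dotProduct_mulVec_le {M : Matrix ι ι ℝ} {ε : ℝ} (hε : ∀ i j, |M i j| ≤ ε)
    (hε0 : 0 ≤ ε) (x z : ι → ℝ) :
    |x ⬝ᵥ (M *ᵥ z)| ≤ ε * Fintype.card ι * (√(x ⬝ᵥ x) * √(z ⬝ᵥ z)) := by
  have hs : ∀ v : ι → ℝ, ∑ i, |v i| ≤ √(Fintype.card ι) * √(v ⬝ᵥ v) := by
    intro v
    rw [← Real.sqrt_mul (Nat.cast_nonneg _)]
    apply Real.le_sqrt_of_sq_le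
    have := sq_sum_le_card_mul_sum_sq (s := Finset.univ) (f := fun i => |v i|)
    simpa [dotProduct, sq] using this
  calc |x ⬝ᵥ (M *ᵥ z)| = |∑ i, ∑ j, x i * (M i j * z j)| := by
        simp [dotProduct, mulVec, Finset.mul_sum]
    _ ≤ ∑ i, ∑ j, |x i| * (ε * |z j|) := by
        refine (Finset.abs_sum_le_sum_abs _ _).trans (Finset.sum_le_sum fun i _ => ?_)
        refine (Finset.abs_sum_le_sum_abs _ _).trans (Finset.sum_le_sum fun j _ => ?_)
        rw [abs_mul, abs_mul]
        gcongr
        exact hε i j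
    _ = ε * ((∑ i, |x i|) * ∑ j, |z j|) := by
        rw [Finset.sum_mul_sum, Finset.mul_sum]
        refine Finset.sum_congr rfl fun i _ => ?_
        rw [Finset.mul_sum]
        refine Finset.sum_congr rfl fun j _ => ?_
        ring
    _ ≤ ε * ((√(Fintype.card ι) * √(x ⬝ᵥ x)) * (√(Fintype.card ι) * √(z ⬝ᵥ z))) := by
        gcongr
        · exact hs x
        · exact hs z
    _ = ε * (√(Fintype.card ι) * √(Fintype.card ι)) * (√(x ⬝ᵥ x) * √(z ⬝ᵥ z)) := by ring
    _ = _ := by rw [Real.mul_self_sqrt (Nat.cast_nonneg _)]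

end Bounds

/-! ### Deterministic analysis of the loading estimate -/

section Loading

variable {m N T : ℕ} {Λ : Matrix (Fin N) (Fin m) ℝ} {f : ℕ → Fin m → ℝ} {y : ℕ → Fin N → ℝ}
  {L : Matrix (Fin N) (Fin m) ℝ}

/-- The part of the sample Kendall's tau matrix that is not due to the factors. -/
def residual (T : ℕ) (Λ : Matrix (Fin N) (Fin m) ℝ) (f : ℕ → Fin m → ℝ) (y : ℕ → Fin N → ℝ) :
    Matrix (Fin N) (Fin N) ℝ :=
  kendall T y - Λ * pairAverage T y f f * Λᵀ

/-- Positive leading eigenvalues make `V̂` invertible, so `Λ̃ = K̂ Λ̃ V̂⁻¹`, while `Λ Ĥ = Λ M₁ Λᵀ Λ̃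
V̂⁻¹` by definition. Subtracting isolates the residual, which is why no eigenvector perturbation
theory or eigengap enters. -/
theorem sub_rotation_eq (hL : IsRTSLoading T y L)
    (hv : ∀ j : Fin m, 0 < descEig (kendall_isHermitian T y) j) :
    L - Λ * rotation T Λ f y L = residual T Λ f y * L * (eigMatrix m T y)⁻¹ := by
  have hdet : IsUnit (eigMatrix m T y).det := by
    rw [eigMatrix, det_diagonal, isUnit_iff_ne_zero]
    exact Finset.prod_ne_zero_iff.2 fun j _ => (hv j).ne'
  have h1 : L = kendall T y * L * (eigMatrix m T y)⁻¹ := by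
    rw [hL.2, mul_nonsing_inv_cancel_right _ _ hdet]
  rw [residual, Matrix.sub_mul, Matrix.sub_mul, ← h1, rotation]
  simp only [Matrix.mul_assoc]

theorem col_sub_rotation (hL : IsRTSLoading T y L)
    (hv : ∀ j : Fin m, 0 < descEig (kendall_isHermitian T y) j) (j : Fin m) :
    (L - Λ * rotation T Λ f y L)ᵀ j =
      (descEig (kendall_isHermitian T y) j)⁻¹ • (residual T Λ f y *ᵥ Lᵀ j) := by
  have hinv : (eigMatrix m T y)⁻¹ =
      diagonal fun j : Fin m => (descEig (kendall_isHermitian T y) j)⁻¹ := by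
    refine Matrix.inv_eq_left_inv ?_
    rw [eigMatrix, diagonal_mul_diagonal, ← diagonal_one]
    congr 1
    ext k
    exact inv_mul_cancel₀ (hv k).ne'
  ext i
  rw [sub_rotation_eq hL hv, hinv, transpose_apply, mul_diagonal, Pi.smul_apply, smul_eq_mul,
    mul_comm]
  rfl

theorem IsRTSLoading.col_dotProduct (hL : IsRTSLoading T y L) (i j : Fin m) :
    Lᵀ i ⬝ᵥ Lᵀ j = N * (1 : Matrix (Fin m) (Fin m) ℝ) i j := by
  have := congrFun (congrFun hL.1 i) j
  simpa [mul_apply, dotProduct] using this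

theorem col_sub_rotation_sq_le (hL : IsRTSLoading T y L) {c Δ : ℝ} (hc : 0 < c)
    (hv : ∀ j : Fin m, c ≤ descEig (kendall_isHermitian T y) j)
    (hΔ : ∀ x, (residual T Λ f y *ᵥ x) ⬝ᵥ (residual T Λ f y *ᵥ x) ≤ Δ ^ 2 * (x ⬝ᵥ x))
    (j : Fin m) :
    (L - Λ * rotation T Λ f y L)ᵀ j ⬝ᵥ (L - Λ * rotation T Λ f y L)ᵀ j ≤ (Δ / c) ^ 2 * N := by
  have hvj := hc.trans_le (hv j)
  rw [col_sub_rotation hL fun j => hc.trans_le (hv j), smul_dotProduct, dotProduct_smul,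
    smul_eq_mul, smul_eq_mul, ← mul_assoc, ← sq, div_pow, div_eq_inv_mul, mul_assoc, inv_pow]
  have h1 := hΔ (Lᵀ j)
  rw [hL.col_dotProduct, one_apply_eq, mul_one] at h1
  have h0 := dotProduct_self_nonneg' (residual T Λ f y *ᵥ Lᵀ j)
  have h2 : (descEig (kendall_isHermitian T y) j ^ 2)⁻¹ ≤ (c ^ 2)⁻¹ :=
    inv_anti₀ (by positivity) (pow_le_pow_left₀ hc.le (hv j) 2)
  exact mul_le_mul h2 h1 h0 (by positivity)

/-- A row of the error is bounded by the full columns, so the operator norm of the residual suffices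
and no row-by-row analysis is needed. -/
theorem maxError_le (hL : IsRTSLoading T y L) {c Δ : ℝ} (hc : 0 < c) (hΔ0 : 0 ≤ Δ)
    (hv : ∀ j : Fin m, c ≤ descEig (kendall_isHermitian T y) j)
    (hΔ : ∀ x, (residual T Λ f y *ᵥ x) ⬝ᵥ (residual T Λ f y *ᵥ x) ≤ Δ ^ 2 * (x ⬝ᵥ x)) :
    maxError L Λ (rotation T Λ f y L) ≤ m * (Δ / c * √N) := by
  set H := rotation T Λ f y L with hH
  refine Real.iSup_le (fun i => ?_) (by positivity)
  refine abs_le_of_sq_le_sq' ?_ (by positivity) |>.2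
  rw [l2norm_sq]
  have hrow : ∀ j, (L i - Hᵀ *ᵥ Λ i) j = (L - Λ * H)ᵀ j i := by
    intro j
    rw [transpose_apply, Matrix.sub_apply, Pi.sub_apply, mulVec_transpose]
    rfl
  calc (L i - Hᵀ *ᵥ Λ i) ⬝ᵥ (L i - Hᵀ *ᵥ Λ i)
      = ∑ j, (L - Λ * H)ᵀ j i * (L - Λ * H)ᵀ j i := by
        simp only [dotProduct, hrow]
    _ ≤ ∑ _j : Fin m, (Δ / c) ^ 2 * N := by
        refine Finset.sum_le_sum fun j _ => ?_
        refine le_trans ?_ (col_sub_rotation_sq_le hL hc hv hΔ j)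
        exact Finset.single_le_sum (f := fun i => (L - Λ * H)ᵀ j i * (L - Λ * H)ᵀ j i)
          (fun _ _ => mul_self_nonneg _) (Finset.mem_univ i)
    _ = m * ((Δ / c) ^ 2 * N) := by simp
    -- Enlarging `m` to `m²` only serves to obtain a perfect square.
    _ ≤ m ^ 2 * ((Δ / c) ^ 2 * N) := by
        refine mul_le_mul_of_nonneg_right ?_ (by positivity)
        exact_mod_cast Nat.le_self_pow two_ne_zero m
    _ = (m * (Δ / c * √N)) ^ 2 := by
        rw [mul_pow, mul_pow (Δ / c), Real.sq_sqrt (Nat.cast_nonneg _)]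

theorem abs_dotProduct_le_sqrt {ι : Type*} [Fintype ι] (u v : ι → ℝ) :
    |u ⬝ᵥ v| ≤ √(u ⬝ᵥ u) * √(v ⬝ᵥ v) := by
  rw [← Real.sqrt_mul (dotProduct_self_nonneg' u)]
  exact Real.abs_le_sqrt (dotProduct_sq_le u v)

/-- The rotation nearly normalizes any matrix that is close to `Λᵀ Λ / N`. -/
theorem abs_rotation_sub_one_le (hN : 0 < N) (hL : IsRTSLoading T y L) {c Δ : ℝ} (hc : 0 < c)
    (hΔ0 : 0 ≤ Δ) (hΔc : Δ ≤ c)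
    (hv : ∀ j : Fin m, c ≤ descEig (kendall_isHermitian T y) j)
    (hΔ : ∀ x, (residual T Λ f y *ᵥ x) ⬝ᵥ (residual T Λ f y *ᵥ x) ≤ Δ ^ 2 * (x ⬝ᵥ x))
    {V : Matrix (Fin m) (Fin m) ℝ} {ε v₀ : ℝ} (hε0 : 0 ≤ ε) (hv₀ : 0 < v₀)
    (hε : ∀ i j, |(V - (N : ℝ)⁻¹ • (Λᵀ * Λ)) i j| ≤ ε)
    (hV : ∀ b, v₀ * (b ⬝ᵥ b) ≤ b ⬝ᵥ (((N : ℝ)⁻¹ • (Λᵀ * Λ)) *ᵥ b)) (i j : Fin m) :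
    |((rotation T Λ f y L)ᵀ * V * rotation T Λ f y L) i j -
      (1 : Matrix (Fin m) (Fin m) ℝ) i j| ≤ 3 * (Δ / c) + ε * m * (4 / v₀) := by
  set H := rotation T Λ f y L with hH
  set W := (N : ℝ)⁻¹ • (Λᵀ * Λ) with hW
  set E := L - Λ * H with hE
  set η := Δ / c with hη
  have hη0 : 0 ≤ η := by positivity
  -- This makes the quadratic term in `E` no larger than the linear ones, so all three are at most
  -- `η N`.
  have hη1 : η ≤ 1 := (div_le_one hc).2 hΔc
  have hNpos : (0 : ℝ) < N := by exact_mod_cast hN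
  have hEj : ∀ j, √(Eᵀ j ⬝ᵥ Eᵀ j) ≤ η * √N := fun j => by
    refine Real.sqrt_le_iff.2 ⟨by positivity, ?_⟩
    rw [mul_pow, Real.sq_sqrt hNpos.le]
    exact col_sub_rotation_sq_le hL hc hv hΔ j
  have hLj : ∀ j, √(Lᵀ j ⬝ᵥ Lᵀ j) = √N := fun j => by
    rw [hL.col_dotProduct, one_apply_eq, mul_one]
  have hss : √(N : ℝ) * √N = N := Real.mul_self_sqrt hNpos.le
  have hform : ∀ (M : Matrix (Fin m) (Fin m) ℝ) i j, (Hᵀ * M * H) i j = Hᵀ i ⬝ᵥ (M *ᵥ Hᵀ j) := by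
    intro M i j
    rw [Matrix.mul_assoc]
    rfl
  -- `Λ Ĥ = Λ̃ - E`, and `Λ̃ᵀ Λ̃ = N I`.
  have hgram : ∀ i j, (Hᵀ * W * H) i j = (N : ℝ)⁻¹ *
      ((Lᵀ i - Eᵀ i) ⬝ᵥ (Lᵀ j - Eᵀ j)) := by
    intro i j
    have hcol : ∀ j, Lᵀ j - Eᵀ j = Λ *ᵥ Hᵀ j := by
      intro j
      ext k
      rw [hE, Pi.sub_apply, transpose_apply, transpose_apply, Matrix.sub_apply, sub_sub_cancel]
      rfl
    rw [hform, hcol, hcol, hW, smul_mulVec, dotProduct_smul, smul_eq_mul, ← mulVec_mulVec,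
      ← transpose_mulVec_dotProduct, transpose_transpose]
  have hWb : ∀ i j, |(Hᵀ * W * H) i j - (1 : Matrix (Fin m) (Fin m) ℝ) i j| ≤ 3 * η := by
    intro i j
    have h1 : (Hᵀ * W * H) i j - (1 : Matrix (Fin m) (Fin m) ℝ) i j =
        (N : ℝ)⁻¹ * (Eᵀ i ⬝ᵥ Eᵀ j - Lᵀ i ⬝ᵥ Eᵀ j - Eᵀ i ⬝ᵥ Lᵀ j) := by
      rw [hgram, sub_dotProduct, dotProduct_sub, dotProduct_sub, hL.col_dotProduct]
      field_simp
      ring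
    rw [h1, abs_mul, abs_of_pos (inv_pos.2 hNpos), inv_mul_le_iff₀ hNpos]
    have b1 := abs_dotProduct_le_sqrt (Eᵀ i) (Eᵀ j)
    have b2 := abs_dotProduct_le_sqrt (Lᵀ i) (Eᵀ j)
    have b3 := abs_dotProduct_le_sqrt (Eᵀ i) (Lᵀ j)
    have c1 : √(Eᵀ i ⬝ᵥ Eᵀ i) * √(Eᵀ j ⬝ᵥ Eᵀ j) ≤ η * N := by
      calc √(Eᵀ i ⬝ᵥ Eᵀ i) * √(Eᵀ j ⬝ᵥ Eᵀ j) ≤ (η * √N) * (η * √N) :=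
            mul_le_mul (hEj i) (hEj j) (Real.sqrt_nonneg _) (by positivity)
        _ = η * (η * (√N * √N)) := by ring
        _ ≤ η * (1 * (√N * √N)) := by gcongr
        _ = η * N := by rw [hss, one_mul]
    have c2 : √(Lᵀ i ⬝ᵥ Lᵀ i) * √(Eᵀ j ⬝ᵥ Eᵀ j) ≤ η * N := by
      rw [hLj]
      calc √(N : ℝ) * √(Eᵀ j ⬝ᵥ Eᵀ j) ≤ √N * (η * √N) := by gcongr; exact hEj j
        _ = η * (√N * √N) := by ring
        _ = η * N := by rw [hss]
    have c3 : √(Eᵀ i ⬝ᵥ Eᵀ i) * √(Lᵀ j ⬝ᵥ Lᵀ j) ≤ η * N := by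
      rw [hLj]
      calc √(Eᵀ i ⬝ᵥ Eᵀ i) * √(N : ℝ) ≤ (η * √N) * √N := by gcongr; exact hEj i
        _ = η * (√N * √N) := by ring
        _ = η * N := by rw [hss]
    have d := (abs_sub (Eᵀ i ⬝ᵥ Eᵀ j - Lᵀ i ⬝ᵥ Eᵀ j) (Eᵀ i ⬝ᵥ Lᵀ j)).trans
      (add_le_add_left (abs_sub (Eᵀ i ⬝ᵥ Eᵀ j) (Lᵀ i ⬝ᵥ Eᵀ j)) _)
    linarith
  -- The diagonal entries of `Hᵀ W H` are at most `1 + 3η ≤ 4`, and `W ≥ v₀`.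
  have hHj : ∀ j, Hᵀ j ⬝ᵥ Hᵀ j ≤ 4 / v₀ := by
    intro j
    have h1 := hV (Hᵀ j)
    rw [← hform] at h1
    have h2 := (abs_le.1 (hWb j j)).2
    rw [one_apply_eq] at h2
    rw [le_div_iff₀ hv₀]
    linarith
  have hdiff : |(Hᵀ * (V - W) * H) i j| ≤ ε * m * (4 / v₀) := by
    rw [hform]
    refine (abs_dotProduct_mulVec_le hε hε0 _ _).trans ?_
    rw [Fintype.card_fin]
    gcongr
    have h4 : 0 ≤ 4 / v₀ := by positivity
    calc √(Hᵀ i ⬝ᵥ Hᵀ i) * √(Hᵀ j ⬝ᵥ Hᵀ j) ≤ √(4 / v₀) * √(4 / v₀) := by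
          gcongr
          · exact hHj i
          · exact hHj j
      _ = 4 / v₀ := Real.mul_self_sqrt h4
  have hsplit : (Hᵀ * V * H) i j - (1 : Matrix (Fin m) (Fin m) ℝ) i j =
      ((Hᵀ * W * H) i j - (1 : Matrix (Fin m) (Fin m) ℝ) i j) + (Hᵀ * (V - W) * H) i j := by
    rw [Matrix.mul_sub, Matrix.sub_mul, Matrix.sub_apply]
    ring
  rw [hsplit]
  exact (abs_add_le _ _).trans (add_le_add (hWb i j) hdiff)

end Loading

end RTS

namespace RTS

/-! ### Homogeneous kernels and their Frobenius norms -/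

section Kernels

variable {m N : ℕ} {Λ : Matrix (Fin N) (Fin m) ℝ} {A : Matrix (Fin N) (Fin N) ℝ} {B c₁ c₂ Q : ℝ}

/-- The kernel of the sample Kendall's tau matrix. -/
def kendallKernel (Λ : Matrix (Fin N) (Fin m) ℝ) (A : Matrix (Fin N) (Fin N) ℝ) (i j : Fin N)
    (w : Fin m ⊕ Fin N → ℝ) : ℝ :=
  (obs Λ A w ⬝ᵥ obs Λ A w)⁻¹ * (obs Λ A w i * obs Λ A w j)

/-- The kernel of the part of the sample Kendall's tau matrix that is not due to the factors. -/
def residualKernel (Λ : Matrix (Fin N) (Fin m) ℝ) (A : Matrix (Fin N) (Fin N) ℝ) (i j : Fin N)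
    (w : Fin m ⊕ Fin N → ℝ) : ℝ :=
  (obs Λ A w ⬝ᵥ obs Λ A w)⁻¹ * (obs Λ A w i * obs Λ A w j - common Λ w i * common Λ w j)

theorem common_smul (c : ℝ) (w : Fin m ⊕ Fin N → ℝ) : common Λ (c • w) = c • common Λ w := by
  rw [common, common, ← mulVec_smul]
  rfl

theorem obs_smul (c : ℝ) (w : Fin m ⊕ Fin N → ℝ) : obs Λ A (c • w) = c • obs Λ A w := by
  rw [obs, obs, common_smul, smul_add, idio, idio, ← mulVec_smul]
  rfl

theorem kendallKernel_smul (i j : Fin N) {c : ℝ} (hc : c ≠ 0) (w : Fin m ⊕ Fin N → ℝ) :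
    kendallKernel Λ A i j (c • w) = kendallKernel Λ A i j w := by
  simp only [kendallKernel, obs_smul, smul_dotProduct, dotProduct_smul, smul_eq_mul, Pi.smul_apply,
    mul_inv]
  field_simp

theorem residualKernel_smul (i j : Fin N) {c : ℝ} (hc : c ≠ 0) (w : Fin m ⊕ Fin N → ℝ) :
    residualKernel Λ A i j (c • w) = residualKernel Λ A i j w := by
  simp only [residualKernel, obs_smul, common_smul, smul_dotProduct, dotProduct_smul, smul_eq_mul,
    Pi.smul_apply, mul_inv]
  field_simp

theorem measurable_kendallKernel (i j : Fin N) : Measurable (kendallKernel Λ A i j) :=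
  measurable_obs_sq.inv.mul ((measurable_obs i).mul (measurable_obs j))

theorem measurable_residualKernel (i j : Fin N) : Measurable (residualKernel Λ A i j) :=
  measurable_obs_sq.inv.mul (((measurable_obs i).mul (measurable_obs j)).sub
    ((measurable_common i).mul (measurable_common j)))

theorem sum_mul_sq {ι : Type*} [Fintype ι] (v : ι → ℝ) :
    ∑ i, ∑ j, (v i * v j) ^ 2 = (v ⬝ᵥ v) ^ 2 := by
  rw [dotProduct, sq (∑ i, v i * v i), Finset.sum_mul_sum]
  refine Finset.sum_congr rfl fun i _ => Finset.sum_congr rfl fun j _ => ?_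
  ring

/-- `y yᵀ / ‖y‖²` is a projection of rank one (or zero when `y = 0`), so the bound does not grow
with `N`. -/
theorem sum_kendallKernel_sq_le (w : Fin m ⊕ Fin N → ℝ) :
    ∑ i, ∑ j, kendallKernel Λ A i j w ^ 2 ≤ 1 := by
  simp only [kendallKernel, mul_pow _ (obs Λ A w _ * obs Λ A w _), ← Finset.mul_sum]
  rw [sum_mul_sq, ← mul_pow]
  refine pow_le_one₀ (mul_nonneg (inv_nonneg.2 (dotProduct_self_nonneg' _))
    (dotProduct_self_nonneg' _)) ?_
  exact inv_mul_le_one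

/-- `(a - b)² ≤ 2a² + 2b²` splits off a second rank-one matrix, whose Frobenius norm is the ratio
`‖Λh‖² / ‖y‖²`. -/
theorem sum_residualKernel_sq_le (w : Fin m ⊕ Fin N → ℝ) :
    ∑ i, ∑ j, residualKernel Λ A i j w ^ 2 ≤
      2 + 2 * ((obs Λ A w ⬝ᵥ obs Λ A w)⁻¹ * (common Λ w ⬝ᵥ common Λ w)) ^ 2 := by
  have h1 : ∀ i j, residualKernel Λ A i j w ^ 2 ≤ 2 * kendallKernel Λ A i j w ^ 2 +
      2 * ((obs Λ A w ⬝ᵥ obs Λ A w)⁻¹ ^ 2 * (common Λ w i * common Λ w j) ^ 2) := by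
    intro i j
    simp only [residualKernel, kendallKernel]
    nlinarith [sq_nonneg ((obs Λ A w ⬝ᵥ obs Λ A w)⁻¹ * (obs Λ A w i * obs Λ A w j) +
      (obs Λ A w ⬝ᵥ obs Λ A w)⁻¹ * (common Λ w i * common Λ w j))]
  refine (Finset.sum_le_sum fun i _ => Finset.sum_le_sum fun j _ => h1 i j).trans ?_
  simp only [Finset.sum_add_distrib, ← Finset.mul_sum]
  rw [sum_mul_sq, ← mul_pow]
  have := sum_kendallKernel_sq_le (Λ := Λ) (A := A) w
  linarith

end Kernels

/-! ### Frobenius concentration of matrix U-statistics -/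

section Concentration

variable {Ω ι : Type*} [MeasurableSpace Ω] [Fintype ι] {P : Measure Ω} [IsProbabilityMeasure P]

/-- `ξ g / ‖g‖ - ξ' g' / ‖g'‖` as a function of the pairs `(ξ, g)` and `(ξ', g')`. -/
def pairDiff (p q : ℝ × (ι → ℝ)) : ι → ℝ :=
  p.1 • ((l2norm p.2)⁻¹ • p.2) - q.1 • ((l2norm q.2)⁻¹ • q.2)

theorem measurable_l2norm : Measurable (l2norm : (ι → ℝ) → ℝ) :=
  measurable_norm.comp (WithLp.measurable_toLp 2 _)

theorem measurable_pairDiff :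
    Measurable fun p : (ℝ × (ι → ℝ)) × (ℝ × (ι → ℝ)) => pairDiff p.1 p.2 := by
  have := measurable_l2norm (ι := ι)
  unfold pairDiff
  fun_prop

/-- The average of a kernel over the pairs of sample points. -/
def kernelMean (T : ℕ) (X : ℕ → Ω → ℝ × (ι → ℝ)) (Φ : (ι → ℝ) → ℝ) (ω : Ω) : ℝ :=
  (2 / ((T : ℝ) * ((T : ℝ) - 1))) *
    ∑ s ∈ Finset.range T, ∑ t ∈ Finset.range s, Φ (pairDiff (X t ω) (X s ω))

/-- The sample of pairs of radii and Gaussian vectors. -/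
structure RadialSample (P : Measure Ω) (X : ℕ → Ω → ℝ × (ι → ℝ)) : Prop where
  measurable : ∀ t, Measurable (X t)
  indep : iIndepFun X P
  indep_radius : ∀ t, IndepFun (fun ω => (X t ω).1) (fun ω => (X t ω).2) P
  law : ∀ t, P.map (fun ω => (X t ω).2) = stdPi ι
  ne_zero : ∀ t, ∀ᵐ ω ∂P, (X t ω).1 ≠ 0

/-- Concentration in Frobenius norm of a matrix of averages of `0`-homogeneous kernels. -/
theorem RadialSample.prob_frobenius_le {X : ℕ → Ω → ℝ × (ι → ℝ)} (hX : RadialSample P X)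
    (hι : 2 ≤ Fintype.card ι) {κ : Type*} [Fintype κ] {Φ : κ → κ → (ι → ℝ) → ℝ}
    (hΦ : ∀ i j, Measurable (Φ i j))
    (hom : ∀ i j (c : ℝ) (x : ι → ℝ), c ≠ 0 → Φ i j (c • x) = Φ i j x) {q : ℝ}
    (hint : Integrable (fun w => ∑ i, ∑ j, Φ i j w ^ 2) (stdPi ι))
    (hq : ∫ w, ∑ i, ∑ j, Φ i j w ^ 2 ∂stdPi ι ≤ q) {T : ℕ} (hT : 2 ≤ T) {a : ℝ} (ha : 0 < a) :
    P {ω | a < ∑ i, ∑ j, (kernelMean T X (Φ i j) ω - ∫ w, Φ i j w ∂stdPi ι) ^ 2} ≤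
      ENNReal.ofReal (16 * q / (T * a)) := by
  have hTpos : (0 : ℝ) < T := by exact_mod_cast (by omega : 0 < T)
  have hsq : ∀ i j, Integrable (fun w => Φ i j w ^ 2) (stdPi ι) := by
    intro i j
    refine hint.mono' ((hΦ i j).pow_const 2).aestronglyMeasurable (.of_forall fun w => ?_)
    rw [Real.norm_eq_abs, abs_of_nonneg (sq_nonneg _)]
    calc Φ i j w ^ 2 ≤ ∑ j, Φ i j w ^ 2 :=
          Finset.single_le_sum (f := fun j => Φ i j w ^ 2) (fun _ _ => sq_nonneg _)
            (Finset.mem_univ j)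
      _ ≤ _ := Finset.single_le_sum (f := fun i => ∑ j, Φ i j w ^ 2)
            (fun _ _ => Finset.sum_nonneg fun _ _ => sq_nonneg _) (Finset.mem_univ i)
  have hL2 : ∀ i j, MemLp (Φ i j) 2 (stdPi ι) := fun i j =>
    (memLp_two_iff_integrable_sq (hΦ i j).aestronglyMeasurable).2 (hsq i j)
  have hU : ∀ i j, Integrable (fun ω => (kernelMean T X (Φ i j) ω - ∫ w, Φ i j w ∂stdPi ι) ^ 2) P ∧
      ∫ ω, (kernelMean T X (Φ i j) ω - ∫ w, Φ i j w ∂stdPi ι) ^ 2 ∂P ≤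
        16 / T * ∫ w, Φ i j w ^ 2 ∂stdPi ι := by
    intro i j
    have hκ : Measurable (Function.uncurry fun p q : ℝ × (ι → ℝ) => Φ i j (pairDiff p q)) :=
      (hΦ i j).comp measurable_pairDiff
    -- Every pair of sample points yields the kernel's Gaussian law, so the U-statistic is centred
    -- at the Gaussian mean.
    have hlaw : ∀ t s, t < s → P.map (fun ω => Φ i j (pairDiff (X t ω) (X s ω))) =
        (stdPi ι).map (Φ i j) := fun t s hts =>
      map_homogeneous_pair hι (hX.measurable t) (hX.measurable s) (hX.indep.indepFun hts.ne)
        (hX.indep_radius t) (hX.indep_radius s) (hX.law t) (hX.law s) (hX.ne_zero t) (hΦ i j)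
        (hom i j)
    have h := integral_sq_pair_mean_sub_le hX.measurable hX.indep hκ hlaw
      ((memLp_map_measure_iff (by fun_prop) (hΦ i j).aemeasurable).2 (hL2 i j)) hT
    rw [integral_map (hΦ i j).aemeasurable (by fun_prop),
      integral_map (hΦ i j).aemeasurable (by fun_prop)] at h
    exact h
  set F : Ω → ℝ := fun ω =>
    ∑ i, ∑ j, (kernelMean T X (Φ i j) ω - ∫ w, Φ i j w ∂stdPi ι) ^ 2 with hF
  have hFint : Integrable F P :=
    integrable_finsetSum _ fun i _ => integrable_finsetSum _ fun j _ => (hU i j).1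
  have hFle : ∫ ω, F ω ∂P ≤ 16 / T * q := by
    calc ∫ ω, F ω ∂P = ∑ i, ∑ j, ∫ ω, (kernelMean T X (Φ i j) ω - ∫ w, Φ i j w ∂stdPi ι) ^ 2 ∂P := by
          rw [hF, integral_finsetSum _ fun i _ => integrable_finsetSum _ fun j _ => (hU i j).1]
          exact Finset.sum_congr rfl fun i _ => integral_finsetSum _ fun j _ => (hU i j).1
      _ ≤ ∑ i, ∑ j, 16 / T * ∫ w, Φ i j w ^ 2 ∂stdPi ι :=
          Finset.sum_le_sum fun i _ => Finset.sum_le_sum fun j _ => (hU i j).2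
      _ = 16 / T * ∫ w, ∑ i, ∑ j, Φ i j w ^ 2 ∂stdPi ι := by
          rw [integral_finsetSum _ fun i _ => integrable_finsetSum _ fun j _ => hsq i j,
            Finset.mul_sum]
          refine Finset.sum_congr rfl fun i _ => ?_
          rw [integral_finsetSum _ fun j _ => hsq i j, Finset.mul_sum]
      _ ≤ 16 / T * q := by gcongr
  have hF0 : ∀ ω, 0 ≤ F ω := fun ω =>
    Finset.sum_nonneg fun i _ => Finset.sum_nonneg fun j _ => sq_nonneg _
  have hM := mul_meas_ge_le_integral_of_nonneg (.of_forall hF0) hFint a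
  calc P {ω | a < F ω} ≤ P {ω | a ≤ F ω} := measure_mono fun ω (h : a < F ω) => h.le
    _ = ENNReal.ofReal (P.real {ω | a ≤ F ω}) := by rw [ofReal_measureReal]
    _ ≤ _ := by
        refine ENNReal.ofReal_le_ofReal ?_
        rw [le_div_iff₀ (by positivity)]
        have h1 := hM.trans hFle
        have h2 : 16 / (T : ℝ) * q * T = 16 * q := by field_simp
        nlinarith

end Concentration

end RTS

namespace RTS

/-! ### Population means of the kernels -/

section Population

variable {m N : ℕ} {Λ : Matrix (Fin N) (Fin m) ℝ} {A : Matrix (Fin N) (Fin N) ℝ} {B c₁ c₂ Q : ℝ}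

theorem integrable_of_sum_sq {ι κ : Type*} [Fintype ι] [Fintype κ] {Φ : κ → κ → (ι → ℝ) → ℝ}
    (hΦ : ∀ i j, Measurable (Φ i j))
    (hint : Integrable (fun w => ∑ i, ∑ j, Φ i j w ^ 2) (stdPi ι)) (i j : κ) :
    Integrable (Φ i j) (stdPi ι) := by
  refine ((integrable_const 1).add hint).mono' (hΦ i j).aestronglyMeasurable
    (.of_forall fun w => ?_)
  have h1 : Φ i j w ^ 2 ≤ ∑ i, ∑ j, Φ i j w ^ 2 :=
    (Finset.single_le_sum (f := fun j => Φ i j w ^ 2) (fun _ _ => sq_nonneg _)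
      (Finset.mem_univ j)).trans
    (Finset.single_le_sum (f := fun i => ∑ j, Φ i j w ^ 2)
      (fun _ _ => Finset.sum_nonneg fun _ _ => sq_nonneg _) (Finset.mem_univ i))
  simp only [Pi.add_apply, Real.norm_eq_abs]
  nlinarith [sq_abs (Φ i j w), sq_nonneg (|Φ i j w| - 1)]

/-- The matrix of the Gaussian means of a matrix of kernels. -/
def meanMatrix {ι κ : Type*} [Fintype ι] (Φ : κ → κ → (ι → ℝ) → ℝ) : Matrix κ κ ℝ :=
  Matrix.of fun i j => ∫ w, Φ i j w ∂stdPi ι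

theorem dotProduct_meanMatrix_mulVec {ι κ : Type*} [Fintype ι] [Fintype κ]
    {Φ : κ → κ → (ι → ℝ) → ℝ} (hΦ : ∀ i j, Integrable (Φ i j) (stdPi ι)) (u v : κ → ℝ) :
    u ⬝ᵥ (meanMatrix Φ *ᵥ v) = ∫ w, ∑ i, ∑ j, u i * (Φ i j w * v j) ∂stdPi ι := by
  rw [integral_finsetSum _ fun i _ => integrable_finsetSum _ fun j _ =>
    ((hΦ i j).mul_const _).const_mul _]
  refine Finset.sum_congr rfl fun i _ => ?_
  rw [integral_finsetSum _ fun j _ => ((hΦ i j).mul_const _).const_mul _, mulVec, dotProduct,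
    Finset.mul_sum]
  refine Finset.sum_congr rfl fun j _ => ?_
  rw [integral_const_mul, integral_mul_const]
  rfl

theorem integrable_sum_kendallKernel_sq (Λ : Matrix (Fin N) (Fin m) ℝ)
    (A : Matrix (Fin N) (Fin N) ℝ) :
    Integrable (fun w => ∑ i, ∑ j, kendallKernel Λ A i j w ^ 2) (stdPi (Fin m ⊕ Fin N)) := by
  refine (integrable_const (1 : ℝ)).mono' ?_ (.of_forall fun w => ?_)
  · exact (Finset.measurable_sum _ fun i _ => Finset.measurable_sum _ fun j _ =>
      (measurable_kendallKernel i j).pow_const 2).aestronglyMeasurable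
  · rw [Real.norm_eq_abs, abs_of_nonneg
      (Finset.sum_nonneg fun _ _ => Finset.sum_nonneg fun _ _ => sq_nonneg _)]
    exact sum_kendallKernel_sq_le w

theorem integral_sum_kendallKernel_sq_le (Λ : Matrix (Fin N) (Fin m) ℝ)
    (A : Matrix (Fin N) (Fin N) ℝ) :
    ∫ w, ∑ i, ∑ j, kendallKernel Λ A i j w ^ 2 ∂stdPi (Fin m ⊕ Fin N) ≤ 1 := by
  refine (integral_mono (integrable_sum_kendallKernel_sq Λ A) (integrable_const 1)
    fun w => sum_kendallKernel_sq_le w).trans ?_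
  simp

theorem OcticDesign.sum_residualKernel_sq (hQ : OcticDesign Λ A Q)
    (hD : DesignBounds Λ A B c₁ c₂) (hN : 0 < N) :
    Integrable (fun w => ∑ i, ∑ j, residualKernel Λ A i j w ^ 2) (stdPi (Fin m ⊕ Fin N)) ∧
    ∫ w, ∑ i, ∑ j, residualKernel Λ A i j w ^ 2 ∂stdPi (Fin m ⊕ Fin N) ≤
      2 + 2 * (B ^ 2 * m * (m * (1 + 6 * Q))) := by
  have h := hQ.integral_common_ratio_sq_le hD hN
  have hi := h.1.const_mul 2
  have hb : Integrable (fun w => 2 + 2 * ((obs Λ A w ⬝ᵥ obs Λ A w)⁻¹ *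
      (common Λ w ⬝ᵥ common Λ w)) ^ 2) (stdPi (Fin m ⊕ Fin N)) := (integrable_const 2).add hi
  have hint : Integrable (fun w => ∑ i, ∑ j, residualKernel Λ A i j w ^ 2)
      (stdPi (Fin m ⊕ Fin N)) := by
    refine hb.mono' ?_ (.of_forall fun w => ?_)
    · exact (Finset.measurable_sum _ fun i _ => Finset.measurable_sum _ fun j _ =>
        (measurable_residualKernel i j).pow_const 2).aestronglyMeasurable
    · rw [Real.norm_eq_abs, abs_of_nonneg
        (Finset.sum_nonneg fun _ _ => Finset.sum_nonneg fun _ _ => sq_nonneg _)]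
      exact sum_residualKernel_sq_le w
  refine ⟨hint, (integral_mono hint hb fun w => sum_residualKernel_sq_le w).trans ?_⟩
  rw [integral_add (integrable_const 2) hi, integral_const_mul]
  simp only [integral_const, probReal_univ, one_smul]
  linarith [h.2]

theorem sum_kendallKernel_form (u v : Fin N → ℝ) (w : Fin m ⊕ Fin N → ℝ) :
    ∑ i, ∑ j, u i * (kendallKernel Λ A i j w * v j) =
      (obs Λ A w ⬝ᵥ obs Λ A w)⁻¹ * ((u ⬝ᵥ obs Λ A w) * (v ⬝ᵥ obs Λ A w)) := by
  have h : (u ⬝ᵥ obs Λ A w) * (v ⬝ᵥ obs Λ A w) =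
      ∑ i, ∑ j, (u i * obs Λ A w i) * (v j * obs Λ A w j) := Finset.sum_mul_sum _ _ _ _
  rw [h, Finset.mul_sum]
  refine Finset.sum_congr rfl fun i _ => ?_
  rw [Finset.mul_sum]
  refine Finset.sum_congr rfl fun j _ => ?_
  rw [kendallKernel]
  ring

theorem sum_residualKernel_form (u v : Fin N → ℝ) (w : Fin m ⊕ Fin N → ℝ) :
    ∑ i, ∑ j, u i * (residualKernel Λ A i j w * v j) =
      (obs Λ A w ⬝ᵥ obs Λ A w)⁻¹ * ((u ⬝ᵥ obs Λ A w) * (v ⬝ᵥ obs Λ A w) -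
        (u ⬝ᵥ common Λ w) * (v ⬝ᵥ common Λ w)) := by
  have h : ∀ z : Fin N → ℝ, (u ⬝ᵥ z) * (v ⬝ᵥ z) =
      ∑ i, ∑ j, (u i * z i) * (v j * z j) := fun z => Finset.sum_mul_sum _ _ _ _
  rw [h, h, ← Finset.sum_sub_distrib, Finset.mul_sum]
  refine Finset.sum_congr rfl fun i _ => ?_
  rw [← Finset.sum_sub_distrib, Finset.mul_sum]
  refine Finset.sum_congr rfl fun j _ => ?_
  rw [residualKernel]
  ring

theorem OcticDesign.meanMatrix_residual_sq_le (hQ : OcticDesign Λ A Q)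
    (hD : DesignBounds Λ A B c₁ c₂) (hN : 0 < N) (x : Fin N → ℝ) :
    (meanMatrix (residualKernel Λ A) *ᵥ x) ⬝ᵥ (meanMatrix (residualKernel Λ A) *ᵥ x) ≤
      ((4 * m * (1 + 6 * Q) + (1 + 3 * Q)) / N) ^ 2 * (x ⬝ᵥ x) := by
  refine mulVec_sq_le_of_bilinear_le (fun u v hu hv => ?_) x
  rw [dotProduct_meanMatrix_mulVec
    (integrable_of_sum_sq measurable_residualKernel (hQ.sum_residualKernel_sq hD hN).1)]
  simp only [sum_residualKernel_form]
  exact hQ.abs_integral_residual_le hD hN hu hv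

/-- The lower bound for the `m` largest eigenvalues of the population Kendall's tau matrix. -/
def signalBound (B c₁ v₀ : ℝ) : ℝ := (∫ t, |t| ∂gaussianReal 0 1) ^ 2 * v₀ / (B + c₁)

/-- On the range of `Λ`, `‖Λᵀ x‖² ≥ N v₀ ‖x‖²`, and this `N` cancels the one from `E‖y‖² ≤ N (B +
c₁)`. -/
theorem DesignBounds.le_meanMatrix_kendall (hD : DesignBounds Λ A B c₁ c₂) (hN : 0 < N) {v₀ : ℝ}
    (hlow : ∀ b, N * v₀ * (b ⬝ᵥ b) ≤ (Λ *ᵥ b) ⬝ᵥ (Λ *ᵥ b)) (b : Fin m → ℝ) :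
    signalBound B c₁ v₀ * ((Λ *ᵥ b) ⬝ᵥ (Λ *ᵥ b)) ≤
      (Λ *ᵥ b) ⬝ᵥ (meanMatrix (kendallKernel Λ A) *ᵥ (Λ *ᵥ b)) := by
  have hNpos : (0 : ℝ) < N := by exact_mod_cast hN
  have hB := hD.nonneg
  have hc := hD.upper_pos
  rw [dotProduct_meanMatrix_mulVec
    (integrable_of_sum_sq measurable_kendallKernel (integrable_sum_kendallKernel_sq Λ A))]
  simp only [sum_kendallKernel_form]
  refine le_trans ?_ (hD.le_integral_obs_sq hN (Λ *ᵥ b))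
  have h1 := mulVec_sq_le_transpose_mulVec_sq hlow b
  rw [signalBound, le_div_iff₀ (by positivity)]
  calc _ = (∫ t, |t| ∂gaussianReal 0 1) ^ 2 * (N * v₀ * ((Λ *ᵥ b) ⬝ᵥ (Λ *ᵥ b))) := by
        field_simp
    _ ≤ _ := mul_le_mul_of_nonneg_left h1 (sq_nonneg _)

end Population

/-! ### From the factor model to the sample matrices -/

section Sample

variable {Ω : Type*} [MeasurableSpace Ω] {P : Measure Ω} {m : ℕ}
  {Λ : (N : ℕ) → Matrix (Fin N) (Fin m) ℝ} {A : (N : ℕ) → Matrix (Fin N) (Fin N) ℝ}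
  {ξ : ℕ → ℕ → Ω → ℝ} {g : (N : ℕ) → ℕ → Ω → Fin m ⊕ Fin N → ℝ}
  {f : (N : ℕ) → ℕ → Ω → Fin m → ℝ} {e y : (N : ℕ) → ℕ → Ω → Fin N → ℝ}

theorem EllipticalFactorModel.radialSample (h : EllipticalFactorModel P m Λ A ξ g f e y) {N : ℕ}
    (hN : 1 ≤ N) : RadialSample P fun t ω => (ξ N t ω, g N t ω) where
  measurable t := (h.measurable_radius N t).prodMk (h.measurable_gaussian N t)
  indep := h.indep_time N
  indep_radius := h.indep_radius N
  law := h.gaussian_law N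
  ne_zero t := (h.identDistrib_radius N t).symm.ae_snd
    (measurableSet_singleton (0 : ℝ)).compl (h.radius_ne_zero N hN)

theorem EllipticalFactorModel.factor_eq (h : EllipticalFactorModel P m Λ A ξ g f e y) (N t : ℕ)
    (ω : Ω) : f N t ω = (ξ N t ω • ((l2norm (g N t ω))⁻¹ • g N t ω)) ∘ Sum.inl := by
  have h1 := congrArg (fun v => v ∘ Sum.inl) (h.representation N t ω)
  simp only [Sum.elim_comp_inl, fromBlocks_mulVec] at h1
  rw [h1]
  ext i
  simp

theorem EllipticalFactorModel.noise_eq (h : EllipticalFactorModel P m Λ A ξ g f e y) (N t : ℕ)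
    (ω : Ω) :
    e N t ω = A N *ᵥ ((ξ N t ω • ((l2norm (g N t ω))⁻¹ • g N t ω)) ∘ Sum.inr) := by
  have h1 := congrArg (fun v => v ∘ Sum.inr) (h.representation N t ω)
  simp only [Sum.elim_comp_inr, fromBlocks_mulVec] at h1
  rw [h1]
  ext i
  have h2 : ((ξ N t ω • ((l2norm (g N t ω))⁻¹ • g N t ω)) ∘ Sum.inr : Fin N → ℝ) =
      ξ N t ω • (((l2norm (g N t ω))⁻¹ • g N t ω) ∘ Sum.inr) := rfl
  rw [h2, mulVec_smul]
  simp

theorem EllipticalFactorModel.factor_sub (h : EllipticalFactorModel P m Λ A ξ g f e y)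
    (N t s : ℕ) (ω : Ω) : f N t ω - f N s ω =
      pairDiff (ξ N t ω, g N t ω) (ξ N s ω, g N s ω) ∘ Sum.inl := by
  rw [h.factor_eq N t, h.factor_eq N s]
  rfl

theorem EllipticalFactorModel.observation_sub (h : EllipticalFactorModel P m Λ A ξ g f e y)
    (N t s : ℕ) (ω : Ω) : y N t ω - y N s ω =
      obs (Λ N) (A N) (pairDiff (ξ N t ω, g N t ω) (ξ N s ω, g N s ω)) := by
  have h1 : y N t ω - y N s ω = Λ N *ᵥ (f N t ω - f N s ω) + (e N t ω - e N s ω) := by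
    rw [h.observation, h.observation, mulVec_sub]
    abel
  rw [h1, h.factor_sub, h.noise_eq N t, h.noise_eq N s, ← mulVec_sub]
  rfl

theorem EllipticalFactorModel.kendall_apply (h : EllipticalFactorModel P m Λ A ξ g f e y)
    (N T : ℕ) (ω : Ω) (i j : Fin N) :
    kendall T (fun t => y N t ω) i j =
      kernelMean T (fun t ω => (ξ N t ω, g N t ω)) (kendallKernel (Λ N) (A N) i j) ω := by
  rw [kendall, pairAverage, kernelMean, Matrix.smul_apply, smul_eq_mul, Matrix.sum_apply]
  congr 1
  refine Finset.sum_congr rfl fun s _ => ?_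
  rw [Matrix.sum_apply]
  refine Finset.sum_congr rfl fun t _ => ?_
  rw [Matrix.smul_apply, smul_eq_mul, vecMulVec_apply, l2norm_sq, h.observation_sub]
  rfl

/-- `M₁` carries the same weights `‖y_t - y_s‖⁻²` as Kendall's tau, so the difference is again a
single U-statistic. -/
theorem EllipticalFactorModel.residual_apply (h : EllipticalFactorModel P m Λ A ξ g f e y)
    (N T : ℕ) (ω : Ω) (i j : Fin N) :
    residual T (Λ N) (fun t => f N t ω) (fun t => y N t ω) i j =
      kernelMean T (fun t ω => (ξ N t ω, g N t ω)) (residualKernel (Λ N) (A N) i j) ω := by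
  rw [residual, Matrix.sub_apply, h.kendall_apply, kernelMean, kernelMean, pairAverage,
    Matrix.mul_smul, Matrix.smul_mul, Matrix.smul_apply, smul_eq_mul, ← mul_sub, Matrix.mul_sum,
    Matrix.sum_mul, Matrix.sum_apply, ← Finset.sum_sub_distrib]
  congr 1
  refine Finset.sum_congr rfl fun s _ => ?_
  rw [Matrix.mul_sum, Matrix.sum_mul, Matrix.sum_apply, ← Finset.sum_sub_distrib]
  refine Finset.sum_congr rfl fun t _ => ?_
  rw [Matrix.mul_smul, Matrix.smul_mul, Matrix.smul_apply, smul_eq_mul, mul_vecMulVec,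
    vecMulVec_mul, vecMul_transpose, vecMulVec_apply, l2norm_sq, h.observation_sub, h.factor_sub,
    kendallKernel, residualKernel]
  simp only [common]
  ring

/-- With high probability the leading sample eigenvalues are bounded below and the residual part
of the sample Kendall's tau matrix is small. -/
theorem EllipticalFactorModel.prob_not_good_le [IsProbabilityMeasure P]
    (h : EllipticalFactorModel P m Λ A ξ g f e y)
    {N : ℕ} (hN : 2 ≤ N) {B c₁ c₂ Q v₀ : ℝ} (hD : DesignBounds (Λ N) (A N) B c₁ c₂)
    (hQ : OcticDesign (Λ N) (A N) Q) (hv₀ : 0 < v₀)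
    (hlow : ∀ b, N * v₀ * (b ⬝ᵥ b) ≤ (Λ N *ᵥ b) ⬝ᵥ (Λ N *ᵥ b)) {T : ℕ} (hT : 2 ≤ T) {a : ℝ}
    (ha : 0 < a) :
    P {ω | ¬((∀ j : Fin m, signalBound B c₁ v₀ / 2 ≤
          descEig (kendall_isHermitian T fun t => y N t ω) j) ∧
        ∀ x, (residual T (Λ N) (fun t => f N t ω) (fun t => y N t ω) *ᵥ x) ⬝ᵥ
          (residual T (Λ N) (fun t => f N t ω) (fun t => y N t ω) *ᵥ x) ≤
          2 * (((4 * m * (1 + 6 * Q) + (1 + 3 * Q)) / N) ^ 2 + a) * (x ⬝ᵥ x))} ≤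
      ENNReal.ofReal (16 * 1 / (T * (signalBound B c₁ v₀ / 2) ^ 2)) +
        ENNReal.ofReal (16 * (2 + 2 * (B ^ 2 * m * (m * (1 + 6 * Q)))) / (T * a)) := by
  have hN0 : 0 < N := by omega
  have hNpos : (0 : ℝ) < N := by exact_mod_cast hN0
  have hB := hD.nonneg
  have hc := hD.upper_pos
  set c := signalBound B c₁ v₀ with hcdef
  have hc0 : 0 < c := by
    have := integral_abs_gaussianReal_pos
    rw [hcdef, signalBound]
    positivity
  have hX := h.radialSample (N := N) (by omega)
  have hcard : 2 ≤ Fintype.card (Fin m ⊕ Fin N) := by simp; omega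
  have hres := hQ.sum_residualKernel_sq hD hN0
  have p1 := hX.prob_frobenius_le hcard (Φ := kendallKernel (Λ N) (A N)) measurable_kendallKernel
    (fun i j c x hc => kendallKernel_smul i j hc x) (integrable_sum_kendallKernel_sq _ _)
    (integral_sum_kendallKernel_sq_le _ _) hT (a := (c / 2) ^ 2) (by positivity)
  have p2 := hX.prob_frobenius_le hcard (Φ := residualKernel (Λ N) (A N)) measurable_residualKernel
    (fun i j c x hc => residualKernel_smul i j hc x) hres.1 hres.2 hT ha
  refine le_trans ?_ (add_le_add p1 p2)
  refine le_trans (measure_mono fun ω hω => ?_) (measure_union_le _ _)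
  -- Off the two Frobenius deviation events, both properties hold deterministically.
  by_contra hnot
  rw [Set.mem_union, not_or] at hnot
  obtain ⟨n1, n2⟩ := hnot
  rw [Set.mem_ofPred_eq, not_lt] at n1 n2
  rw [Set.mem_ofPred_eq] at hω
  refine hω ⟨fun j => ?_, fun x => ?_⟩
  · set K := kendall T fun t => y N t ω with hK
    have hinj := mulVec_injective_of_lower_bound (M := Λ N) (c := N * v₀) (by positivity) hlow
    refine le_descEig (kendall_isHermitian T fun t => y N t ω) hinj (fun b => ?_) j.2
    set x := Λ N *ᵥ b with hx
    set R := K - meanMatrix (kendallKernel (Λ N) (A N)) with hR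
    have hF : ∑ i, ∑ j, R i j ^ 2 ≤ (c / 2) ^ 2 := by
      refine le_trans (le_of_eq ?_) n1
      refine Finset.sum_congr rfl fun i _ => Finset.sum_congr rfl fun j _ => ?_
      rw [hR, Matrix.sub_apply, hK, h.kendall_apply]
      rfl
    have h1 := hD.le_meanMatrix_kendall hN0 hlow b
    have h2 := mulVec_sq_le_frobenius R x
    have hxx := dotProduct_self_nonneg' x
    -- The deviation costs at most half of the population bound `c`.
    have h3 : (x ⬝ᵥ (R *ᵥ x)) ^ 2 ≤ (c / 2 * (x ⬝ᵥ x)) ^ 2 := by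
      calc (x ⬝ᵥ (R *ᵥ x)) ^ 2 ≤ (x ⬝ᵥ x) * ((R *ᵥ x) ⬝ᵥ (R *ᵥ x)) := dotProduct_sq_le _ _
        _ ≤ (x ⬝ᵥ x) * ((c / 2) ^ 2 * (x ⬝ᵥ x)) := mul_le_mul_of_nonneg_left
            (h2.trans (mul_le_mul_of_nonneg_right hF hxx)) hxx
        _ = _ := by ring
    have h4 := (abs_le_of_sq_le_sq' h3 (by positivity)).1
    have h5 : x ⬝ᵥ (K *ᵥ x) = x ⬝ᵥ (meanMatrix (kendallKernel (Λ N) (A N)) *ᵥ x) +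
        x ⬝ᵥ (R *ᵥ x) := by
      rw [← dotProduct_add, ← add_mulVec, hR, add_sub_cancel]
    rw [h5]
    linarith
  · set D := residual T (Λ N) (fun t => f N t ω) (fun t => y N t ω) with hDdef
    set R := D - meanMatrix (residualKernel (Λ N) (A N)) with hR
    have hF : ∑ i, ∑ j, R i j ^ 2 ≤ a := by
      refine le_trans (le_of_eq ?_) n2
      refine Finset.sum_congr rfl fun i _ => Finset.sum_congr rfl fun j _ => ?_
      rw [hR, Matrix.sub_apply, hDdef, h.residual_apply]
      rfl
    have h1 := hQ.meanMatrix_residual_sq_le hD hN0 x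
    have hxx := dotProduct_self_nonneg' x
    have h2 := (mulVec_sq_le_frobenius R x).trans (mul_le_mul_of_nonneg_right hF hxx)
    have h5 : D *ᵥ x = meanMatrix (residualKernel (Λ N) (A N)) *ᵥ x + R *ᵥ x := by
      rw [← add_mulVec, hR, add_sub_cancel]
    rw [h5]
    set u := meanMatrix (residualKernel (Λ N) (A N)) *ᵥ x
    set v := R *ᵥ x
    -- Gives `‖u + v‖² ≤ 2‖u‖² + 2‖v‖²`, the source of the factor two.
    have h6 := dotProduct_self_nonneg' (u - v)
    simp only [sub_dotProduct, dotProduct_sub] at h6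
    simp only [add_dotProduct, dotProduct_add]
    linarith

end Sample

end RTS

namespace RTS

/-! ### Quantitative consequences of the assumptions -/

section Assumptions

variable {m : ℕ} {Λ : (N : ℕ) → Matrix (Fin N) (Fin m) ℝ} {A : (N : ℕ) → Matrix (Fin N) (Fin N) ℝ}
  {V : Matrix (Fin m) (Fin m) ℝ}

theorem l2norm_nonneg {ι : Type*} [Fintype ι] (v : ι → ℝ) : 0 ≤ l2norm v := norm_nonneg _

theorem exists_designBounds (hΛ : LoadingAssumption Λ V) (hA : NoiseAssumption A) :
    ∃ B c₁ c₂ : ℝ, 0 ≤ B ∧ 0 < c₁ ∧ ∀ N, DesignBounds (Λ N) (A N) B c₁ c₂ := by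
  obtain ⟨C, hC⟩ := hΛ.bounded
  obtain ⟨c₁, c₂, hc₁, hc₂, h⟩ := hA
  have hT : ∀ N u, ((A N)ᵀ *ᵥ u) ⬝ᵥ ((A N)ᵀ *ᵥ u) = u ⬝ᵥ ((A N * (A N)ᵀ) *ᵥ u) := fun N u => by
    rw [transpose_mulVec_dotProduct, mulVec_mulVec]
  refine ⟨C ^ 2, c₁, c₂, sq_nonneg _, hc₁, fun N => ⟨sq_nonneg _, hc₁, hc₂, fun i => ?_,
    fun u => ?_, fun u => ?_⟩⟩
  · rw [← l2norm_sq]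
    exact pow_le_pow_left₀ (l2norm_nonneg _) (hC N i) 2
  · rw [hT]
    exact dotProduct_mulVec_le (scatter_isHermitian (A N)) (fun i => (h N i).2) u
  · rw [hT]
    exact le_dotProduct_mulVec (scatter_isHermitian (A N)) (fun i => (h N i).1) u

theorem LoadingAssumption.eventually_abs_sub_le (hΛ : LoadingAssumption Λ V) {ε : ℝ} (hε : 0 < ε) :
    ∀ᶠ N : ℕ in atTop, ∀ i j, |(V - (N : ℝ)⁻¹ • ((Λ N)ᵀ * Λ N)) i j| ≤ ε := by
  rw [eventually_all]
  intro i
  rw [eventually_all]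
  intro j
  have h1 : Tendsto (fun N : ℕ => ((N : ℝ)⁻¹ • ((Λ N)ᵀ * Λ N)) i j) atTop (𝓝 (V i j)) :=
    tendsto_pi_nhds.1 (tendsto_pi_nhds.1 hΛ.limit i) j
  filter_upwards [Metric.tendsto_nhds.1 h1 ε hε] with N hN
  rw [Matrix.sub_apply, abs_sub_comm]
  exact hN.le

theorem LoadingAssumption.exists_eventually_lower_bound (hΛ : LoadingAssumption Λ V) :
    ∃ v₀ : ℝ, 0 < v₀ ∧ ∀ᶠ N : ℕ in atTop, ∀ b : Fin m → ℝ,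
      v₀ * (b ⬝ᵥ b) ≤ b ⬝ᵥ (((N : ℝ)⁻¹ • ((Λ N)ᵀ * Λ N)) *ᵥ b) := by
  obtain ⟨_, c, _, hc, h⟩ := hΛ.eigenvalue_bounds
  have hV : ∀ b : Fin m → ℝ, c * (b ⬝ᵥ b) ≤ b ⬝ᵥ (V *ᵥ b) :=
    le_dotProduct_mulVec hΛ.posDef.isHermitian fun i => (h _).1
  refine ⟨c / 2, by positivity, ?_⟩
  -- The entrywise error costs at most `m` times this, hence less than `c / 2`; `m + 1` keeps the
  -- quotient meaningful for `m = 0`.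
  have hε : 0 < c / 2 / (m + 1) := by positivity
  filter_upwards [hΛ.eventually_abs_sub_le hε] with N hN b
  have hbb := dotProduct_self_nonneg' b
  have h1 := abs_dotProduct_mulVec_le hN hε.le b b
  rw [Real.mul_self_sqrt hbb, Fintype.card_fin] at h1
  have h2 : c / 2 / (m + 1) * m * (b ⬝ᵥ b) ≤ c / 2 * (b ⬝ᵥ b) := by
    refine mul_le_mul_of_nonneg_right ?_ hbb
    rw [div_mul_eq_mul_div, div_le_iff₀ (by positivity)]
    nlinarith
  have h3 := (abs_le.1 (h1.trans h2)).2
  rw [sub_mulVec, dotProduct_sub] at h3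
  linarith [hV b]

end Assumptions

/-! ### Splitting a stochastic order -/

section BigOp

variable {Ω : Type*} [MeasurableSpace Ω] {P : Measure Ω}

/-- A sequence that is `O_p(a + b)` is the sum of one that is `O_p(a)` and one that is
`O_p(b)`. -/
theorem exists_isBigOp_add {ι : Type*} {l : Filter ι} {X : ι → Ω → ℝ} {a b : ι → ℝ}
    (ha : ∀ i, 0 ≤ a i) (hb : ∀ i, 0 ≤ b i) (h : IsBigOp P l X fun i => a i + b i) :
    ∃ R₁ R₂ : ι → Ω → ℝ, (∀ i ω, X i ω = R₁ i ω + R₂ i ω) ∧ IsBigOp P l R₁ a ∧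
      IsBigOp P l R₂ b := by
  classical
  -- Assign the whole of `X i` to the larger of the two rates, which dominates half of their sum.
  refine ⟨fun i ω => if b i ≤ a i then X i ω else 0, fun i ω => if b i ≤ a i then 0 else X i ω,
    fun i ω => ?_, fun δ hδ => ?_, fun δ hδ => ?_⟩
  · by_cases hab : b i ≤ a i <;> simp [hab]
  · obtain ⟨C, hC⟩ := h δ hδ
    refine ⟨2 * |C|, ?_⟩
    filter_upwards [hC] with i hi
    refine (measure_mono fun ω hω => ?_).trans hi
    rw [Set.mem_ofPred_eq] at hω ⊢
    have h0 := mul_nonneg (abs_nonneg C) (ha i)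
    split_ifs at hω with hab
    · refine lt_of_le_of_lt ?_ hω
      have h1 := mul_le_mul_of_nonneg_right (le_abs_self C) (add_nonneg (ha i) (hb i))
      have h2 := mul_le_mul_of_nonneg_left hab (abs_nonneg C)
      linarith
    · rw [abs_zero] at hω
      linarith
  · obtain ⟨C, hC⟩ := h δ hδ
    refine ⟨2 * |C|, ?_⟩
    filter_upwards [hC] with i hi
    refine (measure_mono fun ω hω => ?_).trans hi
    rw [Set.mem_ofPred_eq] at hω ⊢
    have h0 := mul_nonneg (abs_nonneg C) (hb i)
    split_ifs at hω with hab
    · rw [abs_zero] at hω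
      linarith
    · refine lt_of_le_of_lt ?_ hω
      have h1 := mul_le_mul_of_nonneg_right (le_abs_self C) (add_nonneg (ha i) (hb i))
      have h2 := mul_le_mul_of_nonneg_left (not_le.1 hab).le (abs_nonneg C)
      linarith

end BigOp

/-! ### Asymptotics -/

section Main

variable {Ω : Type*} [MeasurableSpace Ω] {P : Measure Ω} [IsProbabilityMeasure P] {m : ℕ}
  {Λ : (N : ℕ) → Matrix (Fin N) (Fin m) ℝ} {A : (N : ℕ) → Matrix (Fin N) (Fin N) ℝ}
  {V : Matrix (Fin m) (Fin m) ℝ}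
  {ξ : ℕ → ℕ → Ω → ℝ} {g : (N : ℕ) → ℕ → Ω → Fin m ⊕ Fin N → ℝ}
  {f : (N : ℕ) → ℕ → Ω → Fin m → ℝ} {e y : (N : ℕ) → ℕ → Ω → Fin N → ℝ}
  {L : (N : ℕ) → ℕ → Ω → Matrix (Fin N) (Fin m) ℝ}

/-- `L` is a loading estimate, the leading sample eigenvalues are at least `c`, and the residual
part of the sample Kendall's tau matrix has operator norm at most `Δ`. -/
structure GoodSample {N : ℕ} (T : ℕ) (Λ : Matrix (Fin N) (Fin m) ℝ) (f : ℕ → Fin m → ℝ)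
    (y : ℕ → Fin N → ℝ) (L : Matrix (Fin N) (Fin m) ℝ) (c Δ : ℝ) : Prop where
  loading : IsRTSLoading T y L
  eig : ∀ j : Fin m, c ≤ descEig (kendall_isHermitian T y) j
  residual_le : ∀ x, (residual T Λ f y *ᵥ x) ⬝ᵥ (residual T Λ f y *ᵥ x) ≤ Δ ^ 2 * (x ⬝ᵥ x)

/-- The constants `c` and `C` are fixed before `δ`; only the stochastic part `S` of the residual
bound depends on the allowed failure probability. -/
theorem exists_eventually_goodSample (hModel : EllipticalFactorModel P m Λ A ξ g f e y)
    (hΛ : LoadingAssumption Λ V) (hA : NoiseAssumption A)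
    (hL : ∀ N T, m ≤ N → 2 ≤ T → ∀ᵐ ω ∂P, IsRTSLoading T (fun t => y N t ω) (L N T ω)) :
    ∃ c C : ℝ, 0 < c ∧ 0 ≤ C ∧ ∀ δ : ℝ, 0 < δ → ∃ S : ℝ, 0 < S ∧
      ∀ᶠ n : ℕ × ℕ in atTop ×ˢ atTop,
        P {ω | ¬GoodSample n.2 (Λ n.1) (fun t => f n.1 t ω) (fun t => y n.1 t ω) (L n.1 n.2 ω) c
          (2 * (C / n.1 + √(S / n.2)))} ≤ ENNReal.ofReal δ := by
  obtain ⟨B, c₁, c₂, hB, hc₁, hD⟩ := exists_designBounds hΛ hA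
  obtain ⟨Q, hQ0, hQ⟩ := exists_octicDesign m (B := B) (c₁ := c₁) (c₂ := c₂)
  obtain ⟨v₀, hv₀, hlow⟩ := hΛ.exists_eventually_lower_bound
  set c := signalBound B c₁ v₀ / 2 with hc
  have hc0 : 0 < c := by
    have := integral_abs_gaussianReal_pos
    rw [hc, signalBound]
    positivity
  set C : ℝ := 4 * m * (1 + 6 * Q) + (1 + 3 * Q) with hC
  have hC0 : 0 ≤ C := by positivity
  set q : ℝ := 2 + 2 * (B ^ 2 * m * (m * (1 + 6 * Q))) with hq
  have hq0 : 0 < q := by positivity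
  -- With deviation level `S / T`, this `S` makes the residual fail with probability at most `δ /
  -- 2`. The eigenvalues fail with at most `δ / 2` once `T ≥ 32 / (c² δ)`.
  refine ⟨c, C, hc0, hC0, fun δ hδ => ⟨32 * q / δ, by positivity, ?_⟩⟩
  set S := 32 * q / δ with hS
  have hS0 : 0 < S := by positivity
  have hNev : ∀ᶠ N : ℕ in atTop, 32 ≤ N ∧ m ≤ N ∧ ∀ b : Fin m → ℝ,
      v₀ * (b ⬝ᵥ b) ≤ b ⬝ᵥ (((N : ℝ)⁻¹ • ((Λ N)ᵀ * Λ N)) *ᵥ b) :=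
    (eventually_ge_atTop 32).and ((eventually_ge_atTop m).and hlow)
  have hTev : ∀ᶠ T : ℕ in atTop, 2 ≤ T ∧ 32 / (c ^ 2 * δ) ≤ (T : ℝ) :=
    (eventually_ge_atTop 2).and (tendsto_natCast_atTop_atTop.eventually_ge_atTop _)
  filter_upwards [hNev.prod_mk hTev] with n hn
  obtain ⟨⟨hN32, hNm, hlowN⟩, hT2, hTc⟩ := hn
  obtain ⟨N, T⟩ := n
  simp only at hN32 hNm hlowN hT2 hTc ⊢
  have hNpos : (0 : ℝ) < N := by exact_mod_cast (by omega : 0 < N)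
  have hTpos : (0 : ℝ) < T := by exact_mod_cast (by omega : 0 < T)
  have hlow' : ∀ b, N * v₀ * (b ⬝ᵥ b) ≤ (Λ N *ᵥ b) ⬝ᵥ (Λ N *ᵥ b) := by
    intro b
    have h1 := hlowN b
    rw [smul_mulVec, dotProduct_smul, smul_eq_mul, ← mulVec_mulVec,
      ← transpose_mulVec_dotProduct, transpose_transpose, le_inv_mul_iff₀ hNpos] at h1
    linarith
  have hp := hModel.prob_not_good_le (by omega : 2 ≤ N) (hD N) (hQ N _ _ hN32 (hD N)) hv₀ hlow' hT2
    (a := S / T) (by positivity)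
  rw [← hc, ← hC, ← hq, ← ENNReal.ofReal_add (by positivity) (by positivity)] at hp
  have hsmall : 16 * 1 / (T * c ^ 2) + 16 * q / (T * (S / T)) ≤ δ := by
    have e1 : 16 * 1 / (T * c ^ 2) ≤ δ / 2 := by
      rw [div_le_iff₀ (by positivity)] at hTc ⊢
      nlinarith
    have e2 : 16 * q / (T * (S / T)) = δ / 2 := by
      rw [mul_div_cancel₀ _ hTpos.ne', hS]
      field_simp
      norm_num
    linarith
  have hae : P {ω | ¬IsRTSLoading T (fun t => y N t ω) (L N T ω)} = 0 := hL N T hNm hT2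
  refine le_trans (le_trans (measure_mono fun ω hω => ?_) (measure_union_le _ _))
    ((add_le_add hae.le hp).trans ?_)
  · rw [Set.mem_ofPred_eq] at hω
    by_contra hnot
    rw [Set.mem_union, not_or, Set.mem_ofPred_eq, Set.mem_ofPred_eq, not_not, not_not] at hnot
    refine hω ⟨hnot.1, hnot.2.1, fun x => (hnot.2.2 x).trans ?_⟩
    refine mul_le_mul_of_nonneg_right ?_ (dotProduct_self_nonneg' x)
    have h1 : √(S / T) ^ 2 = S / T := Real.sq_sqrt (by positivity)
    have h2 : 0 ≤ C / N := by positivity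
    nlinarith [mul_nonneg h2 (Real.sqrt_nonneg (S / T)), sq_nonneg (C / N),
      sq_nonneg (√(S / T)), h1]
  · rw [zero_add]
    exact ENNReal.ofReal_le_ofReal hsmall

/-- `√N (C/N + √(S/T)) = C N^(-1/2) + √S (N/T)^(1/2)`, so the residual norm turns directly into the
two rates. -/
theorem isBigOp_maxError (hModel : EllipticalFactorModel P m Λ A ξ g f e y)
    (hΛ : LoadingAssumption Λ V) (hA : NoiseAssumption A)
    (hL : ∀ N T, m ≤ N → 2 ≤ T → ∀ᵐ ω ∂P, IsRTSLoading T (fun t => y N t ω) (L N T ω)) :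
    IsBigOp P (atTop ×ˢ atTop) (fun (n : ℕ × ℕ) ω => maxError (L n.1 n.2 ω) (Λ n.1)
      (rotation n.2 (Λ n.1) (fun t => f n.1 t ω) (fun t => y n.1 t ω) (L n.1 n.2 ω)))
      fun n => (n.1 : ℝ) ^ (-(1 / 2) : ℝ) + ((n.1 : ℝ) / (n.2 : ℝ)) ^ (1 / 2 : ℝ) := by
  obtain ⟨c, C, hc, hC, h⟩ := exists_eventually_goodSample hModel hΛ hA hL
  intro δ hδ
  obtain ⟨S, hS, hev⟩ := h δ hδ
  refine ⟨m * (2 / c) * (C + √S), ?_⟩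
  have hpos : ∀ᶠ n : ℕ × ℕ in atTop ×ˢ atTop, 0 < n.1 ∧ 0 < n.2 :=
    (eventually_gt_atTop 0).prod_mk (eventually_gt_atTop 0)
  filter_upwards [hev, hpos] with n hn hn0
  refine (measure_mono fun ω hω => ?_).trans hn
  rw [Set.mem_ofPred_eq] at hω ⊢
  intro hG
  obtain ⟨N, T⟩ := n
  simp only at hω hG hn0
  have hNpos : (0 : ℝ) < N := by exact_mod_cast hn0.1
  have hTpos : (0 : ℝ) < T := by exact_mod_cast hn0.2
  have hb := maxError_le hG.loading hc (by positivity) hG.eig hG.residual_le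
  have h0 : 0 ≤ maxError (L N T ω) (Λ N)
      (rotation T (Λ N) (fun t => f N t ω) (fun t => y N t ω) (L N T ω)) :=
    Real.iSup_nonneg fun i => l2norm_nonneg _
  rw [abs_of_nonneg h0] at hω
  have hr1 : (N : ℝ) ^ (-(1 / 2) : ℝ) = (√N)⁻¹ := by
    rw [Real.rpow_neg hNpos.le, Real.sqrt_eq_rpow]
  have hr2 : ((N : ℝ) / T) ^ (1 / 2 : ℝ) = √N / √T := by
    rw [← Real.sqrt_eq_rpow, Real.sqrt_div hNpos.le]
  rw [hr1, hr2] at hω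
  have hsN : 0 < √(N : ℝ) := Real.sqrt_pos.2 hNpos
  have hsT : 0 < √(T : ℝ) := Real.sqrt_pos.2 hTpos
  have hsS : 0 ≤ √S := Real.sqrt_nonneg _
  have hkey : (m : ℝ) * (2 * (C / N + √(S / T)) / c * √N) =
      m * (2 / c) * (C * (√N)⁻¹ + √S * (√N / √T)) := by
    rw [Real.sqrt_div hS.le]
    have : C / (N : ℝ) = C * (√N)⁻¹ * (√N)⁻¹ := by
      rw [mul_assoc, inv_sqrt_sq, div_eq_mul_inv]
    rw [this]
    field_simp
  rw [hkey] at hb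
  have hle : C * (√N)⁻¹ + √S * (√N / √T) ≤ (C + √S) * ((√N)⁻¹ + √N / √T) := by
    have e1 : 0 ≤ C * (√N / √T) := by positivity
    have e2 : 0 ≤ √S * (√(N : ℝ))⁻¹ := by positivity
    nlinarith
  have hfin := hb.trans (mul_le_mul_of_nonneg_left hle (by positivity : 0 ≤ (m : ℝ) * (2 / c)))
  rw [← mul_assoc] at hfin
  linarith

theorem tendstoInMeasure_rotation (hModel : EllipticalFactorModel P m Λ A ξ g f e y)
    (hΛ : LoadingAssumption Λ V) (hA : NoiseAssumption A)
    (hL : ∀ N T, m ≤ N → 2 ≤ T → ∀ᵐ ω ∂P, IsRTSLoading T (fun t => y N t ω) (L N T ω))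
    (i j : Fin m) :
    TendstoInMeasure P (fun (n : ℕ × ℕ) ω =>
      ((rotation n.2 (Λ n.1) (fun t => f n.1 t ω) (fun t => y n.1 t ω) (L n.1 n.2 ω))ᵀ * V *
        rotation n.2 (Λ n.1) (fun t => f n.1 t ω) (fun t => y n.1 t ω) (L n.1 n.2 ω)) i j)
      (atTop ×ˢ atTop) (fun _ => (1 : Matrix (Fin m) (Fin m) ℝ) i j) := by
  obtain ⟨c, C, hc, hC, h⟩ := exists_eventually_goodSample hModel hΛ hA hL
  obtain ⟨v₀, hv₀, hlow⟩ := hΛ.exists_eventually_lower_bound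
  rw [tendstoInMeasure_iff_norm]
  intro ε hε
  rw [ENNReal.tendsto_nhds_zero]
  intro δ hδ
  obtain ⟨δ', hδ'0, hδ'⟩ : ∃ δ' : ℝ, 0 < δ' ∧ ENNReal.ofReal δ' ≤ δ := by
    rcases eq_or_ne δ ⊤ with rfl | hδt
    · exact ⟨1, one_pos, le_top⟩
    · exact ⟨δ.toReal, ENNReal.toReal_pos hδ.ne' hδt, ENNReal.ofReal_toReal_le⟩
  obtain ⟨S, hS, hev⟩ := h δ' hδ'0
  set ε' : ℝ := ε / 2 / ((m + 1) * (4 / v₀)) with hε'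
  have hε'0 : 0 < ε' := by positivity
  -- `Δ ≤ c` is needed for the rotation bound, and `Δ ≤ ε c / 8` gives `3Δ/c ≤ 3ε/8`, strictly below
  -- `ε/2`. The choice of `ε'` keeps the other term within `ε/2`.
  set η : ℝ := min c (ε * c / 8) with hη
  have hη0 : 0 < η := by positivity
  have hΔ : Tendsto (fun n : ℕ × ℕ => 2 * (C / (n.1 : ℝ) + √(S / (n.2 : ℝ))))
      (atTop ×ˢ atTop) (𝓝 0) := by
    have t1 : Tendsto (fun n : ℕ × ℕ => C / (n.1 : ℝ)) (atTop ×ˢ atTop) (𝓝 0) :=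
      (tendsto_const_div_atTop_nhds_zero_nat C).comp tendsto_fst
    have t2 : Tendsto (fun n : ℕ × ℕ => √(S / (n.2 : ℝ))) (atTop ×ˢ atTop) (𝓝 0) := by
      have t3 := (tendsto_const_div_atTop_nhds_zero_nat S).sqrt
      rw [Real.sqrt_zero] at t3
      exact t3.comp tendsto_snd
    simpa using (t1.add t2).const_mul 2
  have hpos : ∀ᶠ n : ℕ × ℕ in atTop ×ˢ atTop, 0 < n.1 :=
    tendsto_fst.eventually (eventually_gt_atTop 0)
  filter_upwards [hev, hpos, hΔ.eventually_le_const hη0,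
    tendsto_fst.eventually hlow, tendsto_fst.eventually (hΛ.eventually_abs_sub_le hε'0)]
    with n hn hn0 hnη hnl hnε
  refine (measure_mono fun ω hω => ?_).trans (hn.trans hδ')
  rw [Set.mem_ofPred_eq] at hω ⊢
  intro hG
  obtain ⟨N, T⟩ := n
  simp only at hω hG hn0 hnη hnl hnε
  set Δ := 2 * (C / (N : ℝ) + √(S / (T : ℝ))) with hΔdef
  have hΔ0 : 0 ≤ Δ := by positivity
  have hb := abs_rotation_sub_one_le hn0 hG.loading hc hΔ0 (hnη.trans (min_le_left _ _)) hG.eig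
    hG.residual_le hε'0.le hv₀ hnε hnl i j
  rw [Real.norm_eq_abs] at hω
  have e1 : 3 * (Δ / c) < ε / 2 := by
    have : Δ ≤ ε * c / 8 := hnη.trans (min_le_right _ _)
    rw [← mul_div_assoc, div_lt_iff₀ hc]
    nlinarith [mul_pos hε hc]
  have e2 : ε' * m * (4 / v₀) ≤ ε / 2 := by
    rw [hε', div_mul_eq_mul_div, div_mul_eq_mul_div, div_le_iff₀ (by positivity)]
    have : 0 < 4 / v₀ := by positivity
    nlinarith [mul_pos hε this]
  linarith

end Main

end RTS

end

theorem proposition2 {Ω : Type*} [MeasurableSpace Ω] (P : Measure Ω) [IsProbabilityMeasure P]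
    (m : ℕ) (Λ : (N : ℕ) → Matrix (Fin N) (Fin m) ℝ) (A : (N : ℕ) → Matrix (Fin N) (Fin N) ℝ)
    (V : Matrix (Fin m) (Fin m) ℝ)
    (ξ : ℕ → ℕ → Ω → ℝ) (g : (N : ℕ) → ℕ → Ω → Fin m ⊕ Fin N → ℝ)
    (f : (N : ℕ) → ℕ → Ω → Fin m → ℝ) (e y : (N : ℕ) → ℕ → Ω → Fin N → ℝ)
    (hModel : RTS.EllipticalFactorModel P m Λ A ξ g f e y)
    (hLoading : RTS.LoadingAssumption Λ V)
    (hNoise : RTS.NoiseAssumption A)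
    (L : (N : ℕ) → ℕ → Ω → Matrix (Fin N) (Fin m) ℝ)
    (hL : ∀ N T, m ≤ N → 2 ≤ T → ∀ᵐ ω ∂P, RTS.IsRTSLoading T (fun t => y N t ω) (L N T ω))
    (H : ℕ → ℕ → Ω → Matrix (Fin m) (Fin m) ℝ)
    (hH : ∀ N T ω, H N T ω =
      RTS.rotation T (Λ N) (fun t => f N t ω) (fun t => y N t ω) (L N T ω)) :
    (∀ i j, TendstoInMeasure P
      (fun (n : ℕ × ℕ) ω => ((H n.1 n.2 ω)ᵀ * V * H n.1 n.2 ω) i j)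
      (atTop ×ˢ atTop) (fun _ => (1 : Matrix (Fin m) (Fin m) ℝ) i j)) ∧
    ∃ R₁ R₂ : ℕ × ℕ → Ω → ℝ,
      (∀ N T ω, RTS.maxError (L N T ω) (Λ N) (H N T ω) = R₁ (N, T) ω + R₂ (N, T) ω) ∧
      RTS.IsBigOp P (atTop ×ˢ atTop) R₁ (fun n => (n.1 : ℝ) ^ (-(1 / 2) : ℝ)) ∧
      RTS.IsBigOp P (atTop ×ˢ atTop) R₂ (fun n => ((n.1 : ℝ) / (n.2 : ℝ)) ^ (1 / 2 : ℝ)) := by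
  simp only [hH]
  refine ⟨RTS.tendstoInMeasure_rotation hModel hLoading hNoise hL, ?_⟩
  obtain ⟨R₁, R₂, h, h₁, h₂⟩ := RTS.exists_isBigOp_add
    (fun n => Real.rpow_nonneg (Nat.cast_nonneg _) _)
    (fun n => Real.rpow_nonneg (div_nonneg (Nat.cast_nonneg _) (Nat.cast_nonneg _)) _)
    (RTS.isBigOp_maxError hModel hLoading hNoise hL)
  exact ⟨R₁, R₂, fun N T ω => h (N, T) ω, h₁, h₂⟩
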